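/- A \emph{$\pi/3$-equiangular polyhedron} in hyperbolic $3$-space $\mathbb{H}^3$ is a set $P\subset\mathbb{H}^3$ that is the intersection of finitely many closed half-spaces, has non-empty interior and finite volume, and all of whose dihedral angles (between faces that meet in an edge) are equal to $\pi/3$. Let $P_1$ be the regular ideal tetrahedron and $P_2$ the regular ideal cube in $\mathbb{H}^3$, i.e. the hyperbolic convex hulls of the vertices of a regular tetrahedron, respectively a cube, inscribed in the sphere at infinity of the ball model. \textbf{Theorem.} Among all $\pi/3$-equiangular polyhedra in $\mathbb{H}^3$, the cube $P_2$ has the second smallest volume, and only $P_1$ has smaller volume. Precisely: $P_1$ and $P_2$ are $\pi/3$-equiangular polyhedra, $\operatorname{vol}(P_1)<\operatorname{vol}(P_2)$, and every $\pi/3$-equiangular polyhedron $P\subset\mathbb{H}^3$ satisfies exactly one of the following: $P$ is isometric to $P_1$ (and then $\operatorname{vol}(P)=\operatorname{vol}(P_1)$); $P$ is isometric to $P_2$ (and then $\operatorname{vol}(P)=\operatorname{vol}(P_2)$); or $\operatorname{vol}(P)>\operatorname{vol}(P_2)$. -/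

import Mathlib

open MeasureTheory

noncomputable section

namespace HypPoly

/-- Euclidean three-space. -/
abbrev E3 : Type := EuclideanSpace ℝ (Fin 3)

/-- The vector space underlying Minkowski space `ℝ^{1,3}`: a time and a space coordinate. -/
abbrev Mink : Type := ℝ × E3

/-- The Lorentzian inner product, of signature `(-,+,+,+)`. -/
def lor (v w : Mink) : ℝ := -(v.1 * w.1) + inner ℝ v.2 w.2

/-- Hyperbolic three-space: the upper sheet of the hyperboloid `⟨v, v⟩ = -1`. -/
def H3 : Type := {v : Mink // lor v v = -1 ∧ 0 < v.1}

instance : MeasurableSpace H3 :=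
  inferInstanceAs (MeasurableSpace {v : Mink // lor v v = -1 ∧ 0 < v.1})

/-- The hyperbolic distance: `cosh d(x, y) = -⟨x, y⟩`. -/
def hdist (x y : H3) : ℝ := Real.arcosh (-lor x.1 y.1)

/-- Two subsets of hyperbolic space are congruent if an isometry of hyperbolic space carries the
first onto the second. -/
def Congruent (P Q : Set H3) : Prop :=
  ∃ φ : H3 ≃ H3, (∀ x y, hdist (φ x) (φ y) = hdist x y) ∧ φ '' P = Q

/-- The point of the hyperboloid with given space coordinate. -/
def lift (y : E3) : H3 :=
  ⟨(√(1 + ‖y‖ ^ 2), y), by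
    have h : (0 : ℝ) < 1 + ‖y‖ ^ 2 := by positivity
    refine ⟨?_, Real.sqrt_pos.mpr h⟩
    simp only [lor, Real.mul_self_sqrt h.le, real_inner_self_eq_norm_sq]
    ring⟩

/-- The hyperbolic volume, `dy₁ dy₂ dy₃ / √(1 + |y|²)` in the space coordinates of the
hyperboloid model. -/
def vol : Measure H3 :=
  ((volume : Measure E3).withDensity
    fun y => ENNReal.ofReal (1 / √(1 + ‖y‖ ^ 2))).map lift

/-- The closed half-space with outward normal `e` (used for `⟨e, e⟩ = 1`). -/
def halfSpace (e : Mink) : Set H3 := {x | lor x.1 e ≤ 0}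

/-- The hyperplane with normal `e` (used for `⟨e, e⟩ = 1`). -/
def hyperplane (e : Mink) : Set H3 := {x | lor x.1 e = 0}

/-- The dimension of the linear span of a set of points of the hyperboloid. The smallest hyperbolic
subspace that contains a nonempty set has dimension one less. -/
def spanRank (A : Set H3) : ℕ :=
  Module.finrank ℝ (Submodule.span ℝ ((fun x : H3 => x.1) '' A))

/-- A convex polyhedron: an intersection of finitely many closed half-spaces that has an interior
point. -/
def IsConvexPolyhedron (P : Set H3) : Prop :=
  (∃ N : Finset Mink, (∀ e ∈ N, lor e e = 1) ∧ P = ⋂ e ∈ N, halfSpace e) ∧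
    ∃ x, ∃ r > 0, {y | hdist x y < r} ⊆ P

/-- The unit vector `e` is the outward normal of a (two-dimensional) face of `P`; that face is
`P ∩ hyperplane e`. -/
def IsFaceNormal (P : Set H3) (e : Mink) : Prop :=
  lor e e = 1 ∧ P ⊆ halfSpace e ∧ spanRank (P ∩ hyperplane e) = 3

/-- The faces of `P` with outward normals `e` and `f` are distinct and meet in an edge, that is, in
a one-dimensional set. -/
def Adjacent (P : Set H3) (e f : Mink) : Prop :=
  IsFaceNormal P e ∧ IsFaceNormal P f ∧ e ≠ f ∧
    spanRank ((P ∩ hyperplane e) ∩ (P ∩ hyperplane f)) = 2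

/-- The dihedral angle at the edge between two adjacent faces: `π` minus the angle between their
outward unit normals. The latter lie in the tangent space at any point of the edge, where the
Lorentzian inner product is the Riemannian metric. -/
def dihedralAngle (e f : Mink) : ℝ := Real.pi - Real.arccos (lor e f)

/-- A convex polyhedron of finite volume all of whose dihedral angles are equal to `θ`. -/
def IsEquiangular (θ : ℝ) (P : Set H3) : Prop :=
  IsConvexPolyhedron P ∧ vol P < ⊤ ∧ ∀ e f, Adjacent P e f → dihedralAngle e f = θ

/-- The hyperbolic convex hull in `H3` of a set `S` of ideal points, the sphere at infinity being
the unit sphere of `E3`: the convex hull is taken in the projective (Klein) model, to which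
`x ↦ x.space / x.time` maps the hyperboloid. -/
def idealHull (S : Set E3) : Set H3 := {x | (x.1.1)⁻¹ • x.1.2 ∈ convexHull ℝ S}

/-- The vertices of a cube inscribed in the unit sphere. -/
def cubeVertices : Set E3 := {v | ∀ i, v i = 1 / √3 ∨ v i = -(1 / √3)}

/-- The vertices of a regular tetrahedron inscribed in the unit sphere: every other vertex of the
cube. -/
def tetrahedronVertices : Set E3 := {v | v ∈ cubeVertices ∧ 0 < v 0 * v 1 * v 2}

/-- The regular ideal tetrahedron. -/
def P₁ : Set H3 := idealHull tetrahedronVertices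

/-- The regular ideal cube. -/
def P₂ : Set H3 := idealHull cubeVertices

end HypPoly

end

namespace HypPoly

/-! ### The Lorentzian form -/

/-! A polyhedron is encoded by its outward unit normals in Minkowski space. For dihedral angles `π /
3` the product of two normals is `-1 / 2` when the faces are adjacent and at most `-1` otherwise,
and finite volume means that the cone cut out by the half-spaces contains no spacelike vector
(`NormalSystem`). Three pairwise adjacent normals have a null sum, since three angles `π / 3` are
those of a Euclidean triangle. So the ends of the edges are ideal vertices with three faces each,
and every edge has exactly two of them.

Put such a vertex at infinity in the upper half-space model. The polyhedron lies in a prism over an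
equilateral triangle, normalised here to have altitude 1. The pairings with the three normals are
coordinates in which the Lorentzian form is explicit (`Frame.lor_eq`): a point that pairs to `-σ`
with the apex (the sum of the three normals) has height `1 / σ`, and a plane whose unit normal pairs
to `-m` is a hemisphere of radius `1 / m`. With `w = σ ^ 2` in place of the height, hyperbolic
volume becomes Lebesgue measure up to the constant `√3` (`Frame.volume_chart_image`).

If four faces are pairwise adjacent, there are no others, and the polyhedron is the regular
tetrahedron. Otherwise each ideal vertex gets a cell, the points that are closer to it than to any
other vertex as measured by the null sums. Every face not through the vertex pairs to at most `-2`
with its apex, and every vertex not joined to it by an edge pairs to at most `-6`. Hence the cell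
contains the prism `w < 3`, of chart volume `3 / 2`, except for the parts claimed by the three
neighbouring vertices. The three hemispheres beyond the edges compete for room over the triangle,
which bounds these parts by `1 / 2` in total. So `√3 * vol` is at least the number of vertices.

Without tetrahedra every face has at least four vertices, so seven faces force ten vertices and `√3
* vol ≥ 10`. If the three faces across the edges of some vertex are pairwise adjacent, all their
products are determined and the polyhedron is the regular cube; if not, a seventh face appears.
Equal products give congruent polyhedra (`Frame.congruent`). Finally `√3 * vol P₂ ≤ 143 / 15 < 10`,
by cutting the cube into 48 sectors and bounding the integrand by a polynomial. -/

lemma lor_comm (v w : Mink) : lor v w = lor w v := by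
  simp only [lor, real_inner_comm]; ring

lemma lor_add_left (u v w : Mink) : lor (u + v) w = lor u w + lor v w := by
  simp only [lor, Prod.fst_add, Prod.snd_add, inner_add_left]; ring

lemma lor_smul_left (c : ℝ) (v w : Mink) : lor (c • v) w = c * lor v w := by
  simp only [lor, Prod.smul_fst, Prod.smul_snd, inner_smul_left, smul_eq_mul]
  simp; ring

lemma lor_add_right (u v w : Mink) : lor u (v + w) = lor u v + lor u w := by
  rw [lor_comm, lor_add_left, lor_comm v, lor_comm w]

lemma lor_smul_right (c : ℝ) (v w : Mink) : lor v (c • w) = c * lor v w := by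
  rw [lor_comm, lor_smul_left, lor_comm w]

lemma lor_neg_left (v w : Mink) : lor (-v) w = -lor v w := by
  rw [← neg_one_smul ℝ v, lor_smul_left]; ring

lemma lor_neg_right (v w : Mink) : lor v (-w) = -lor v w := by
  rw [lor_comm, lor_neg_left, lor_comm]

lemma lor_sub_left (u v w : Mink) : lor (u - v) w = lor u w - lor v w := by
  rw [sub_eq_add_neg, lor_add_left, lor_neg_left]; ring

lemma lor_sub_right (u v w : Mink) : lor u (v - w) = lor u v - lor u w := by
  rw [sub_eq_add_neg, lor_add_right, lor_neg_right]; ring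

lemma lor_zero_left (v : Mink) : lor 0 v = 0 := by simp [lor]

lemma lor_zero_right (v : Mink) : lor v 0 = 0 := by simp [lor]

/-- Pairing with a fixed vector, as a linear functional. -/
noncomputable def lorL (e : Mink) : Mink →ₗ[ℝ] ℝ where
  toFun x := lor x e
  map_add' x y := lor_add_left x y e
  map_smul' c x := lor_smul_left c x e

@[simp] lemma lorL_apply (e x : Mink) : lorL e x = lor x e := rfl

lemma lor_sum_left {ι : Type*} (s : Finset ι) (f : ι → Mink) (w : Mink) :
    lor (∑ i ∈ s, f i) w = ∑ i ∈ s, lor (f i) w := by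
  exact map_sum (lorL w) f s

lemma lor_self (v : Mink) : lor v v = ‖v.2‖ ^ 2 - v.1 ^ 2 := by
  simp only [lor, real_inner_self_eq_norm_sq]; ring

lemma continuous_lor : Continuous fun p : Mink × Mink => lor p.1 p.2 := by
  unfold lor; fun_prop

lemma Continuous.lor' {X : Type*} [TopologicalSpace X] {f g : X → Mink} (hf : Continuous f)
    (hg : Continuous g) : Continuous fun x => lor (f x) (g x) :=
  continuous_lor.comp (hf.prodMk hg)

lemma eq_zero_of_lor_eq_zero {v : Mink} (h : ∀ w, lor v w = 0) : v = 0 := by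
  have h1 := h (1, 0)
  have h2 := h (0, v.2)
  simp only [lor, inner_zero_right, mul_one, mul_zero, neg_zero, zero_add, add_zero,
    real_inner_self_eq_norm_sq] at h1 h2
  ext1
  · simpa using h1
  · simpa using h2

lemma finrank_mink : Module.finrank ℝ Mink = 4 := by simp [Mink, E3]

/-! ### Causal vectors -/

lemma time_ne_zero {p : Mink} (hp : lor p p ≤ 0) (h0 : p ≠ 0) : p.1 ≠ 0 := by
  intro h
  rw [lor_self, h] at hp
  apply h0
  ext1
  · exact h
  · have : ‖p.2‖ ^ 2 = 0 := le_antisymm (by simpa using hp) (by positivity)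
    simpa using this

/-- On the orthogonal complement of a causal vector the form is positive semidefinite. -/
lemma lor_self_nonneg_of_orthogonal {p w : Mink} (hp : lor p p ≤ 0) (h0 : p ≠ 0)
    (h : lor p w = 0) : 0 ≤ lor w w ∧ (lor w w = 0 → ∃ c : ℝ, w = c • p) := by
  have hp1 := time_ne_zero hp h0
  set c := w.1 / p.1 with hc
  have hd : (w - c • p).1 = 0 := by
    simp [hc, div_mul_cancel₀ _ hp1]
  have key : ‖(w - c • p).2‖ ^ 2 = lor w w + c ^ 2 * lor p p := by
    have h1 := lor_self (w - c • p)
    rw [hd] at h1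
    simp only [lor_sub_left, lor_sub_right, lor_smul_left, lor_smul_right, h, lor_comm w p] at h1
    linarith
  have hc2 : c ^ 2 * lor p p ≤ 0 := mul_nonpos_of_nonneg_of_nonpos (sq_nonneg c) hp
  have hs := sq_nonneg ‖(w - c • p).2‖
  refine ⟨by linarith, fun hw => ⟨c, ?_⟩⟩
  have : ‖(w - c • p).2‖ ^ 2 = 0 := by linarith
  have h2 : (w - c • p).2 = 0 := by simpa using this
  have : w - c • p = 0 := Prod.ext hd h2
  exact sub_eq_zero.mp this

lemma lor_self_pos_of_orthogonal {p w : Mink} (hp : lor p p < 0) (h : lor p w = 0)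
    (hw : w ≠ 0) : 0 < lor w w := by
  have h0 : p ≠ 0 := by rintro rfl; simp [lor_zero_left] at hp
  obtain ⟨h1, h2⟩ := lor_self_nonneg_of_orthogonal hp.le h0 h
  refine lt_of_le_of_ne h1 fun h3 => ?_
  obtain ⟨c, rfl⟩ := h2 h3.symm
  rw [lor_smul_right] at h
  rcases mul_eq_zero.mp h with h | h
  · simp [h] at hw
  · exact hp.ne h

lemma norm_le_time {n : Mink} (h : lor n n ≤ 0) (h0 : 0 ≤ n.1) : ‖n.2‖ ≤ n.1 := by
  rw [lor_self] at h
  exact abs_le_of_sq_le_sq' (by linarith) h0 |>.2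

lemma norm_lt_time {n : Mink} (h : lor n n < 0) (h0 : 0 ≤ n.1) : ‖n.2‖ < n.1 := by
  rw [lor_self] at h
  exact abs_lt_of_sq_lt_sq' (by linarith) h0 |>.2

lemma lor_neg_of_future {x n : Mink} (hx : lor x x < 0) (hx0 : 0 < x.1) (hn : lor n n ≤ 0)
    (hn0 : 0 < n.1) : lor x n < 0 := by
  have h1 := norm_lt_time hx hx0.le
  have h2 := norm_le_time hn hn0.le
  have h3 := real_inner_le_norm x.2 n.2
  have h4 : ‖x.2‖ * ‖n.2‖ ≤ ‖x.2‖ * n.1 := by gcongr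
  have h5 : ‖x.2‖ * n.1 < x.1 * n.1 := by gcongr
  unfold lor; linarith

lemma H3.lor_neg (x : H3) {n : Mink} (hn : lor n n ≤ 0) (hn0 : 0 < n.1) : lor x.1 n < 0 :=
  lor_neg_of_future (by rw [x.2.1]; norm_num) x.2.2 hn hn0

lemma future_of_lor_neg {x n : Mink} (hx : lor x x < 0) (hn : lor n n ≤ 0) (hn0 : 0 < n.1)
    (h : lor x n < 0) : 0 < x.1 := by
  have hx0 : x ≠ 0 := by rintro rfl; simp [lor_zero_left] at hx
  rcases lt_or_gt_of_ne (time_ne_zero hx.le hx0) with h1 | h1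
  · have := lor_neg_of_future (x := -x) (n := n) (by simpa [lor_neg_left, lor_neg_right] using hx)
      (by simpa using h1) hn hn0
    rw [lor_neg_left] at this; linarith
  · exact h1

lemma future_of_lor_neg_H3 (x : H3) {n : Mink} (hn : lor n n ≤ 0) (h : lor x.1 n < 0) :
    0 < n.1 := by
  have hn0 : n ≠ 0 := by rintro rfl; simp [lor_zero_right] at h
  rcases lt_or_gt_of_ne (time_ne_zero hn hn0) with h1 | h1
  · have := x.lor_neg (n := -n) (by simpa [lor_neg_left, lor_neg_right] using hn)
      (by simpa using h1)
    rw [lor_neg_right] at this; linarith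
  · exact h1

lemma exists_H3_smul {w : Mink} (hw : lor w w < 0) (h0 : 0 < w.1) :
    ∃ x : H3, ∃ c : ℝ, 0 < c ∧ w = c • x.1 := by
  have hs : 0 < √(-lor w w) := Real.sqrt_pos.mpr (by linarith)
  refine ⟨⟨(√(-lor w w))⁻¹ • w, ?_, ?_⟩, √(-lor w w), hs, ?_⟩
  · rw [lor_smul_left, lor_smul_right, ← mul_assoc, ← mul_inv, Real.mul_self_sqrt (by linarith)]
    rw [inv_mul_eq_div, neg_eq_neg_one_mul, div_mul_cancel_right₀ hw.ne]; norm_num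
  · simp only [Prod.smul_fst, smul_eq_mul]; positivity
  · simp [smul_smul, hs.ne']

/-- The vector `e + f` is orthogonal to the causal vector `p`, so its square `2 + 2 * lor e f` is
nonnegative and vanishes only on the line of `p`. Two planes through a common point or ideal point
cannot have product below `-1`. -/
lemma lor_lt_of_timelike_perp {p e f : Mink} (hp : lor p p ≤ 0) (h0 : p ≠ 0)
    (he : lor e e = 1) (hf : lor f f = 1) (hpe : lor p e = 0) (hpf : lor p f = 0) :
    -1 ≤ lor e f ∧ (lor e f = -1 → ∃ c : ℝ, e + f = c • p) := by
  have h := lor_self_nonneg_of_orthogonal (w := e + f) hp h0 (by rw [lor_add_right, hpe, hpf]; simp)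
  have e1 : lor (e + f) (e + f) = 2 + 2 * lor e f := by
    simp only [lor_add_left, lor_add_right, he, hf, lor_comm f e]; ring
  rw [e1] at h
  exact ⟨by linarith [h.1], fun hh => h.2 (by rw [hh]; ring)⟩

/-- The orthogonal projection of an interior point to an edge line. -/
lemma exists_edge_proj (x : H3) {e f : Mink} (he : lor e e = 1) (hf : lor f f = 1)
    (hc : -1 < lor e f) (hc0 : lor e f ≤ 0) (hxe : lor x.1 e < 0) (hxf : lor x.1 f < 0) :
    ∃ z : Mink, lor z e = 0 ∧ lor z f = 0 ∧ lor z z < 0 ∧ 0 < z.1 ∧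
      ∀ g, lor e g ≤ 0 → lor f g ≤ 0 → lor x.1 g < 0 → lor z g < 0 := by
  set c := lor e f with hcdef
  have hD : 0 < 1 - c ^ 2 := by nlinarith
  -- These coefficients solve the Gram system that makes `x - α e - β f` orthogonal to `e` and `f`.
  -- As `c ≤ 0` both are negative, so the projection adds positive multiples of `e` and `f` and
  -- preserves negative pairings with every `g` that pairs nonpositively with both.
  set α := (lor x.1 e - c * lor x.1 f) / (1 - c ^ 2) with hα
  set β := (lor x.1 f - c * lor x.1 e) / (1 - c ^ 2) with hβ
  have hα0 : α < 0 := div_neg_of_neg_of_pos (by nlinarith) hD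
  have hβ0 : β < 0 := div_neg_of_neg_of_pos (by nlinarith) hD
  have h1 : lor x.1 e = α + β * c := by rw [hα, hβ]; field_simp; ring
  have h2 : lor x.1 f = α * c + β := by rw [hα, hβ]; field_simp; ring
  have hfe : lor f e = c := lor_comm _ _
  have hze : lor (x.1 - α • e - β • f) e = 0 := by
    simp only [lor_sub_left, lor_smul_left, he, hfe, h1]; ring
  have hzf : lor (x.1 - α • e - β • f) f = 0 := by
    simp only [lor_sub_left, lor_smul_left, hf, ← hcdef, h2]; ring
  have hzx : lor (x.1 - α • e - β • f) x.1 < 0 := by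
    simp only [lor_sub_left, lor_smul_left, x.2.1, lor_comm e, lor_comm f]
    nlinarith [mul_pos_of_neg_of_neg hα0 hxe, mul_pos_of_neg_of_neg hβ0 hxf]
  have hzz : lor (x.1 - α • e - β • f) (x.1 - α • e - β • f) < 0 := by
    rw [lor_sub_right, lor_sub_right, lor_smul_right, lor_smul_right, hze, hzf]; simpa using hzx
  refine ⟨x.1 - α • e - β • f, hze, hzf, hzz, ?_, ?_⟩
  · exact future_of_lor_neg hzz (by rw [x.2.1]; norm_num) x.2.2 hzx
  · intro g h3 h4 h5
    simp only [lor_sub_left, lor_smul_left]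
    nlinarith [mul_nonneg_of_nonpos_of_nonpos hα0.le h3, mul_nonneg_of_nonpos_of_nonpos hβ0.le h4]

/-- The orthogonal projection of an interior point to a face plane. -/
lemma exists_face_proj (x : H3) {e : Mink} (he : lor e e = 1) (hxe : lor x.1 e < 0) :
    ∃ z : Mink, lor z e = 0 ∧ lor z z < 0 ∧ 0 < z.1 ∧
      ∀ g, lor e g ≤ 0 → lor x.1 g < 0 → lor z g < 0 := by
  have hze : lor (x.1 - lor x.1 e • e) e = 0 := by
    simp only [lor_sub_left, lor_smul_left, he]; ring
  have hzx : lor (x.1 - lor x.1 e • e) x.1 < 0 := by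
    simp only [lor_sub_left, lor_smul_left, x.2.1, lor_comm e]
    nlinarith
  have hzz : lor (x.1 - lor x.1 e • e) (x.1 - lor x.1 e • e) < 0 := by
    rw [lor_sub_right, lor_smul_right, hze]; simpa using hzx
  refine ⟨x.1 - lor x.1 e • e, hze, hzz, ?_, ?_⟩
  · exact future_of_lor_neg hzz (by rw [x.2.1]; norm_num) x.2.2 hzx
  · intro g h3 h5
    simp only [lor_sub_left, lor_smul_left]
    nlinarith [mul_nonneg_of_nonpos_of_nonpos hxe.le h3]

/-! ### Faces, edges and ends of edges of a system of normals -/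

/-- The outward unit normals of a polyhedron of finite volume whose dihedral angles are `π / 3`:
faces are adjacent when their normals have product `-1 / 2`, and otherwise their planes do not
cross. -/
structure NormalSystem (N : Finset Mink) : Prop where
  unit : ∀ e ∈ N, lor e e = 1
  interior : ∃ x : H3, ∀ e ∈ N, lor x.1 e < 0
  gram : ∀ e ∈ N, ∀ f ∈ N, e ≠ f → lor e f = -1 / 2 ∨ lor e f ≤ -1
  causal : ∀ w, (∀ e ∈ N, lor w e ≤ 0) → lor w w ≤ 0

namespace NormalSystem

variable {N : Finset Mink}

lemma le_neg_half (h : NormalSystem N) {e f : Mink} (he : e ∈ N) (hf : f ∈ N) (hef : e ≠ f) :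
    lor e f ≤ -1 / 2 := by
  rcases h.gram e he f hf hef with h | h <;> linarith

lemma ne_of_adj (h : NormalSystem N) {e f : Mink} (he : e ∈ N) (hef : lor e f = -1 / 2) :
    e ≠ f := by
  rintro rfl
  rw [h.unit e he] at hef; norm_num at hef

/-- A ray in a spacelike direction leaves the polyhedral cone through some face. -/
lemma exists_exit (h : NormalSystem N) {z u : Mink} (hz : ∀ e ∈ N, lor z e ≤ 0)
    (hu : 0 < lor u u) :
    ∃ s : ℝ, 0 ≤ s ∧ ∃ g ∈ N, 0 < lor u g ∧ lor (z + s • u) g = 0 ∧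
      ∀ e ∈ N, lor (z + s • u) e ≤ 0 := by
  have hne : (N.filter fun g => 0 < lor u g).Nonempty := by
    by_contra hc
    rw [Finset.not_nonempty_iff_eq_empty, Finset.filter_eq_empty_iff] at hc
    have := h.causal u fun e he => not_lt.mp (hc he)
    linarith
  obtain ⟨g, hg, hmin⟩ := Finset.exists_min_image _ (fun g => -lor z g / lor u g) hne
  rw [Finset.mem_filter] at hg
  refine ⟨-lor z g / lor u g, div_nonneg (by linarith [hz g hg.1]) hg.2.le, g, hg.1, hg.2, ?_, ?_⟩
  · rw [lor_add_left, lor_smul_left, div_mul_cancel₀ _ hg.2.ne']; ring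
  · intro e he
    rw [lor_add_left, lor_smul_left]
    have h0 : 0 ≤ -lor z g / lor u g := div_nonneg (by linarith [hz g hg.1]) hg.2.le
    rcases le_or_gt (lor u e) 0 with h1 | h1
    · nlinarith [hz e he]
    · have := hmin e (Finset.mem_filter.mpr ⟨he, h1⟩)
      rw [le_div_iff₀ h1] at this
      linarith

/-- The exit point lies in the cone, hence is an ordinary or an ideal point by `causal`. It is
nonzero because its pairing with `z` is still `lor z z`. -/
lemma exists_exit_causal (h : NormalSystem N) {z u : Mink} (hz : ∀ e ∈ N, lor z e ≤ 0)
    (hzz : lor z z < 0) (hzu : lor z u = 0) (hu : u ≠ 0) :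
    ∃ s : ℝ, ∃ g ∈ N, 0 < lor u g ∧ lor (z + s • u) g = 0 ∧ lor (z + s • u) (z + s • u) ≤ 0 ∧
      z + s • u ≠ 0 := by
  obtain ⟨s, -, g, hg, hug, h0, h1⟩ := h.exists_exit hz (lor_self_pos_of_orthogonal hzz hzu hu)
  refine ⟨s, g, hg, hug, h0, h.causal _ h1, fun h2 => ?_⟩
  have : lor z (z + s • u) = 0 := by rw [h2, lor_zero_right]
  rw [lor_add_right, lor_smul_right, hzu] at this
  linarith

/-- Shoot rays from an interior point `z` of the face in infinitely many directions of its plane. A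
ray that leaves through a face not adjacent to `e` ends where the two planes are tangent at
infinity, so its end spans the line of `e + g` and is determined by `g`. Finitely many faces cannot
absorb all the rays in this way. -/
lemma exists_adj (h : NormalSystem N) {e : Mink} (he : e ∈ N) : ∃ f ∈ N, lor e f = -1 / 2 := by
  obtain ⟨x, hx⟩ := h.interior
  obtain ⟨z, hze, hzz, -, hzg⟩ := exists_face_proj x (h.unit e he) (hx e he)
  have hz : ∀ g ∈ N, lor z g ≤ 0 := by
    intro g hg
    by_cases hge : g = e
    · rw [hge, hze]
    · exact (hzg g (by linarith [h.le_neg_half he hg (Ne.symm hge)]) (hx g hg)).le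
  have hker : 1 < Module.finrank ℝ (LinearMap.ker ((lorL e).prod (lorL z))) := by
    have h1 := LinearMap.finrank_range_add_finrank_ker ((lorL e).prod (lorL z))
    have h2 := Submodule.finrank_le (LinearMap.range ((lorL e).prod (lorL z)))
    have h3 : Module.finrank ℝ (ℝ × ℝ) = 2 := by simp
    rw [finrank_mink] at h1
    omega
  obtain ⟨u₀, hu₀⟩ : ∃ x : LinearMap.ker ((lorL e).prod (lorL z)), x ≠ 0 := by
    have : Nontrivial (LinearMap.ker ((lorL e).prod (lorL z))) :=
      Module.nontrivial_of_finrank_pos (R := ℝ) (by omega)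
    exact exists_ne 0
  obtain ⟨u₁, hu₁⟩ := exists_linearIndependent_pair_of_one_lt_finrank hker hu₀
  have mem : ∀ u : LinearMap.ker ((lorL e).prod (lorL z)), lor u.1 e = 0 ∧ lor z u.1 = 0 := by
    intro u
    have := u.2
    rw [LinearMap.mem_ker] at this
    exact ⟨congrArg Prod.fst this, by rw [lor_comm]; exact congrArg Prod.snd this⟩
  -- Pairwise non-parallel directions in the tangent plane of the face at `z`.
  set u : ℕ → LinearMap.ker ((lorL e).prod (lorL z)) := fun n => u₁ + (n : ℝ) • u₀ with hu
  have indep : ∀ n, u n ≠ 0 := by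
    intro n hn
    have := LinearIndependent.pair_iff.mp hu₁ n 1 (by rw [one_smul, add_comm]; exact hn)
    exact one_ne_zero this.2
  have key : ∀ n, ∃ s : ℝ, ∃ g ∈ N, 0 < lor (u n).1 g ∧ lor (z + s • (u n).1) g = 0 ∧
      lor (z + s • (u n).1) (z + s • (u n).1) ≤ 0 ∧ z + s • (u n).1 ≠ 0 := fun n =>
    h.exists_exit_causal hz hzz (mem (u n)).2 (by simpa using indep n)
  choose s g hg hug hpg hpp hp0 using key
  by_contra! hcon
  have hge : ∀ n, g n ≠ e := by
    intro n hn
    have := hug n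
    rw [hn, (mem _).1] at this
    exact lt_irrefl _ this
  have hprop : ∀ n, ∃ c : ℝ, e + g n = c • (z + s n • (u n).1) := by
    intro n
    have hpe : lor (z + s n • (u n).1) e = 0 := by
      rw [lor_add_left, lor_smul_left, hze, (mem _).1]; simp
    obtain ⟨h1, h2⟩ := lor_lt_of_timelike_perp (hpp n) (hp0 n) (h.unit e he) (h.unit _ (hg n)) hpe
      (hpg n)
    apply h2
    rcases h.gram e he (g n) (hg n) (hge n).symm with h3 | h3
    · exact absurd h3 (hcon _ (hg n))
    · linarith
  choose c hc using hprop
  obtain ⟨n, m, hnm, hgnm⟩ := Finite.exists_ne_map_eq_of_infinite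
    (fun n => (⟨g n, hg n⟩ : N))
  have hgnm : g n = g m := congrArg Subtype.val hgnm
  have hval : ∀ n, lor (e + g n) z = c n * lor z z := by
    intro n
    rw [hc n, lor_smul_left, lor_add_left, lor_smul_left, lor_comm (u n).1 z, (mem _).2]; ring
  have hcc : c n = c m := by
    have h1 := hval n
    rw [hgnm, hval m] at h1
    exact (mul_right_cancel₀ hzz.ne h1).symm
  have hcn : c n ≠ 0 := by
    intro h0
    have := hc n
    rw [h0, zero_smul] at this
    have h2 := hx e he
    have h3 := hx _ (hg n)
    have : lor x.1 (e + g n) = 0 := by rw [this, lor_zero_right]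
    rw [lor_add_right] at this
    linarith
  have h1 : c n • (z + s n • (u n).1) = c n • (z + s m • (u m).1) := by
    rw [← hc n, hgnm, hc m, hcc]
  have h2 : s n • (u n).1 = s m • (u m).1 := add_left_cancel (smul_right_injective _ hcn h1)
  have h3 : (s n * n - s m * m) • u₀ + (s n - s m) • u₁ = 0 := by
    have h4 : s n • u n = s m • u m := Subtype.ext h2
    simp only [hu] at h4
    rw [← sub_eq_zero] at h4
    rw [← h4]; module
  obtain ⟨h4, h5⟩ := LinearIndependent.pair_iff.mp hu₁ _ _ h3
  have h6 : s n = s m := by linarith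
  have h7 : s m * ((n : ℝ) - m) = 0 := by rw [h6] at h4; linarith
  rcases mul_eq_zero.mp h7 with h8 | h8
  -- A zero step would put `z` on the plane of `g m`, but `z` is strictly inside every face other
  -- than `e`.
  · have hzg0 := hpg m
    rw [h8, zero_smul, add_zero] at hzg0
    have := hzg (g m) (by linarith [h.le_neg_half he (hg m) (hge m).symm]) (hx _ (hg m))
    linarith
  · exact hnm (by exact_mod_cast sub_eq_zero.mp h8)

/-- If three normals are orthogonal to a nonzero causal vector and two of them are adjacent, then
all are. -/
lemma adj_of_perp (h : NormalSystem N) {p e f g : Mink} (he : e ∈ N) (hf : f ∈ N) (hg : g ∈ N)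
    (hge : g ≠ e) (hfg : f ≠ g) (hef : lor e f = -1 / 2) (hp : lor p p ≤ 0) (hp0 : p ≠ 0)
    (hpe : lor p e = 0) (hpf : lor p f = 0) (hpg : lor p g = 0) : lor e g = -1 / 2 := by
  obtain ⟨h1, h2⟩ := lor_lt_of_timelike_perp hp hp0 (h.unit e he) (h.unit g hg) hpe hpg
  rcases h.gram e he g hg hge.symm with h3 | h3
  · exact h3
  -- Tangent planes would have `e + g` proportional to `p`, hence orthogonal to `f`; then `lor g f =
  -- 1 / 2`, which is positive.
  · obtain ⟨c, hc⟩ := h2 (le_antisymm h3 h1)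
    have h4 : lor (e + g) f = 0 := by rw [hc, lor_smul_left, hpf, mul_zero]
    rw [lor_add_left, hef] at h4
    have := h.le_neg_half hg hf hfg.symm
    linarith

lemma lor_sum_triple (h : NormalSystem N) {e f g k : Mink} (he : e ∈ N) (hf : f ∈ N) (hg : g ∈ N)
    (hk : k ∈ N) (h1 : k ≠ e) (h2 : k ≠ f) (h3 : k ≠ g) : lor (e + f + g) k ≤ -3 / 2 := by
  rw [lor_add_left, lor_add_left]
  linarith [h.le_neg_half he hk h1.symm, h.le_neg_half hf hk h2.symm, h.le_neg_half hg hk h3.symm]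

/-- Every edge has two ends: two adjacent faces have exactly two common neighbours. -/
lemma exists_common_neighbors (h : NormalSystem N) {e f : Mink} (he : e ∈ N) (hf : f ∈ N)
    (hef : lor e f = -1 / 2) :
    ∃ g ∈ N, ∃ g' ∈ N, g ≠ g' ∧ (lor e g = -1 / 2 ∧ lor f g = -1 / 2) ∧
      (lor e g' = -1 / 2 ∧ lor f g' = -1 / 2) := by
  obtain ⟨x, hx⟩ := h.interior
  have hne := h.ne_of_adj he hef
  obtain ⟨z, hze, hzf, hzz, -, hzg⟩ := exists_edge_proj x (h.unit e he) (h.unit f hf)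
    (by rw [hef]; norm_num) (by rw [hef]; norm_num) (hx e he) (hx f hf)
  have hz : ∀ g ∈ N, lor z g ≤ 0 := by
    intro g hg
    by_cases hge : g = e
    · rw [hge, hze]
    by_cases hgf : g = f
    · rw [hgf, hzf]
    · exact (hzg g (by linarith [h.le_neg_half he hg (Ne.symm hge)])
        (by linarith [h.le_neg_half hf hg (Ne.symm hgf)]) (hx g hg)).le
  have hker : LinearMap.ker (((lorL e).prod (lorL f)).prod (lorL z)) ≠ ⊥ := by
    apply LinearMap.ker_ne_bot_of_finrank_lt
    rw [finrank_mink]; simp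
  obtain ⟨u, hu, hu0⟩ := Submodule.exists_mem_ne_zero_of_ne_bot hker
  obtain ⟨⟨hue, huf⟩, huz⟩ : (lor u e = 0 ∧ lor u f = 0) ∧ lor u z = 0 := by
    simpa [LinearMap.mem_ker] using hu
  -- Here `u` is a tangent vector of the edge line at `z`. The face through which the ray leaves
  -- meets `e` and `f` at the exit point, so it is adjacent to both. Applying this to `u` and `-u`
  -- gives the two ends.
  have key : ∀ u : Mink, u ≠ 0 → lor u e = 0 → lor u f = 0 → lor z u = 0 →
      ∃ g ∈ N, 0 < lor u g ∧ lor e g = -1 / 2 ∧ lor f g = -1 / 2 := by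
    intro u hu0 hue huf huz
    obtain ⟨s, g, hg, hug, hpg, hpp, hp0⟩ := h.exists_exit_causal hz hzz huz hu0
    have hge : g ≠ e := by rintro rfl; linarith
    have hgf : g ≠ f := by rintro rfl; linarith
    have hpe : lor (z + s • u) e = 0 := by rw [lor_add_left, lor_smul_left, hze, hue]; simp
    have hpf : lor (z + s • u) f = 0 := by rw [lor_add_left, lor_smul_left, hzf, huf]; simp
    exact ⟨g, hg, hug, h.adj_of_perp he hf hg hge hgf.symm hef hpp hp0 hpe hpf hpg,
      h.adj_of_perp hf he hg hgf hge.symm (by rw [lor_comm, hef]) hpp hp0 hpf hpe hpg⟩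
  obtain ⟨g, hg, hug, h1, h2⟩ := key u hu0 hue huf (by rw [lor_comm, huz])
  obtain ⟨g', hg', hug', h1', h2'⟩ := key (-u) (by simpa using hu0)
    (by rw [lor_neg_left, hue, neg_zero]) (by rw [lor_neg_left, huf, neg_zero])
    (by rw [lor_neg_right, lor_comm, huz, neg_zero])
  refine ⟨g, hg, g', hg', ?_, ⟨h1, h2⟩, h1', h2'⟩
  rintro rfl
  rw [lor_neg_left] at hug'
  linarith

/-- Each common neighbour `a` gives a null vector `e + f + a` orthogonal to `e` and `f`, an end of
the line of the edge. Three distinct ones have pairwise negative products, so together with `e` and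
`f` they would be five independent vectors in dimension four. -/
lemma common_neighbor_unique (h : NormalSystem N) {e f g g' k : Mink} (he : e ∈ N) (hf : f ∈ N)
    (hg : g ∈ N) (hg' : g' ∈ N) (hk : k ∈ N) (hef : lor e f = -1 / 2)
    (h1 : lor e g = -1 / 2 ∧ lor f g = -1 / 2) (h2 : lor e g' = -1 / 2 ∧ lor f g' = -1 / 2)
    (h3 : lor e k = -1 / 2 ∧ lor f k = -1 / 2) (hgg' : g ≠ g') : k = g ∨ k = g' := by
  by_contra! hcon
  obtain ⟨hkg, hkg'⟩ := hcon
  have e1 : ∀ a, lor e a = -1 / 2 → lor (e + f + a) e = 0 := by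
    intro a ha
    simp only [lor_add_left, h.unit e he, lor_comm f e, hef, lor_comm a e, ha]
    norm_num
  have e2 : ∀ a, lor f a = -1 / 2 → lor (e + f + a) f = 0 := by
    intro a ha
    simp only [lor_add_left, h.unit f hf, hef, lor_comm a f, ha]
    norm_num
  have e3 : ∀ a ∈ N, lor e a = -1 / 2 → lor f a = -1 / 2 → lor (e + f + a) a = 0 := by
    intro a ha h4 h5
    simp only [lor_add_left, h.unit a ha, h4, h5]
    norm_num
  have e4 : ∀ a b, a ∈ N → b ∈ N → lor e a = -1 / 2 → lor f a = -1 / 2 → lor e b = -1 / 2 →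
      lor f b = -1 / 2 → a ≠ b → lor (e + f + a) (e + f + b) < 0 := by
    intro a b ha hb h4 h5 h6 h7 hab
    rw [lor_add_right, lor_add_right, e1 a h4, e2 a h5]
    have := h.lor_sum_triple he hf ha hb (h.ne_of_adj he h6).symm (h.ne_of_adj hf h7).symm hab.symm
    linarith
  have hdep : ¬ LinearIndependent ℝ ![e, f, e + f + g, e + f + g', e + f + k] := by
    intro hli
    have := hli.fintype_card_le_finrank
    rw [finrank_mink] at this
    simp at this
  rw [Fintype.not_linearIndependent_iff] at hdep
  obtain ⟨c, hc, i, hi⟩ := hdep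
  simp only [Fin.sum_univ_five] at hc
  simp only [Matrix.cons_val] at hc
  have pair : ∀ w, c 0 * lor e w + c 1 * lor f w + c 2 * lor (e + f + g) w +
      c 3 * lor (e + f + g') w + c 4 * lor (e + f + k) w = 0 := by
    intro w
    have := congrArg (fun v => lor v w) hc
    simpa only [lor_add_left, lor_smul_left, lor_zero_left] using this
  have p1 := pair e
  have p2 := pair f
  rw [e1 g h1.1, e1 g' h2.1, e1 k h3.1, h.unit e he, lor_comm f e, hef] at p1
  rw [e2 g h1.2, e2 g' h2.2, e2 k h3.2, h.unit f hf, hef] at p2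
  have c0 : c 0 = 0 := by linarith
  have c1 : c 1 = 0 := by linarith
  have n1 : ∀ a ∈ N, lor e a = -1 / 2 → lor f a = -1 / 2 → lor (e + f + a) (e + f + a) = 0 := by
    intro a ha h4 h5
    rw [lor_add_right, lor_add_right, e1 a h4, e2 a h5, e3 a ha h4 h5]; norm_num
  have p3 := pair (e + f + g)
  have p4 := pair (e + f + g')
  have p5 := pair (e + f + k)
  rw [n1 g hg h1.1 h1.2, lor_comm _ (e + f + g), lor_comm _ (e + f + g)] at p3
  rw [n1 g' hg' h2.1 h2.2, lor_comm (e + f + k)] at p4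
  rw [n1 k hk h3.1 h3.2] at p5
  have a1 := e4 g g' hg hg' h1.1 h1.2 h2.1 h2.2 hgg'
  have a2 := e4 g k hg hk h1.1 h1.2 h3.1 h3.2 hkg.symm
  have a3 := e4 g' k hg' hk h2.1 h2.2 h3.1 h3.2 hkg'.symm
  rw [lor_comm _ (e + f + g), lor_comm (e + f + k) (e + f + g)] at p3
  simp only [c0, c1, zero_mul, zero_add, mul_zero, add_zero] at p3 p4 p5
  generalize lor (e + f + g) (e + f + g') = A at *
  generalize lor (e + f + g) (e + f + k) = B at *
  generalize lor (e + f + g') (e + f + k) = C at *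
  -- The Gram matrix of the three null vectors has zero diagonal and negative entries `A`, `B`, `C`,
  -- so its determinant `2 * A * B * C` is nonzero; this eliminates by hand.
  have c4 : c 4 = 0 := by
    have : c 4 * (2 * B * C) = 0 := by linear_combination C * p3 + B * p4 - A * p5
    rcases mul_eq_zero.mp this with h | h
    · exact h
    · nlinarith [mul_pos_of_neg_of_neg a2 a3]
  rw [c4] at p3 p4
  have c3 : c 3 = 0 := by
    rcases mul_eq_zero.mp (show c 3 * A = 0 by linarith) with h | h
    · exact h
    · linarith
  have c2 : c 2 = 0 := by
    rcases mul_eq_zero.mp (show c 2 * A = 0 by linarith) with h | h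
    · exact h
    · linarith
  fin_cases i <;> simp_all

end NormalSystem

/-! ### Volume of polyhedra and ideal points -/

lemma measurable_lift : Measurable lift := by
  apply Measurable.subtype_mk
  have h : Continuous fun y : E3 => ((√(1 + ‖y‖ ^ 2), y) : Mink) := by fun_prop
  exact h.measurable

lemma measurableSet_halfSpace (e : Mink) : MeasurableSet (halfSpace e) := by
  have h : Measurable fun x : H3 => lor x.1 e :=
    (Continuous.lor' continuous_id continuous_const).measurable.comp measurable_subtype_coe
  exact measurableSet_le h measurable_const

lemma measurableSet_polyhedron (N : Finset Mink) : MeasurableSet (⋂ e ∈ N, halfSpace e) :=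
  Finset.measurableSet_biInter _ fun e _ => measurableSet_halfSpace e

lemma vol_apply {A : Set H3} (hA : MeasurableSet A) :
    vol A = ∫⁻ y in lift ⁻¹' A, ENNReal.ofReal (1 / √(1 + ‖y‖ ^ 2)) := by
  rw [vol, Measure.map_apply measurable_lift hA, withDensity_apply _ (measurable_lift hA)]

lemma mem_polyhedron {N : Finset Mink} {x : H3} :
    x ∈ (⋂ e ∈ N, halfSpace e) ↔ ∀ e ∈ N, lor x.1 e ≤ 0 := by
  simp [halfSpace]

open scoped Pointwise in
/-- A polyhedron that contains a neighbourhood of an ideal point has infinite volume. -/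
lemma vol_eq_top_of_ideal {N : Finset Mink} {n : Mink} (hn : lor n n = 0) (hn0 : 0 < n.1)
    (h : ∀ e ∈ N, lor n e < 0) : vol (⋂ e ∈ N, halfSpace e) = ⊤ := by
  have hnn : ‖n.2‖ = n.1 := by
    rw [lor_self] at hn
    exact (sq_eq_sq₀ (norm_nonneg _) hn0.le).mp (by linarith)
  -- A rescaling of the hyperboloid that extends to the light cone: `lift (R • b) = R • F (b, 1 /
  -- R)`, and `F (n.2, 0) = n`. Strict inequalities at `n` therefore hold at `lift (R • b)` for `b`
  -- near `n.2` and `R` large.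
  set F : E3 × ℝ → Mink := fun q => (√(‖q.1‖ ^ 2 + q.2 ^ 2), q.1) with hF
  have hFc : Continuous F := by rw [hF]; fun_prop
  have hF0 : F (n.2, 0) = n := by
    simp only [hF]
    ext1
    · simp [hnn, Real.sqrt_sq hn0.le]
    · rfl
  have hev : ∀ᶠ q in nhds (n.2, (0 : ℝ)), ∀ e ∈ N, lor (F q) e < 0 := by
    rw [Filter.eventually_all_finset]
    intro e he
    have hc : Continuous fun q => lor (F q) e := Continuous.lor' hFc continuous_const
    exact (hc.tendsto _).eventually_lt_const (by rw [hF0]; exact h e he)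
  obtain ⟨δ, hδ, hball⟩ := Metric.eventually_nhds_iff.mp hev
  set K := ‖n.2‖ + δ with hK
  have hKpos : 0 < K := by positivity
  set V := (volume : Measure E3) (Metric.ball n.2 δ) with hV
  have hVpos : 0 < V := Metric.measure_ball_pos _ _ hδ
  -- The scaled ball has Euclidean volume `R ^ 3 * V` and density at least `1 / (R * (1 + K))`, so
  -- its hyperbolic volume grows like `R ^ 2`.
  have key : ∀ R : ℝ, 1 ≤ R → 1 / δ < R →
      ENNReal.ofReal (R ^ 2 / (1 + K)) * V ≤ vol (⋂ e ∈ N, halfSpace e) := by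
    intro R hR1 hRδ
    have hR0 : 0 < R := by linarith
    have hsub : R • Metric.ball n.2 δ ⊆ lift ⁻¹' (⋂ e ∈ N, halfSpace e) := by
      rintro _ ⟨b, hb, rfl⟩
      rw [Set.mem_preimage, mem_polyhedron]
      intro e he
      have h1 : dist (b, 1 / R) (n.2, (0 : ℝ)) < δ := by
        rw [Prod.dist_eq]
        apply max_lt hb
        rw [Real.dist_eq, sub_zero, abs_of_pos (by positivity)]
        rw [div_lt_iff₀ hR0]
        rw [div_lt_iff₀ hδ] at hRδ
        linarith
      have h2 := hball h1 e he
      have h3 : (lift (R • b)).1 = R • F (b, 1 / R) := by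
        simp only [lift, hF]
        ext1
        · simp only [Prod.smul_fst, smul_eq_mul]
          rw [norm_smul, Real.norm_of_nonneg hR0.le]
          rw [show R * √(‖b‖ ^ 2 + (1 / R) ^ 2) = √(R ^ 2 * (‖b‖ ^ 2 + (1 / R) ^ 2)) by
            rw [Real.sqrt_mul (by positivity), Real.sqrt_sq hR0.le]]
          congr 1
          field_simp
          ring
        · rfl
      change lor (lift (R • b)).1 e ≤ 0
      rw [h3, lor_smul_left]
      exact mul_nonpos_of_nonneg_of_nonpos hR0.le h2.le
    rw [vol_apply (measurableSet_polyhedron N)]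
    refine le_trans ?_ (lintegral_mono_set hsub)
    have hmeas : MeasurableSet (R • Metric.ball n.2 δ) :=
      (Metric.isOpen_ball.smul₀ hR0.ne').measurableSet
    have hlow : ∀ y ∈ R • Metric.ball n.2 δ, ENNReal.ofReal (1 / (R * (1 + K))) ≤
        ENNReal.ofReal (1 / √(1 + ‖y‖ ^ 2)) := by
      rintro _ ⟨b, hb, rfl⟩
      apply ENNReal.ofReal_le_ofReal
      apply one_div_le_one_div_of_le (by positivity)
      have hbK : ‖b‖ ≤ K := by
        have := norm_le_norm_add_norm_sub' b n.2
        rw [← dist_eq_norm] at this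
        have h2 : dist b n.2 < δ := hb
        linarith
      apply Real.sqrt_le_iff.mpr ⟨by positivity, ?_⟩
      change 1 + ‖R • b‖ ^ 2 ≤ _
      rw [norm_smul, Real.norm_of_nonneg hR0.le]
      nlinarith [norm_nonneg b, mul_le_mul hbK hbK (norm_nonneg b) hKpos.le, mul_pos hR0 hR0]
    have h4 := setLIntegral_mono' (μ := (volume : Measure E3)) hmeas hlow
    refine le_trans ?_ h4
    rw [setLIntegral_const, Measure.addHaar_smul]
    rw [show Module.finrank ℝ E3 = 3 by simp [E3], ← mul_assoc, ← ENNReal.ofReal_mul (by positivity),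
      abs_of_pos (by positivity)]
    gcongr
    apply le_of_eq
    field_simp
  by_contra hne
  have hVtop : V ≠ ⊤ := measure_ball_lt_top.ne
  set v := (vol (⋂ e ∈ N, halfSpace e)).toReal with hv
  have hVr : 0 < V.toReal := ENNReal.toReal_pos hVpos.ne' hVtop
  obtain ⟨R, hR⟩ := exists_gt (max (max 1 (1 / δ)) (v * (1 + K) / V.toReal))
  simp only [max_lt_iff] at hR
  have h1 := key R hR.1.1.le hR.1.2
  have h2 := ENNReal.toReal_mono hne h1
  rw [ENNReal.toReal_mul, ENNReal.toReal_ofReal (by positivity), ← hv] at h2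
  have h3 := hR.2
  rw [div_lt_iff₀ hVr] at h3
  have h4 : R ^ 2 / (1 + K) * V.toReal * (1 + K) = R ^ 2 * V.toReal := by field_simp
  have h5 : R ^ 2 * V.toReal ≤ v * (1 + K) := by
    rw [← h4]; exact mul_le_mul_of_nonneg_right h2 (by positivity)
  nlinarith [mul_pos (show (0 : ℝ) < R - 1 by linarith) (mul_pos (show 0 < R by linarith) hVr)]

/-- From the interior point `x`, a spacelike `w` in the cone would lead to a point `x + s • w` of
the light cone with all pairings still strictly negative. A neighbourhood of this ideal point then
lies in the polyhedron, and the volume is infinite. -/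
lemma causal_of_vol_lt_top {N : Finset Mink} (hv : vol (⋂ e ∈ N, halfSpace e) < ⊤) (x : H3)
    (hx : ∀ e ∈ N, lor x.1 e < 0) (w : Mink) (hw : ∀ e ∈ N, lor w e ≤ 0) : lor w w ≤ 0 := by
  by_contra! hA
  set A := lor w w with hAdef
  set B := lor x.1 w with hB
  set r := √(B ^ 2 + A) with hr
  have hr2 : r ^ 2 = B ^ 2 + A := Real.sq_sqrt (by positivity)
  have hr0 : 0 < r := Real.sqrt_pos.mpr (by positivity)
  have hrB : B < r := (abs_lt_of_sq_lt_sq' (by linarith) hr0.le).2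
  -- The positive root of `A * s ^ 2 + 2 * B * s - 1`, which is the square of `x + s • w`.
  set s := (-B + r) / A with hs
  have hs0 : 0 < s := div_pos (by linarith) hA
  have hAs : A * s = r - B := by rw [hs]; field_simp; ring
  have hnull : lor (x.1 + s • w) (x.1 + s • w) = 0 := by
    simp only [lor_add_left, lor_add_right, lor_smul_left, lor_smul_right, x.2.1, lor_comm w x.1,
      ← hB, ← hAdef]
    have : A * (-1 + 2 * s * B + s * s * A) = 0 := by
      linear_combination (2 * B) * hAs + (A * s + r - B) * hAs + hr2
    have := (mul_eq_zero.mp this).resolve_left hA.ne'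
    linarith
  have hxn : lor x.1 (x.1 + s • w) < 0 := by
    have h2 : lor x.1 (x.1 + s • w) = -1 + s * B := by
      simp only [lor_add_right, lor_smul_right, x.2.1, ← hB]
    have h3 : A * (-1 + s * B) = - r * (r - B) := by linear_combination B * hAs + hr2
    rw [h2]
    by_contra! h4
    nlinarith [mul_pos hr0 (sub_pos.mpr hrB), mul_nonneg hA.le h4]
  have := vol_eq_top_of_ideal hnull (future_of_lor_neg_H3 x hnull.le hxn) (N := N) fun e he => by
    rw [lor_add_left, lor_smul_left]
    nlinarith [hx e he, hw e he]
  exact hv.ne this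

/-! ### From equiangular polyhedra to systems of normals -/

/-- A finite intersection has an irredundant subfamily. -/
lemma exists_irredundant {α β : Type*} [DecidableEq α] (N : Finset α) (H : α → Set β) :
    ∃ M ⊆ N, (⋂ e ∈ M, H e) = ⋂ e ∈ N, H e ∧
      ∀ e ∈ M, ∃ y, y ∉ H e ∧ ∀ f ∈ M, f ≠ e → y ∈ H f := by
  classical
  obtain ⟨M, hM, hmin⟩ := Finset.exists_min_image
    (N.powerset.filter fun M => (⋂ e ∈ M, H e) = ⋂ e ∈ N, H e) Finset.card
    ⟨N, by simp⟩
  rw [Finset.mem_filter, Finset.mem_powerset] at hM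
  refine ⟨M, hM.1, hM.2, fun e he => ?_⟩
  by_contra! hcon
  have h1 : (⋂ f ∈ M.erase e, H f) = ⋂ f ∈ N, H f := by
    rw [← hM.2]
    apply Set.Subset.antisymm
    · intro y hy
      simp only [Set.mem_iInter, Finset.mem_erase] at hy ⊢
      by_cases hye : y ∈ H e
      · intro f hf
        by_cases hfe : f = e
        · rwa [hfe]
        · exact hy f ⟨hfe, hf⟩
      · obtain ⟨f, hf, hfe, hyf⟩ := hcon y hye
        exact absurd (hy f ⟨hfe, hf⟩) hyf
    · exact Set.biInter_subset_biInter_left (Finset.erase_subset e M)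
  have h2 := hmin (M.erase e) (by
    rw [Finset.mem_filter, Finset.mem_powerset]
    exact ⟨(Finset.erase_subset e M).trans hM.1, h1⟩)
  have := Finset.card_erase_lt_of_mem he
  omega

lemma timelike_add {z y : Mink} (hz : lor z z < 0) (hz0 : 0 < z.1) (hy : lor y y < 0)
    (hy0 : 0 < y.1) {a b : ℝ} (ha : 0 < a) (hb : 0 < b) :
    lor (a • z + b • y) (a • z + b • y) < 0 ∧ 0 < (a • z + b • y).1 := by
  have h := lor_neg_of_future hz hz0 hy.le hy0
  constructor
  · simp only [lor_add_left, lor_add_right, lor_smul_left, lor_smul_right, lor_comm y z]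
    nlinarith [mul_pos ha hb, mul_pos ha ha, mul_pos hb hb]
  · simp only [Prod.fst_add, Prod.smul_fst, smul_eq_mul]
    positivity

/-- The segment from `z` to `y` meets the plane of `f` in a positive combination of the two, which
inherits strict inequalities from `z` and equalities common to both. -/
lemma exists_crossing {z y f : Mink} (hz : lor z z < 0) (hz0 : 0 < z.1) (hy : lor y y < 0)
    (hy0 : 0 < y.1) (hzf : lor z f < 0) (hyf : 0 < lor y f) :
    ∃ p, lor p p < 0 ∧ 0 < p.1 ∧ lor p f = 0 ∧ (∀ g, lor z g < 0 → lor y g ≤ 0 → lor p g < 0) ∧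
      ∀ g, lor z g = 0 → lor y g = 0 → lor p g = 0 := by
  have h := timelike_add hz hz0 hy hy0 hyf (neg_pos.mpr hzf)
  refine ⟨lor y f • z + (-lor z f) • y, h.1, h.2, ?_, ?_, ?_⟩
  · simp only [lor_add_left, lor_smul_left]; ring
  · intro g h1 h2
    simp only [lor_add_left, lor_smul_left]
    nlinarith [mul_pos_of_neg_of_neg hzf h1]
  · intro g h1 h2
    simp only [lor_add_left, lor_smul_left, h1, h2]; ring

lemma exists_small_step {z : Mink} (hz : lor z z < 0) (hz0 : 0 < z.1) (M : Finset Mink)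
    (hM : ∀ g ∈ M, lor z g < 0) (u : Mink) :
    ∃ s : ℝ, 0 < s ∧ lor (z + s • u) (z + s • u) < 0 ∧ 0 < (z + s • u).1 ∧
      ∀ g ∈ M, lor (z + s • u) g < 0 := by
  have hc : Continuous fun s : ℝ => z + s • u := by fun_prop
  have h0 : z + (0 : ℝ) • u = z := by simp
  have h1 : ∀ᶠ s in nhds (0 : ℝ), lor (z + s • u) (z + s • u) < 0 :=
    ((Continuous.lor' hc hc).tendsto _).eventually_lt_const (by rw [h0]; exact hz)
  have h2 : ∀ᶠ s in nhds (0 : ℝ), 0 < (z + s • u).1 :=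
    ((continuous_fst.comp hc).tendsto _).eventually_const_lt (by simpa using hz0)
  have h3 : ∀ᶠ s in nhds (0 : ℝ), ∀ g ∈ M, lor (z + s • u) g < 0 := by
    rw [Filter.eventually_all_finset]
    intro g hg
    exact ((Continuous.lor' hc continuous_const).tendsto _).eventually_lt_const
      (by rw [h0]; exact hM g hg)
  have h4 : ∀ᶠ s in nhdsWithin (0 : ℝ) (Set.Ioi 0), 0 < s := eventually_mem_nhdsWithin
  obtain ⟨s, hs⟩ := (h4.and (((h1.and h2).and h3).filter_mono nhdsWithin_le_nhds)).exists
  exact ⟨s, hs.1, hs.2.1.1, hs.2.1.2, hs.2.2⟩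

/-- Computes the rank of a face or an edge from one relatively interior point `z`: the zero step
puts `z` in the span, and subtracting it from `z + s • u` isolates `u`. -/
lemma span_eq_of_steps {A : Set H3} {W : Submodule ℝ Mink} (hA : ∀ x ∈ A, x.1 ∈ W) {z : Mink}
    (hstep : ∀ u ∈ W, ∃ s : ℝ, 0 < s ∧ ∃ x ∈ A, ∃ c : ℝ, z + s • u = c • x.1) :
    Submodule.span ℝ ((fun x : H3 => x.1) '' A) = W := by
  apply le_antisymm
  · rw [Submodule.span_le]
    rintro _ ⟨x, hx, rfl⟩
    exact hA x hx
  · have hmem : ∀ x ∈ A, x.1 ∈ Submodule.span ℝ ((fun x : H3 => x.1) '' A) := fun x hx =>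
      Submodule.subset_span ⟨x, hx, rfl⟩
    obtain ⟨s, -, x, hx, c, h0⟩ := hstep 0 W.zero_mem
    rw [smul_zero, add_zero] at h0
    intro u hu
    obtain ⟨s, hs, y, hy, c', h1⟩ := hstep u hu
    have h2 : u = s⁻¹ • (c' • y.1 - c • x.1) := by
      rw [← h1, ← h0, add_sub_cancel_left, smul_smul, inv_mul_cancel₀ hs.ne', one_smul]
    rw [h2]
    exact Submodule.smul_mem _ _ (Submodule.sub_mem _ (Submodule.smul_mem _ _ (hmem y hy))
      (Submodule.smul_mem _ _ (hmem x hx)))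

lemma finrank_ker_lorL {e : Mink} (he : lor e e = 1) :
    Module.finrank ℝ (LinearMap.ker (lorL e)) = 3 := by
  have h := LinearMap.finrank_range_add_finrank_ker (lorL e)
  have hs : LinearMap.range (lorL e) = ⊤ := by
    rw [LinearMap.range_eq_top]
    intro a
    exact ⟨a • e, by rw [lorL_apply, lor_smul_left, he, mul_one]⟩
  rw [hs, finrank_top, finrank_mink, Module.finrank_self] at h
  omega

lemma finrank_ker_lorL_pair {e f : Mink} (he : lor e e = 1) (hf : lor f f = 1)
    (hef : lor e f ^ 2 < 1) :
    Module.finrank ℝ (LinearMap.ker ((lorL e).prod (lorL f))) = 2 := by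
  have h := LinearMap.finrank_range_add_finrank_ker ((lorL e).prod (lorL f))
  have hs : LinearMap.range ((lorL e).prod (lorL f)) = ⊤ := by
    rw [LinearMap.range_eq_top]
    rintro ⟨a, b⟩
    have hD : 1 - lor e f ^ 2 ≠ 0 := by linarith
    refine ⟨((a - lor e f * b) / (1 - lor e f ^ 2)) • e +
      ((b - lor e f * a) / (1 - lor e f ^ 2)) • f, ?_⟩
    ext1
    · change lor _ e = a
      rw [lor_add_left, lor_smul_left, lor_smul_left, he, lor_comm f e]
      field_simp; ring
    · change lor _ f = b
      rw [lor_add_left, lor_smul_left, lor_smul_left, hf]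
      field_simp; ring
  rw [hs, finrank_top, finrank_mink] at h
  simp at h
  omega

lemma lor_eq_of_dihedralAngle {e f : Mink} (h : dihedralAngle e f = Real.pi / 3) :
    lor e f = -1 / 2 := by
  have h1 : Real.arccos (lor e f) = Real.pi - Real.pi / 3 := by unfold dihedralAngle at h; linarith
  have hpi := Real.pi_pos
  -- Outside `[-1, 1]` the function `Real.arccos` takes the values `π` and `0`, neither of which is
  -- `2 * π / 3`.
  have h2 : -1 ≤ lor e f := by
    by_contra! hc
    rw [Real.arccos_of_le_neg_one hc.le] at h1; linarith
  have h3 : lor e f ≤ 1 := by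
    by_contra! hc
    rw [Real.arccos_of_one_le hc.le] at h1; linarith
  rw [← Real.cos_arccos h2 h3, h1, Real.cos_pi_sub, Real.cos_pi_div_three]; norm_num

/-- If the centre were on the plane, the geodesic `cosh s • x + sinh s • e` would leave the
half-space at once while staying in the ball for `s = r / 2`. -/
lemma lor_neg_of_ball {x : H3} {r : ℝ} (hr : 0 < r) {e : Mink} (he : lor e e = 1)
    (h : {y | hdist x y < r} ⊆ halfSpace e) : lor x.1 e < 0 := by
  have hle : lor x.1 e ≤ 0 := h (show hdist x x < r by
    unfold hdist; rw [x.2.1]; simpa using hr)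
  refine lt_of_le_of_ne hle fun h0 => ?_
  set s := r / 2 with hs
  have hs0 : 0 < s := by positivity
  have hn : lor (Real.cosh s • x.1 + Real.sinh s • e) (Real.cosh s • x.1 + Real.sinh s • e) = -1 := by
    simp only [lor_add_left, lor_add_right, lor_smul_left, lor_smul_right, x.2.1, he, h0,
      lor_comm e x.1]
    linear_combination -Real.cosh_sq_sub_sinh_sq s
  have hnx : lor (Real.cosh s • x.1 + Real.sinh s • e) x.1 = -Real.cosh s := by
    simp only [lor_add_left, lor_smul_left, x.2.1, h0, lor_comm e x.1]; ring
  have hf : 0 < (Real.cosh s • x.1 + Real.sinh s • e).1 :=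
    future_of_lor_neg (by rw [hn]; norm_num) (by rw [x.2.1]; norm_num) x.2.2
      (by rw [hnx]; linarith [Real.cosh_pos s])
  have hmem := @h ⟨_, hn, hf⟩ (by
    change Real.arcosh (-lor x.1 _) < r
    rw [lor_comm, hnx, neg_neg, Real.arcosh_cosh hs0.le]
    linarith)
  change lor (Real.cosh s • x.1 + Real.sinh s • e) e ≤ 0 at hmem
  rw [lor_add_left, lor_smul_left, lor_smul_left, h0, he] at hmem
  have := Real.sinh_pos_iff.mpr hs0
  linarith

/-- The defining data of an irredundant presentation with an interior point. -/
structure Presentation (P : Set H3) (N : Finset Mink) (x : H3) : Prop where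
  unit : ∀ e ∈ N, lor e e = 1
  eq : P = ⋂ e ∈ N, halfSpace e
  interior : ∀ e ∈ N, lor x.1 e < 0
  irredundant : ∀ e ∈ N, ∃ y : H3, 0 < lor y.1 e ∧ ∀ f ∈ N, f ≠ e → lor y.1 f ≤ 0

lemma IsConvexPolyhedron.exists_presentation {P : Set H3} (hP : IsConvexPolyhedron P) :
    ∃ N x, Presentation P N x := by
  classical
  obtain ⟨⟨N, hN, rfl⟩, x, r, hr, hball⟩ := hP
  obtain ⟨M, hMN, hM, hirr⟩ := exists_irredundant N halfSpace
  refine ⟨M, x, fun e he => hN e (hMN he), hM.symm, fun e he => ?_, fun e he => ?_⟩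
  · exact lor_neg_of_ball hr (hN e (hMN he)) (hball.trans (Set.biInter_subset_of_mem (hMN he)))
  · obtain ⟨y, hy, hyf⟩ := hirr e he
    exact ⟨y, not_le.mp hy, hyf⟩

namespace Presentation

variable {P : Set H3} {N : Finset Mink} {x : H3}

lemma mem_iff (h : Presentation P N x) {y : H3} : y ∈ P ↔ ∀ e ∈ N, lor y.1 e ≤ 0 := by
  rw [h.eq, mem_polyhedron]

lemma exists_mem_smul (h : Presentation P N x) {w : Mink} (hw : lor w w < 0) (h0 : 0 < w.1)
    (hN : ∀ e ∈ N, lor w e ≤ 0) : ∃ y ∈ P, ∃ c : ℝ, 0 < c ∧ w = c • y.1 := by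
  obtain ⟨y, c, hc, rfl⟩ := exists_H3_smul hw h0
  refine ⟨y, h.mem_iff.mpr fun e he => ?_, c, hc, rfl⟩
  have := hN e he
  rw [lor_smul_left] at this
  exact nonpos_of_mul_nonpos_right this hc

/-- Every face has a relatively interior point. -/
lemma exists_face_point (h : Presentation P N x) {e : Mink} (he : e ∈ N) :
    ∃ z, lor z z < 0 ∧ 0 < z.1 ∧ lor z e = 0 ∧ ∀ g ∈ N, g ≠ e → lor z g < 0 := by
  obtain ⟨y, hy, hyf⟩ := h.irredundant e he
  obtain ⟨p, h1, h2, h3, h4, -⟩ := exists_crossing (z := x.1) (y := y.1)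
    (by rw [x.2.1]; norm_num) x.2.2 (by rw [y.2.1]; norm_num) y.2.2 (h.interior e he) hy
  exact ⟨p, h1, h2, h3, fun g hg hge => h4 g (h.interior g hg) (hyf g hg hge)⟩

lemma isFaceNormal (h : Presentation P N x) {e : Mink} (he : e ∈ N) : IsFaceNormal P e := by
  classical
  obtain ⟨z, hz, hz0, hze, hzg⟩ := h.exists_face_point he
  refine ⟨h.unit e he, fun y hy => h.mem_iff.mp hy e he, ?_⟩
  rw [spanRank, span_eq_of_steps (W := LinearMap.ker (lorL e)) (z := z) (fun y hy => hy.2),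
    finrank_ker_lorL (h.unit e he)]
  intro u hu
  rw [LinearMap.mem_ker, lorL_apply] at hu
  obtain ⟨s, hs, h1, h2, h3⟩ := exists_small_step hz hz0 (N.erase e) (fun g hg =>
    hzg g (Finset.mem_of_mem_erase hg) (Finset.ne_of_mem_erase hg)) u
  have h4 : lor (z + s • u) e = 0 := by rw [lor_add_left, lor_smul_left, hze, hu]; simp
  obtain ⟨y, hy, c, hc, hyc⟩ := h.exists_mem_smul h1 h2 (fun g hg => by
    by_cases hge : g = e
    · rw [hge, h4]
    · exact (h3 g (Finset.mem_erase.mpr ⟨hge, hg⟩)).le)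
  refine ⟨s, hs, y, ⟨hy, ?_⟩, c, hyc⟩
  rw [hyc, lor_smul_left] at h4
  exact (mul_eq_zero.mp h4).resolve_left hc.ne'

lemma ne_neg (h : Presentation P N x) {e f : Mink} (he : e ∈ N) (hf : f ∈ N) : e + f ≠ 0 := by
  intro h0
  have : lor x.1 (e + f) = 0 := by rw [h0, lor_zero_right]
  rw [lor_add_right] at this
  linarith [h.interior e he, h.interior f hf]

/-- Two faces whose planes meet along an open piece of a line of the boundary are adjacent. -/
lemma adjacent (h : Presentation P N x) {e f z : Mink} (he : e ∈ N) (hf : f ∈ N) (hef : e ≠ f)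
    (hz : lor z z < 0) (hze : lor z e = 0) (hzf : lor z f = 0)
    (hstep : ∀ u, lor u e = 0 → lor u f = 0 → ∃ s : ℝ, 0 < s ∧ lor (z + s • u) (z + s • u) < 0 ∧
      0 < (z + s • u).1 ∧ ∀ g ∈ N, lor (z + s • u) g ≤ 0) : Adjacent P e f := by
  refine ⟨h.isFaceNormal he, h.isFaceNormal hf, hef, ?_⟩
  -- Both `e + f` and `e - f` are nonzero and orthogonal to the timelike `z`, hence spacelike; this
  -- gives `|lor e f| < 1`, so the two planes meet transversally.
  have hp1 : 0 < lor (e + f) (e + f) := lor_self_pos_of_orthogonal hz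
    (by rw [lor_add_right, hze, hzf, add_zero]) (h.ne_neg he hf)
  have hp2 : 0 < lor (e - f) (e - f) := lor_self_pos_of_orthogonal hz
    (by rw [lor_sub_right, hze, hzf, sub_zero]) (sub_ne_zero.mpr hef)
  simp only [lor_add_left, lor_add_right, lor_sub_left, lor_sub_right, h.unit e he, h.unit f hf,
    lor_comm f e] at hp1 hp2
  have hsq : lor e f ^ 2 < 1 := by nlinarith
  rw [spanRank, span_eq_of_steps (W := LinearMap.ker ((lorL e).prod (lorL f))) (z := z),
    finrank_ker_lorL_pair (h.unit e he) (h.unit f hf) hsq]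
  · intro y hy
    exact Prod.ext hy.1.2 hy.2.2
  · intro u hu
    obtain ⟨hue, huf⟩ : lor u e = 0 ∧ lor u f = 0 := ⟨congrArg Prod.fst hu, congrArg Prod.snd hu⟩
    obtain ⟨s, hs, h1, h2, h3⟩ := hstep u hue huf
    obtain ⟨y, hy, c, hc, hyc⟩ := h.exists_mem_smul h1 h2 h3
    have h4 : lor (z + s • u) e = 0 := by rw [lor_add_left, lor_smul_left, hze, hue]; simp
    have h5 : lor (z + s • u) f = 0 := by rw [lor_add_left, lor_smul_left, hzf, huf]; simp
    rw [hyc, lor_smul_left] at h4 h5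
    exact ⟨s, hs, y, ⟨⟨hy, (mul_eq_zero.mp h4).resolve_left hc.ne'⟩, hy,
      (mul_eq_zero.mp h5).resolve_left hc.ne'⟩, c, hyc⟩

/-- If adjacent faces have angle `π / 3`, the polyhedron projects orthogonally into its faces. -/
lemma proj_mem (h : Presentation P N x)
    (hadj : ∀ e f, Adjacent P e f → lor e f = -1 / 2) {e : Mink} (he : e ∈ N) {w : Mink}
    (hw : lor w w < 0) (hw0 : 0 < w.1) (hwN : ∀ g ∈ N, lor w g ≤ 0) :
    ∀ g ∈ N, lor (w - lor w e • e) g ≤ 0 := by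
  classical
  -- `M` is an irredundant set of sides for the face as a polygon in its own plane; other faces of
  -- the polyhedron are implied there.
  obtain ⟨M, hMN, hM, hirr⟩ := exists_irredundant (N.erase e)
    (fun g => {y : {y : H3 // lor y.1 e = 0} | lor y.1.1 g ≤ 0})
  have hMsub : ∀ f ∈ M, f ∈ N ∧ f ≠ e := fun f hf =>
    ⟨Finset.mem_of_mem_erase (hMN hf), Finset.ne_of_mem_erase (hMN hf)⟩
  have hface : ∀ p, lor p p < 0 → 0 < p.1 → lor p e = 0 → (∀ f ∈ M, lor p f ≤ 0) →
      ∀ g ∈ N, lor p g ≤ 0 := by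
    intro p hp hp0 hpe hpM g hg
    by_cases hge : g = e
    · rw [hge, hpe]
    obtain ⟨y, c, hc, rfl⟩ := exists_H3_smul hp hp0
    rw [lor_smul_left] at hpe
    have hye := (mul_eq_zero.mp hpe).resolve_left hc.ne'
    have hyM : (⟨y, hye⟩ : {y : H3 // lor y.1 e = 0}) ∈
        ⋂ f ∈ M, {y : {y : H3 // lor y.1 e = 0} | lor y.1.1 f ≤ 0} := by
      simp only [Set.mem_iInter]
      intro f hf
      have := hpM f hf
      rw [lor_smul_left] at this
      exact nonpos_of_mul_nonpos_right this hc
    rw [hM] at hyM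
    simp only [Set.mem_iInter] at hyM
    rw [lor_smul_left]
    exact mul_nonpos_of_nonneg_of_nonpos hc.le (hyM g (Finset.mem_erase.mpr ⟨hge, hg⟩))
  -- A point of the plane beyond the side `f` only, joined to an interior point of the face, crosses
  -- `f` inside a genuine edge. So `e` and `f` are adjacent, and projecting along `e` only lowers
  -- the pairing with `f`.
  have hM' : ∀ f ∈ M, lor e f = -1 / 2 := by
    intro f hf
    obtain ⟨hfN, hfe⟩ := hMsub f hf
    apply hadj
    obtain ⟨y, hyf, hyg⟩ := hirr f hf
    obtain ⟨z, hz, hz0, hze, hzg⟩ := h.exists_face_point he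
    obtain ⟨p, hp, hp0, hpf, hpg, hpe⟩ := exists_crossing hz hz0
      (y := y.1.1) (by rw [y.1.2.1]; norm_num) y.1.2.2 (hzg f hfN hfe) (not_le.mp hyf)
    have hpe := hpe e hze y.2
    refine h.adjacent he hfN hfe.symm hp hpe hpf fun u hue huf => ?_
    obtain ⟨s, hs, h1, h2, h3⟩ := exists_small_step hp hp0 (M.erase f) (fun g hg => by
      rw [Finset.mem_erase] at hg
      exact hpg g (hzg g (hMsub g hg.2).1 (hMsub g hg.2).2) (hyg g hg.2 hg.1)) u
    refine ⟨s, hs, h1, h2, hface _ h1 h2 ?_ fun g hg => ?_⟩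
    · rw [lor_add_left, lor_smul_left, hpe, hue]; simp
    · by_cases hgf : g = f
      · rw [hgf, lor_add_left, lor_smul_left, hpf, huf]; simp
      · exact (h3 g (Finset.mem_erase.mpr ⟨hgf, hg⟩)).le
  have hpe : lor (w - lor w e • e) e = 0 := by
    rw [lor_sub_left, lor_smul_left, h.unit e he]; ring
  have hpw : lor (w - lor w e • e) w < 0 := by
    rw [lor_sub_left, lor_smul_left, lor_comm e w]; nlinarith [sq_nonneg (lor w e)]
  have hpp : lor (w - lor w e • e) (w - lor w e • e) < 0 := by
    rw [lor_sub_right, lor_smul_right, hpe]; linarith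
  refine hface _ hpp (future_of_lor_neg hpp hw.le hw0 hpw) hpe fun f hf => ?_
  rw [lor_sub_left, lor_smul_left, hM' f hf]
  linarith [hwN f (hMsub f hf).1, hwN e he]

/-- Projecting an interior point of the face `g` into the face `e` keeps it in the polyhedron, which
forces `lor e g ≤ 0` for all pairs. If moreover `lor e g > -1`, the projection of `x` to the line
common to both planes is strictly inside all other faces. So the two faces really share an edge and
the product is `-1 / 2`. -/
lemma normalSystem (h : Presentation P N x) (hadj : ∀ e f, Adjacent P e f → lor e f = -1 / 2)
    (hv : vol P < ⊤) : NormalSystem N := by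
  classical
  have hnonpos : ∀ e ∈ N, ∀ g ∈ N, e ≠ g → lor e g ≤ 0 := by
    intro e he g hg heg
    obtain ⟨z, hz, hz0, hzg, hzf⟩ := h.exists_face_point hg
    have h1 := h.proj_mem hadj he hz hz0 (fun f hf => by
      by_cases hfg : f = g
      · rw [hfg, hzg]
      · exact (hzf f hf hfg).le) g hg
    rw [lor_sub_left, lor_smul_left, hzg] at h1
    have h2 := hzf e he heg
    by_contra! h3
    nlinarith
  refine ⟨h.unit, ⟨x, h.interior⟩, fun e he g hg heg => ?_,
    causal_of_vol_lt_top (by rw [← h.eq]; exact hv) x h.interior⟩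
  rcases le_or_gt (lor e g) (-1) with h1 | h1
  · exact Or.inr h1
  left
  apply hadj
  obtain ⟨z, hze, hzg, hz, hz0, hzf⟩ := exists_edge_proj x (h.unit e he) (h.unit g hg) h1
    (hnonpos e he g hg heg) (h.interior e he) (h.interior g hg)
  refine h.adjacent he hg heg hz hze hzg fun u hue hug => ?_
  obtain ⟨s, hs, h2, h3, h4⟩ := exists_small_step hz hz0 ((N.erase e).erase g) (fun f hf => by
    simp only [Finset.mem_erase] at hf
    exact hzf f (hnonpos e he f hf.2.2 (Ne.symm hf.2.1)) (hnonpos g hg f hf.2.2 (Ne.symm hf.1))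
      (h.interior f hf.2.2)) u
  refine ⟨s, hs, h2, h3, fun f hf => ?_⟩
  by_cases hfg : f = g
  · rw [hfg, lor_add_left, lor_smul_left, hzg, hug]; simp
  by_cases hfe : f = e
  · rw [hfe, lor_add_left, lor_smul_left, hze, hue]; simp
  · exact (h4 f (by simp [hfg, hfe, hf])).le

end Presentation

lemma IsEquiangular.exists_normalSystem {P : Set H3} (hP : IsEquiangular (Real.pi / 3) P) :
    ∃ N, NormalSystem N ∧ P = ⋂ e ∈ N, halfSpace e := by
  obtain ⟨N, x, h⟩ := hP.1.exists_presentation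
  exact ⟨N, h.normalSystem (fun e f hef => lor_eq_of_dihedralAngle (hP.2.2 e f hef)) hP.2.1, h.eq⟩

/-! ### The chart at an ideal vertex -/

/-- The normals of three faces that meet at an ideal vertex with dihedral angles `π / 3`. -/
structure Frame (e : Fin 3 → Mink) : Prop where
  unit : ∀ i, lor (e i) (e i) = 1
  pair : ∀ i j, i ≠ j → lor (e i) (e j) = -1 / 2
  future : 0 < (e 0 + e 1 + e 2).1

namespace Frame

variable {e : Fin 3 → Mink}

lemma lor_apex (h : Frame e) (i : Fin 3) : lor (e 0 + e 1 + e 2) (e i) = 0 := by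
  simp only [lor_add_left]
  fin_cases i
  · simp only [Fin.zero_eta]
    rw [h.unit 0, h.pair 1 0 (by decide), h.pair 2 0 (by decide)]; norm_num
  · simp only [Fin.mk_one]
    rw [h.unit 1, h.pair 0 1 (by decide), h.pair 2 1 (by decide)]; norm_num
  · simp only [Fin.reduceFinMk]
    rw [h.unit 2, h.pair 0 2 (by decide), h.pair 1 2 (by decide)]; norm_num

lemma lor_apex_self (h : Frame e) : lor (e 0 + e 1 + e 2) (e 0 + e 1 + e 2) = 0 := by
  rw [lor_add_right, lor_add_right, h.lor_apex, h.lor_apex, h.lor_apex]; norm_num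

lemma apex_ne_zero (h : Frame e) : e 0 + e 1 + e 2 ≠ 0 := by
  intro h0
  have := h.future
  rw [h0] at this
  exact lt_irrefl _ this

/-- The frame spans the orthogonal complement of the null apex, whose own complement is the line of
the apex. Otherwise `e 0`, `e 1`, `d`, the apex and a vector not orthogonal to the apex would be
independent. -/
lemma eq_smul_apex (h : Frame e) {d : Mink} (hd : ∀ i, lor d (e i) = 0) :
    ∃ c : ℝ, d = c • (e 0 + e 1 + e 2) := by
  obtain ⟨n, hn⟩ : ∃ n, lor (e 0 + e 1 + e 2) n ≠ 0 := by
    by_contra! hcon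
    exact h.apex_ne_zero (eq_zero_of_lor_eq_zero hcon)
  have hdep : ¬ LinearIndependent ℝ ![e 0, e 1, d, e 0 + e 1 + e 2, n] := by
    intro hli
    have := hli.fintype_card_le_finrank
    rw [finrank_mink] at this
    simp at this
  rw [Fintype.not_linearIndependent_iff] at hdep
  obtain ⟨c, hc, i, hi⟩ := hdep
  simp only [Fin.sum_univ_five] at hc
  simp only [Matrix.cons_val] at hc
  have pair : ∀ w, c 0 * lor (e 0) w + c 1 * lor (e 1) w + c 2 * lor d w +
      c 3 * lor (e 0 + e 1 + e 2) w + c 4 * lor n w = 0 := by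
    intro w
    have := congrArg (fun v => lor v w) hc
    simpa only [lor_add_left, lor_smul_left, lor_zero_left] using this
  have hdv : lor d (e 0 + e 1 + e 2) = 0 := by simp [lor_add_right, hd]
  have p := pair (e 0 + e 1 + e 2)
  rw [lor_comm (e 0), lor_comm (e 1), h.lor_apex, h.lor_apex, hdv, h.lor_apex_self,
    lor_comm n] at p
  have c4 : c 4 = 0 := by
    rcases mul_eq_zero.mp (show c 4 * lor (e 0 + e 1 + e 2) n = 0 by linarith) with h | h
    · exact h
    · exact absurd h hn
  have p0 := pair (e 0)
  have p1 := pair (e 1)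
  rw [h.unit 0, h.pair 1 0 (by decide), hd, h.lor_apex, c4] at p0
  rw [h.unit 1, h.pair 0 1 (by decide), hd, h.lor_apex, c4] at p1
  have c0 : c 0 = 0 := by linarith
  have c1 : c 1 = 0 := by linarith
  simp only [c0, c1, c4, zero_smul, zero_add, add_zero] at hc
  have c2 : c 2 ≠ 0 := by
    intro c2
    rw [c2, zero_smul, zero_add] at hc
    have c3 := (smul_eq_zero.mp hc).resolve_right h.apex_ne_zero
    fin_cases i <;> simp_all
  refine ⟨-(c 3 / c 2), ?_⟩
  have : c 2 • d = -(c 3 • (e 0 + e 1 + e 2)) := eq_neg_of_add_eq_zero_left hc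
  rw [← inv_smul_smul₀ c2 d, this, smul_neg, smul_smul, neg_smul]
  congr 2
  field_simp

lemma exists_lor_eq (h : Frame e) (Y : Fin 3 → ℝ) : ∃ x, ∀ i, lor x (e i) = Y i := by
  set L : Mink →ₗ[ℝ] (Fin 3 → ℝ) := LinearMap.pi fun i => lorL (e i) with hL
  have hker : LinearMap.ker L ≤ Submodule.span ℝ {e 0 + e 1 + e 2} := by
    intro d hd
    obtain ⟨c, rfl⟩ := h.eq_smul_apex (d := d) (fun i => congrFun hd i)
    exact Submodule.smul_mem _ _ (Submodule.mem_span_singleton_self _)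
  have h1 := Submodule.finrank_mono hker
  have h2 := finrank_span_singleton (K := ℝ) h.apex_ne_zero
  have h3 := LinearMap.finrank_range_add_finrank_ker L
  rw [finrank_mink] at h3
  have h4 : LinearMap.range L = ⊤ := by
    apply Submodule.eq_top_of_finrank_eq
    have := Submodule.finrank_le (LinearMap.range L)
    simp only [Module.finrank_fin_fun] at this ⊢
    omega
  obtain ⟨x, hx⟩ := LinearMap.range_eq_top.mp h4 Y
  exact ⟨x, fun i => congrFun hx i⟩

/-- On the orthogonal complement of the apex the form is a sum of squares. -/
lemma lor_self_of_perp (h : Frame e) {d : Mink} (hd : lor d (e 0 + e 1 + e 2) = 0) :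
    lor d d = 2 / 3 * (lor d (e 0) ^ 2 + lor d (e 1) ^ 2 + lor d (e 2) ^ 2) := by
  have hsum : lor d (e 0) + lor d (e 1) + lor d (e 2) = 0 := by
    simpa only [lor_add_right] using hd
  -- The Gram matrix of the frame acts as `3 / 2` on triples with sum zero, so the factor `2 / 3`
  -- inverts it. What remains is a multiple of the apex, which pairs to zero with `d`.
  obtain ⟨c, hc⟩ := h.eq_smul_apex (d := d - (2 / 3 * lor d (e 0)) • e 0 -
    (2 / 3 * lor d (e 1)) • e 1 - (2 / 3 * lor d (e 2)) • e 2) (by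
      intro i
      simp only [lor_sub_left, lor_smul_left]
      fin_cases i
      · simp only [Fin.zero_eta]
        rw [h.unit 0, h.pair 1 0 (by decide), h.pair 2 0 (by decide)]; linarith
      · simp only [Fin.mk_one]
        rw [h.unit 1, h.pair 0 1 (by decide), h.pair 2 1 (by decide)]; linarith
      · simp only [Fin.reduceFinMk]
        rw [h.unit 2, h.pair 0 2 (by decide), h.pair 1 2 (by decide)]; linarith)
  have h1 := congrArg (fun v => lor v d) hc
  simp only [lor_sub_left, lor_smul_left] at h1
  rw [lor_comm (e 0 + e 1 + e 2), hd, lor_comm (e 0), lor_comm (e 1), lor_comm (e 2)] at h1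
  linear_combination h1

/-- The form in terms of the pairings with the frame. -/
lemma lor_eq (h : Frame e) {x y : Mink} {s m : ℝ} (hs : lor x (e 0 + e 1 + e 2) = -s)
    (hm : lor y (e 0 + e 1 + e 2) = -m) (hs0 : s ≠ 0) (hm0 : m ≠ 0) :
    2 * lor x y / (s * m) = lor x x / s ^ 2 + lor y y / m ^ 2 -
      2 / 3 * ((lor x (e 0) / s - lor y (e 0) / m) ^ 2 + (lor x (e 1) / s - lor y (e 1) / m) ^ 2 +
        (lor x (e 2) / s - lor y (e 2) / m) ^ 2) := by
  -- Normalised to have equal pairing with the apex, the vectors differ by something orthogonal to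
  -- it. The sum of squares is the squared distance of the feet in the base plane.
  have h1 := h.lor_self_of_perp (d := s⁻¹ • x - m⁻¹ • y) (by
    rw [lor_sub_left, lor_smul_left, lor_smul_left, hs, hm]; field_simp; norm_num)
  simp only [lor_sub_left, lor_sub_right, lor_smul_left, lor_smul_right, lor_comm y x] at h1
  have e1 : ∀ i, lor x (e i) / s = s⁻¹ * lor x (e i) := fun i => by rw [div_eq_inv_mul]
  have e2 : ∀ i, lor y (e i) / m = m⁻¹ * lor y (e i) := fun i => by rw [div_eq_inv_mul]
  rw [e1, e1, e1, e2, e2, e2, ← h1]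
  field_simp
  ring

lemma lor_apex_neg (h : Frame e) (x : H3) : lor x.1 (e 0 + e 1 + e 2) < 0 :=
  x.lor_neg h.lor_apex_self.le h.future

lemma ext_H3 (h : Frame e) {x y : H3} (hxy : ∀ i, lor x.1 (e i) = lor y.1 (e i)) : x = y := by
  obtain ⟨c, hc⟩ := h.eq_smul_apex (d := x.1 - y.1) (fun i => by rw [lor_sub_left, hxy, sub_self])
  have h1 : x.1 = y.1 + c • (e 0 + e 1 + e 2) := by rw [← hc]; abel
  have h2 := x.2.1
  rw [h1] at h2
  simp only [lor_add_left y.1, lor_add_right _ y.1, lor_smul_left, lor_smul_right, y.2.1,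
    h.lor_apex_self, lor_comm (e 0 + e 1 + e 2) y.1] at h2
  have h3 : c = 0 := by
    rcases mul_eq_zero.mp (show c * lor y.1 (e 0 + e 1 + e 2) = 0 by linarith) with h3 | h3
    · exact h3
    · exact absurd h3 (h.lor_apex_neg y).ne
  apply Subtype.ext
  rw [h1, h3, zero_smul, add_zero]

/-- Adding a multiple of the apex changes no pairing with the frame and moves the square linearly,
so exactly one multiple reaches `-1`. With `ext_H3`, the three pairings are global coordinates on
hyperbolic space. -/
lemma exists_H3 (h : Frame e) (Y : Fin 3 → ℝ) (hY : 0 < Y 0 + Y 1 + Y 2) :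
    ∃ x : H3, ∀ i, lor x.1 (e i) = -Y i := by
  obtain ⟨x, hx⟩ := h.exists_lor_eq fun i => -Y i
  set s := Y 0 + Y 1 + Y 2 with hs
  have hxv : lor x (e 0 + e 1 + e 2) = -s := by
    simp only [lor_add_right, hx]; rw [hs]; ring
  set c := (lor x x + 1) / (2 * s) with hc
  have h1 : lor (x + c • (e 0 + e 1 + e 2)) (x + c • (e 0 + e 1 + e 2)) = -1 := by
    simp only [lor_add_left x, lor_add_right _ x, lor_smul_left, lor_smul_right,
      h.lor_apex_self, lor_comm (e 0 + e 1 + e 2) x, hxv]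
    rw [hc]; field_simp; ring
  have h2 : lor (x + c • (e 0 + e 1 + e 2)) (e 0 + e 1 + e 2) < 0 := by
    rw [lor_add_left, lor_smul_left, h.lor_apex_self, hxv]; linarith
  refine ⟨⟨_, h1, future_of_lor_neg (by rw [h1]; norm_num) h.lor_apex_self.le h.future h2⟩, ?_⟩
  intro i
  change lor (x + c • (e 0 + e 1 + e 2)) (e i) = -Y i
  rw [lor_add_left, lor_smul_left, h.lor_apex, hx]; ring

end Frame

/-- The chart at an ideal vertex: in the upper half-space model with the vertex at infinity, the
first two barycentric coordinates of the foot of the point, and a multiple of its inverse squared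
height. -/
noncomputable def chart (e : Fin 3 → Mink) (x : H3) : E3 :=
  !₂[lor x.1 (e 0) / lor x.1 (e 0 + e 1 + e 2), lor x.1 (e 1) / lor x.1 (e 0 + e 1 + e 2),
    lor x.1 (e 0 + e 1 + e 2) ^ 2]

lemma Frame.chart_injective {e : Fin 3 → Mink} (h : Frame e) : Function.Injective (chart e) := by
  intro x y hxy
  have h0 : lor x.1 (e 0) / lor x.1 (e 0 + e 1 + e 2) = lor y.1 (e 0) / lor y.1 (e 0 + e 1 + e 2) :=
    congrArg (fun v : E3 => v 0) hxy
  have h1 : lor x.1 (e 1) / lor x.1 (e 0 + e 1 + e 2) = lor y.1 (e 1) / lor y.1 (e 0 + e 1 + e 2) :=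
    congrArg (fun v : E3 => v 1) hxy
  have h2 : lor x.1 (e 0 + e 1 + e 2) ^ 2 = lor y.1 (e 0 + e 1 + e 2) ^ 2 :=
    congrArg (fun v : E3 => v 2) hxy
  have hx := h.lor_apex_neg x
  have hy := h.lor_apex_neg y
  have h3 : lor x.1 (e 0 + e 1 + e 2) = lor y.1 (e 0 + e 1 + e 2) := by
    rcases sq_eq_sq_iff_eq_or_eq_neg.mp h2 with h | h
    · exact h
    · linarith
  rw [h3] at h0 h1
  have h0' := (div_left_inj' hy.ne).mp h0
  have h1' := (div_left_inj' hy.ne).mp h1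
  apply h.ext_H3
  intro i
  fin_cases i
  · exact h0'
  · exact h1'
  · simp only [lor_add_right] at h3
    change lor x.1 (e 2) = lor y.1 (e 2)
    linarith

/-! ### Volume in the chart -/

lemma lor_eq_coords (v w : Mink) :
    lor v w = -(v.1 * w.1) + (v.2 0 * w.2 0 + v.2 1 * w.2 1 + v.2 2 * w.2 2) := by
  simp only [lor, PiLp.inner_apply, Fin.sum_univ_three, RCLike.inner_apply, conj_trivial]; ring

/-- The coordinate matrix of four vectors of Minkowski space. -/
def minkMatrix (r : Fin 4 → Mink) : Matrix (Fin 4) (Fin 4) ℝ :=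
  Matrix.of fun i => ![(r i).1, (r i).2 0, (r i).2 1, (r i).2 2]

lemma det_minkMatrix (r : Fin 4 → Mink) : (minkMatrix r).det =
    (r 0).1 * (Matrix.of fun i j => (r (Fin.succ i)).2 j : Matrix (Fin 3) (Fin 3) ℝ).det
    - (r 0).2 0 * ((r 1).1 * ((r 2).2 1 * (r 3).2 2 - (r 2).2 2 * (r 3).2 1)
        - (r 2).1 * ((r 1).2 1 * (r 3).2 2 - (r 1).2 2 * (r 3).2 1)
        + (r 3).1 * ((r 1).2 1 * (r 2).2 2 - (r 1).2 2 * (r 2).2 1))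
    + (r 0).2 1 * ((r 1).1 * ((r 2).2 0 * (r 3).2 2 - (r 2).2 2 * (r 3).2 0)
        - (r 2).1 * ((r 1).2 0 * (r 3).2 2 - (r 1).2 2 * (r 3).2 0)
        + (r 3).1 * ((r 1).2 0 * (r 2).2 2 - (r 1).2 2 * (r 2).2 0))
    - (r 0).2 2 * ((r 1).1 * ((r 2).2 0 * (r 3).2 1 - (r 2).2 1 * (r 3).2 0)
        - (r 2).1 * ((r 1).2 0 * (r 3).2 1 - (r 1).2 1 * (r 3).2 0)
        + (r 3).1 * ((r 1).2 0 * (r 2).2 1 - (r 1).2 1 * (r 2).2 0)) := by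
  have h12 : (1 : Fin 4).succAbove (2 : Fin 3) = 3 := by decide
  have h11 : (1 : Fin 4).succAbove (1 : Fin 3) = 2 := by decide
  have h10 : (1 : Fin 4).succAbove (0 : Fin 3) = 0 := by decide
  have h22 : (2 : Fin 4).succAbove (2 : Fin 3) = 3 := by decide
  have h21 : (2 : Fin 4).succAbove (1 : Fin 3) = 1 := by decide
  have h20 : (2 : Fin 4).succAbove (0 : Fin 3) = 0 := by decide
  have h32 : (3 : Fin 4).succAbove (2 : Fin 3) = 2 := by decide
  have h31 : (3 : Fin 4).succAbove (1 : Fin 3) = 1 := by decide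
  have h30 : (3 : Fin 4).succAbove (0 : Fin 3) = 0 := by decide
  rw [Matrix.det_succ_row_zero, Fin.sum_univ_four]
  simp only [Matrix.det_fin_three, Matrix.submatrix_apply, minkMatrix, Matrix.of_apply,
    Fin.succAbove_zero, h10, h11, h12, h20, h21, h22, h30, h31, h32, Fin.succ_zero_eq_one,
    Fin.succ_one_eq_two, Fin.reduceSucc, Matrix.cons_val]
  norm_num [Fin.val_zero]
  ring

/-- The Gram matrix is `M * J * Mᵀ` with `J` the signature matrix, of determinant `-1`. -/
lemma det_minkMatrix_sq (r : Fin 4 → Mink) :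
    (minkMatrix r).det ^ 2 = -(Matrix.of fun i j => lor (r i) (r j)).det := by
  have h : (Matrix.of fun i j => lor (r i) (r j)) =
      minkMatrix r * Matrix.diagonal ![-1, 1, 1, 1] * (minkMatrix r).transpose := by
    ext i j
    rw [Matrix.mul_apply]
    simp only [Matrix.mul_diagonal, Fin.sum_univ_four, minkMatrix, Matrix.transpose_apply,
      Matrix.of_apply, Matrix.cons_val, lor_eq_coords]
    ring
  rw [h, Matrix.det_mul, Matrix.det_mul, Matrix.det_diagonal, Matrix.det_transpose]
  simp [Fin.prod_univ_four]
  ring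

/-- The gradient of `y ↦ ⟨lift y, e⟩`. -/
noncomputable def gradLor (e : Mink) (y : E3) : E3 := e.2 - (e.1 / √(1 + ‖y‖ ^ 2)) • y

lemma hasFDerivAt_lor_lift (e : Mink) (y : E3) :
    HasFDerivAt (fun y => lor (lift y).1 e) (innerSL ℝ (gradLor e y)) y := by
  have hpos : (0 : ℝ) < 1 + ‖y‖ ^ 2 := by positivity
  have h1 : HasFDerivAt (fun y : E3 => 1 + ‖y‖ ^ 2) (2 • innerSL ℝ y) y := by
    have := (hasStrictFDerivAt_norm_sq y).hasFDerivAt.const_add 1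
    exact this
  have h2 := h1.sqrt hpos.ne'
  have h3 : HasFDerivAt (fun y : E3 => inner ℝ y e.2) (innerSL ℝ e.2) y := by
    have := (innerSL ℝ e.2).hasFDerivAt (x := y)
    refine this.congr_of_eventuallyEq (Filter.Eventually.of_forall fun z => ?_)
    simp [real_inner_comm]
  have h4 := (h2.mul_const e.1).neg.add h3
  refine h4.congr_fderiv ?_
  ext z
  simp only [gradLor, add_apply, neg_apply, smul_apply, innerSL_apply_apply, inner_sub_left, inner_smul_left, smul_eq_mul,
    nsmul_eq_mul]
  simp
  field_simp
  ring

/-- Rows of the Jacobian of the chart. -/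
noncomputable def chartRow (e : Fin 3 → Mink) (y : E3) : Fin 3 → E3 :=
  let t := lor (lift y).1 (e 0 + e 1 + e 2)
  let g := gradLor (e 0 + e 1 + e 2) y
  ![t⁻¹ • gradLor (e 0) y - (lor (lift y).1 (e 0) / t ^ 2) • g,
    t⁻¹ • gradLor (e 1) y - (lor (lift y).1 (e 1) / t ^ 2) • g, (2 * t) • g]

/-- The derivative of the chart. -/
noncomputable def chartDeriv (e : Fin 3 → Mink) (y : E3) : E3 →L[ℝ] E3 :=
  (Matrix.toEuclideanLin (Matrix.of fun i k => chartRow e y i k)).toContinuousLinearMap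

lemma chartDeriv_apply (e : Fin 3 → Mink) (y z : E3) (i : Fin 3) :
    chartDeriv e y z i = inner ℝ (chartRow e y i) z := by
  simp [chartDeriv, Matrix.toEuclideanLin, Matrix.mulVec, dotProduct, PiLp.inner_apply, mul_comm]

lemma Frame.hasFDerivAt_chart {e : Fin 3 → Mink} (h : Frame e) (y : E3) :
    HasFDerivAt (fun y => chart e (lift y)) (chartDeriv e y) y := by
  have ht := (h.lor_apex_neg (lift y)).ne
  rw [← hasFDerivWithinAt_univ, hasFDerivWithinAt_euclidean]
  have hquot : ∀ f : Mink, HasFDerivAt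
      (fun y => lor (lift y).1 f / lor (lift y).1 (e 0 + e 1 + e 2))
      (innerSL ℝ ((lor (lift y).1 (e 0 + e 1 + e 2))⁻¹ • gradLor f y -
        (lor (lift y).1 f / lor (lift y).1 (e 0 + e 1 + e 2) ^ 2) •
          gradLor (e 0 + e 1 + e 2) y)) y := by
    intro f
    have h1 := (hasDerivAt_inv ht).comp_hasFDerivAt y (hasFDerivAt_lor_lift (e 0 + e 1 + e 2) y)
    have := (hasFDerivAt_lor_lift f y).mul h1
    simp only [div_eq_mul_inv]
    refine this.congr_fderiv ?_
    ext z
    simp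
    field_simp
    ring
  intro i
  have hproj : PiLp.proj 2 (fun _ : Fin 3 => ℝ) i ∘L chartDeriv e y =
      innerSL ℝ (chartRow e y i) := by
    ext z
    simpa using chartDeriv_apply e y z i
  rw [hproj, hasFDerivWithinAt_univ]
  fin_cases i
  · exact hquot (e 0)
  · exact hquot (e 1)
  · have := (hasFDerivAt_lor_lift (e 0 + e 1 + e 2) y).pow 2
    refine this.congr_fderiv ?_
    ext z
    simp [chartRow]

/-- Let `t` be the pairing with the apex. Row operations reduce the Jacobian to the gradients of the
three frame pairings, at the cost of a factor `2 / t`. The determinant of these gradients is `D /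
s`, where `D` is the Minkowski determinant of the point and the frame. The Gram determinant gives `D
^ 2 = 3 / 4 * t ^ 2`, so `t` cancels. -/
lemma Frame.abs_det_chartDeriv {e : Fin 3 → Mink} (h : Frame e) (y : E3) :
    |(chartDeriv e y).det| = √3 * (1 / √(1 + ‖y‖ ^ 2)) := by
  have ht := h.lor_apex_neg (lift y)
  set s := √(1 + ‖y‖ ^ 2) with hs
  have hs0 : 0 < s := Real.sqrt_pos.mpr (by positivity)
  have hdet : (chartDeriv e y).det = (Matrix.of fun i k => chartRow e y i k).det := by
    rw [ContinuousLinearMap.det, chartDeriv, LinearMap.coe_toContinuousLinearMap,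
      Matrix.toEuclideanLin_eq_toLin_orthonormal, LinearMap.det_toLin]
  set D := (minkMatrix ![(lift y).1, e 0, e 1, e 2]).det with hD
  have hgram : D ^ 2 = 3 / 4 * lor (lift y).1 (e 0 + e 1 + e 2) ^ 2 := by
    rw [hD, det_minkMatrix_sq, lor_add_right, lor_add_right]
    have e1 : (Matrix.of fun i j => lor (![(lift y).1, e 0, e 1, e 2] i)
        (![(lift y).1, e 0, e 1, e 2] j)) =
        !![-1, lor (lift y).1 (e 0), lor (lift y).1 (e 1), lor (lift y).1 (e 2);
          lor (lift y).1 (e 0), 1, -1 / 2, -1 / 2; lor (lift y).1 (e 1), -1 / 2, 1, -1 / 2;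
          lor (lift y).1 (e 2), -1 / 2, -1 / 2, 1] := by
      ext i j
      fin_cases i <;> fin_cases j <;>
        simp [h.unit, h.pair, (lift y).2.1, lor_comm (e _) (lift y).1]
    rw [e1]
    simp [Matrix.det_succ_row_zero, Fin.sum_univ_succ, Fin.succAbove]
    ring
  have hrel : (chartDeriv e y).det * (lor (lift y).1 (e 0 + e 1 + e 2) * s) = 2 * D := by
    rw [hdet, hD]
    have hl1 : (lift y).1.1 = s := rfl
    have hl2 : (lift y).1.2 = y := rfl
    have hc : ∀ i, gradLor (e 0 + e 1 + e 2) y i =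
        gradLor (e 0) y i + gradLor (e 1) y i + gradLor (e 2) y i := by
      intro i
      simp [gradLor]
      ring
    have ht' : lor (lift y).1 (e 0 + e 1 + e 2) = lor (lift y).1 (e 0) + lor (lift y).1 (e 1) +
        lor (lift y).1 (e 2) := by rw [lor_add_right, lor_add_right]
    have hdet3 : (Matrix.of fun i k => chartRow e y i k).det *
        lor (lift y).1 (e 0 + e 1 + e 2) =
        2 * (Matrix.of fun i k => gradLor (e i) y k).det := by
      rw [Matrix.det_fin_three, Matrix.det_fin_three]
      simp only [chartRow, Matrix.of_apply, Matrix.cons_val, PiLp.sub_apply, PiLp.smul_apply,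
        smul_eq_mul, hc]
      have htne := ht.ne
      rw [ht'] at htne ⊢
      field_simp
      ring
    rw [← mul_assoc, hdet3]
    rw [det_minkMatrix, Matrix.det_fin_three, Matrix.det_fin_three]
    simp only [gradLor, Matrix.of_apply, Matrix.cons_val, PiLp.sub_apply, PiLp.smul_apply,
      smul_eq_mul, hl1, hl2, ← hs, Fin.succ_zero_eq_one, Fin.succ_one_eq_two, Fin.reduceSucc]
    field_simp
    ring
  have h1 : (chartDeriv e y).det ^ 2 = (√3 * (1 / s)) ^ 2 := by
    have h2 : ((chartDeriv e y).det * (lor (lift y).1 (e 0 + e 1 + e 2) * s)) ^ 2 =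
        3 * lor (lift y).1 (e 0 + e 1 + e 2) ^ 2 := by
      rw [hrel, mul_pow, hgram]; ring
    have h3 : lor (lift y).1 (e 0 + e 1 + e 2) ^ 2 ≠ 0 := pow_ne_zero _ ht.ne
    rw [mul_pow, Real.sq_sqrt (by norm_num)]
    have h4 : (chartDeriv e y).det ^ 2 * s ^ 2 = 3 := by
      apply mul_right_cancel₀ h3
      rw [← h2]; ring
    field_simp
    linarith
  rw [← Real.sqrt_sq_eq_abs, h1, Real.sqrt_sq (by positivity)]

lemma lift_surjective (x : H3) : lift x.1.2 = x := by
  apply Subtype.ext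
  ext1
  · have h := x.2.1
    rw [lor_self] at h
    change √(1 + ‖x.1.2‖ ^ 2) = x.1.1
    rw [show 1 + ‖x.1.2‖ ^ 2 = x.1.1 ^ 2 by linarith, Real.sqrt_sq x.2.2.le]
  · rfl

lemma lift_injective : Function.Injective lift := fun a b h => by
  have : (lift a).1.2 = (lift b).1.2 := by rw [h]
  exact this

/-- The chart multiplies volumes by `√3`. -/
lemma Frame.volume_chart_image {e : Fin 3 → Mink} (h : Frame e) {A : Set H3}
    (hA : MeasurableSet A) : volume (chart e '' A) = ENNReal.ofReal (√3) * vol A := by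
  have himg : chart e '' A = (fun y => chart e (lift y)) '' (lift ⁻¹' A) := by
    ext p
    constructor
    · rintro ⟨x, hx, rfl⟩
      exact ⟨x.1.2, by rw [Set.mem_preimage, lift_surjective]; exact hx, by
        simp only [lift_surjective]⟩
    · rintro ⟨y, hy, rfl⟩
      exact ⟨_, hy, rfl⟩
  rw [himg, ← lintegral_abs_det_fderiv_eq_addHaar_image volume (measurable_lift hA)
    (fun y _ => (h.hasFDerivAt_chart y).hasFDerivWithinAt)
    ((h.chart_injective.comp lift_injective).injOn), vol_apply hA,
    ← lintegral_const_mul _ (by fun_prop)]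
  congr 1
  ext y
  rw [h.abs_det_chartDeriv, ENNReal.ofReal_mul (by positivity)]

/-! ### Ideal vertices and their cells -/

lemma Frame.comp_perm {e : Fin 3 → Mink} (h : Frame e) (s : Equiv.Perm (Fin 3)) :
    Frame (e ∘ s) := by
  refine ⟨fun i => h.unit _, fun i j hij => h.pair _ _ (s.injective.ne hij), ?_⟩
  have h1 := Equiv.sum_comp s e
  rw [Fin.sum_univ_three, Fin.sum_univ_three] at h1
  simp only [Function.comp_apply]
  rw [h1]
  exact h.future

/-- Here `r` and `r'` are radii of hemispheres over one side of the triangle. Parametrise that side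
by `[0, 1]`. The centres project to `a + r / 4` and `a' + r' / 4`, and the hypotheses say that the
intervals of half-lengths `3 * r / 4` and `3 * r' / 4` about them lie in `[0, 1]` without
overlapping. So their total length `3 / 2 * (r + r')` is at most 1. -/
lemma add_le_of_separated {r r' a a' : ℝ} (hr : 0 < r) (hr' : 0 < r') (h1 : r / 2 ≤ a)
    (h1' : r' / 2 ≤ a') (h2 : r / 2 ≤ 1 - r / 2 - a) (h2' : r' / 2 ≤ 1 - r' / 2 - a')
    (h : r ^ 2 + r' ^ 2 - 2 / 3 * ((-r / 2 - -r' / 2) ^ 2 + (-a - -a') ^ 2 +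
      (-(1 - r / 2 - a) - -(1 - r' / 2 - a')) ^ 2) ≤ -(r * r')) : r + r' ≤ 2 / 3 := by
  have hp2 : (3 / 4 * (r + r')) ^ 2 ≤ ((a + r / 4) - (a' + r' / 4)) ^ 2 := by nlinarith
  have hp3 := sq_le_sq.mp hp2
  rw [abs_of_pos (by positivity)] at hp3
  rcases abs_cases ((a + r / 4) - (a' + r' / 4)) with ⟨h3, -⟩ | ⟨h3, -⟩ <;> rw [h3] at hp3 <;>
    linarith

/-- Two spheres over the same side of the base triangle do not overlap. -/
lemma Frame.inv_add_inv_le {e : Fin 3 → Mink} (h : Frame e) {D E : Mink} (hD : lor D D = 1)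
    (hE : lor E E = 1) (hDE : lor D E ≤ -1 / 2) (hD0 : lor D (e 0) = -1 / 2)
    (hE0 : lor E (e 0) = -1 / 2) (hD1 : lor D (e 1) ≤ -1 / 2) (hD2 : lor D (e 2) ≤ -1 / 2)
    (hE1 : lor E (e 1) ≤ -1 / 2) (hE2 : lor E (e 2) ≤ -1 / 2) {m m' : ℝ}
    (hm : lor D (e 0 + e 1 + e 2) = -m) (hm' : lor E (e 0 + e 1 + e 2) = -m') :
    1 / m + 1 / m' ≤ 2 / 3 := by
  have hms := hm
  have hms' := hm'
  rw [lor_add_right, lor_add_right] at hms hms'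
  have hm0 : 0 < m := by linarith
  have hm0' : 0 < m' := by linarith
  have key := h.lor_eq hm hm' hm0.ne' hm0'.ne'
  rw [hD, hE, hD0, hE0] at key
  set r := 1 / m with hr
  set r' := 1 / m' with hr'
  have hr0 : 0 < r := by positivity
  have hr0' : 0 < r' := by positivity
  have hrm : m * r = 1 := by rw [hr]; field_simp
  have hrm' : m' * r' = 1 := by rw [hr']; field_simp
  set a := -lor D (e 1) * r with ha
  set a' := -lor E (e 1) * r' with ha'
  have q1 : lor D (e 1) / m = -a := by rw [ha, hr]; ring
  have q2 : lor E (e 1) / m' = -a' := by rw [ha', hr']; ring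
  have q3 : lor D (e 2) / m = -(1 - r / 2 - a) := by
    have : lor D (e 2) = -m + 1 / 2 - lor D (e 1) := by linarith
    rw [this, ha, hr]; field_simp; ring
  have q4 : lor E (e 2) / m' = -(1 - r' / 2 - a') := by
    have : lor E (e 2) = -m' + 1 / 2 - lor E (e 1) := by linarith
    rw [this, ha', hr']; field_simp; ring
  have q5 : -1 / 2 / m = -r / 2 := by rw [hr]; ring
  have q6 : -1 / 2 / m' = -r' / 2 := by rw [hr']; ring
  have q7 : 2 * lor D E / (m * m') = 2 * lor D E * (r * r') := by rw [hr, hr']; field_simp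
  have q8 : 1 / m ^ 2 = r ^ 2 := by rw [hr]; ring
  have q9 : 1 / m' ^ 2 = r' ^ 2 := by rw [hr']; ring
  rw [q1, q2, q3, q4, q5, q6, q7, q8, q9] at key
  have hle : 2 * lor D E * (r * r') ≤ -(r * r') := by
    have := mul_le_mul_of_nonneg_right hDE (mul_pos hr0 hr0').le
    linarith
  have b1 : r / 2 ≤ a := by
    have h1 : lor D (e 1) * r ≤ -1 / 2 * r := mul_le_mul_of_nonneg_right hD1 hr0.le
    linarith
  have b1' : r' / 2 ≤ a' := by
    have h1 : lor E (e 1) * r' ≤ -1 / 2 * r' := mul_le_mul_of_nonneg_right hE1 hr0'.le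
    linarith
  have b2 : r / 2 ≤ 1 - r / 2 - a := by
    have h1 : lor D (e 2) * r ≤ -1 / 2 * r := mul_le_mul_of_nonneg_right hD2 hr0.le
    have h2 : lor D (e 2) * r = -(1 - r / 2 - a) := by rw [← q3, hr]; ring
    linarith
  have b2' : r' / 2 ≤ 1 - r' / 2 - a' := by
    have h1 : lor E (e 2) * r' ≤ -1 / 2 * r' := mul_le_mul_of_nonneg_right hE2 hr0'.le
    have h2 : lor E (e 2) * r' = -(1 - r' / 2 - a') := by rw [← q4, hr']; ring
    linarith
  exact add_le_of_separated hr0 hr0' b1 b1' b2 b2' (by linarith)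

/-- The distance from the corner `i` is at least its component along the altitude. The form on the
right is the squared distance that gives the triangle altitude 1; the barycentric coordinates carry
a minus sign. -/
lemma sq_le_of_corner {p q : Fin 3 → ℝ} (hp : p 0 + p 1 + p 2 = -1) (hq : q 0 + q 1 + q 2 = -1)
    (i : Fin 3) (hqj : ∀ j, j ≠ i → q j = 0) :
    (1 + p i) ^ 2 ≤ 2 / 3 * ((p 0 - q 0) ^ 2 + (p 1 - q 1) ^ 2 + (p 2 - q 2) ^ 2) := by
  have hp2 : p 2 = -1 - p 0 - p 1 := by linarith
  fin_cases i
  · have h1 : q 1 = 0 := hqj 1 (by decide)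
    have h2 : q 2 = 0 := hqj 2 (by decide)
    have h0 : q 0 = -1 := by linarith
    simp only [Fin.zero_eta, h0, h1, h2, hp2]
    nlinarith [sq_nonneg (1 + p 0 + 2 * p 1)]
  · have h1 : q 0 = 0 := hqj 0 (by decide)
    have h2 : q 2 = 0 := hqj 2 (by decide)
    have h0 : q 1 = -1 := by linarith
    simp only [Fin.mk_one, h0, h1, h2, hp2]
    nlinarith [sq_nonneg (1 + p 1 + 2 * p 0)]
  · have h1 : q 0 = 0 := hqj 0 (by decide)
    have h2 : q 1 = 0 := hqj 1 (by decide)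
    have h0 : q 2 = -1 := by linarith
    simp only [Fin.reduceFinMk, h0, h1, h2, hp2]
    nlinarith [sq_nonneg (p 0 - p 1)]

/-- A face whose plane is far below stays below the points near the apex. -/
lemma Frame.lor_face_nonpos {e : Fin 3 → Mink} (he : Frame e) {x : H3} {f : Mink}
    (hf : lor f f = 1) (hm : lor f (e 0 + e 1 + e 2) ≤ -2)
    (hw : lor x.1 (e 0 + e 1 + e 2) ^ 2 < 3) : lor x.1 f ≤ 0 := by
  obtain ⟨σ, hσ⟩ : ∃ σ, lor x.1 (e 0 + e 1 + e 2) = -σ := ⟨_, (neg_neg _).symm⟩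
  obtain ⟨m, hfm⟩ : ∃ m, lor f (e 0 + e 1 + e 2) = -m := ⟨_, (neg_neg _).symm⟩
  have hσ0 : 0 < σ := by linarith [he.lor_apex_neg x]
  have hm0 : 2 ≤ m := by linarith
  have h1 := he.lor_eq hσ hfm hσ0.ne' (by linarith)
  rw [x.2.1, hf] at h1
  rw [hσ, neg_sq] at hw
  -- The height `1 / σ` exceeds `1 / √3`, while the hemisphere has radius at most `1 / 2`.
  have h2 : 1 / m ^ 2 ≤ 1 / σ ^ 2 := one_div_le_one_div_of_le (by positivity) (by nlinarith)
  have h3 : 2 * lor x.1 f / (σ * m) ≤ 0 := by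
    have : -1 / σ ^ 2 = -(1 / σ ^ 2) := by ring
    rw [h1, this]
    have := sq_nonneg (lor x.1 (e 0) / σ - lor f (e 0) / m)
    have := sq_nonneg (lor x.1 (e 1) / σ - lor f (e 1) / m)
    have := sq_nonneg (lor x.1 (e 2) / σ - lor f (e 2) / m)
    linarith
  by_contra! h4
  have : 0 < 2 * lor x.1 f / (σ * m) := by positivity
  linarith

/-- Points near the apex are closer to the apex than to a distant ideal point. -/
lemma Frame.lor_lt_apex_of_far {e : Fin 3 → Mink} (he : Frame e) {x : H3} {n : Mink}
    (hn : lor n n = 0) (hm : lor n (e 0 + e 1 + e 2) ≤ -6)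
    (hw : lor x.1 (e 0 + e 1 + e 2) ^ 2 < 3) : lor x.1 n < lor x.1 (e 0 + e 1 + e 2) := by
  obtain ⟨σ, hσ⟩ : ∃ σ, lor x.1 (e 0 + e 1 + e 2) = -σ := ⟨_, (neg_neg _).symm⟩
  obtain ⟨m, hnm⟩ : ∃ m, lor n (e 0 + e 1 + e 2) = -m := ⟨_, (neg_neg _).symm⟩
  have hσ0 : 0 < σ := by linarith [he.lor_apex_neg x]
  have hm0 : 6 ≤ m := by linarith
  have h1 := he.lor_eq hσ hnm hσ0.ne' (by linarith)
  rw [x.2.1, hn, zero_div] at h1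
  rw [hσ, neg_sq] at hw
  have h2 : 2 * lor x.1 n / (σ * m) ≤ -1 / σ ^ 2 := by
    rw [h1]
    have := sq_nonneg (lor x.1 (e 0) / σ - lor n (e 0) / m)
    have := sq_nonneg (lor x.1 (e 1) / σ - lor n (e 1) / m)
    have := sq_nonneg (lor x.1 (e 2) / σ - lor n (e 2) / m)
    linarith
  rw [div_le_div_iff₀ (by positivity) (by positivity)] at h2
  -- Equidistance from the two ideal points is a hemisphere of squared radius `2 / m ≤ 1 / 3`, and
  -- points with `σ ^ 2 < 3` are above it. This is where the height `3` of the prism comes from.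
  have h3 : 2 * lor x.1 n * σ ≤ -m := by
    have : (2 * lor x.1 n * σ) * σ ≤ -m * σ := by linarith
    exact le_of_mul_le_mul_right this hσ0
  rw [hσ]
  by_contra! h4
  have := mul_le_mul_of_nonneg_right h4 hσ0.le
  nlinarith

/-- Points above a hemisphere are closer to the apex than to a neighbouring ideal point. -/
lemma Frame.lor_lt_apex_of_adj {e : Fin 3 → Mink} (he : Frame e) {x : H3} {n : Mink} {m : ℝ}
    (hn : lor n n = 0) (hnm : lor n (e 0 + e 1 + e 2) = -m) (hm : 0 < m) (i : Fin 3)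
    (hnj : ∀ j, j ≠ i → lor n (e j) = 0)
    (hw : lor x.1 (e 0 + e 1 + e 2) ^ 2 *
      (2 / m - (1 - lor x.1 (e i) / lor x.1 (e 0 + e 1 + e 2)) ^ 2) < 1) :
    lor x.1 n < lor x.1 (e 0 + e 1 + e 2) := by
  obtain ⟨σ, hσ⟩ : ∃ σ, lor x.1 (e 0 + e 1 + e 2) = -σ := ⟨_, (neg_neg _).symm⟩
  have hσ0 : 0 < σ := by linarith [he.lor_apex_neg x]
  have h1 := he.lor_eq hσ hnm hσ0.ne' hm.ne'
  rw [x.2.1, hn, zero_div, add_zero] at h1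
  have hps : lor x.1 (e 0) / σ + lor x.1 (e 1) / σ + lor x.1 (e 2) / σ = -1 := by
    rw [← add_div, ← add_div, ← lor_add_right, ← lor_add_right, hσ]; field_simp
  have hns : lor n (e 0) / m + lor n (e 1) / m + lor n (e 2) / m = -1 := by
    rw [← add_div, ← add_div, ← lor_add_right, ← lor_add_right, hnm]; field_simp
  have hnj' : ∀ j, j ≠ i → lor n (e j) / m = 0 := fun j hj => by rw [hnj j hj, zero_div]
  rw [hσ, neg_sq, div_neg, sub_neg_eq_add] at hw
  rw [hσ]
  have h2 : (1 + lor x.1 (e i) / σ) ^ 2 ≤ 2 / 3 * ((lor x.1 (e 0) / σ - lor n (e 0) / m) ^ 2 +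
      (lor x.1 (e 1) / σ - lor n (e 1) / m) ^ 2 + (lor x.1 (e 2) / σ - lor n (e 2) / m) ^ 2) := by
    exact sq_le_of_corner (p := fun j => lor x.1 (e j) / σ) (q := fun j => lor n (e j) / m)
      hps hns i hnj'
  have h3 : 2 / m < 1 / σ ^ 2 + (1 + lor x.1 (e i) / σ) ^ 2 := by
    have h5 : 2 / m - (1 + lor x.1 (e i) / σ) ^ 2 < 1 / σ ^ 2 := by
      rw [lt_div_iff₀ (by positivity)]; linarith
    linarith
  have h4 : 2 * lor x.1 n / (σ * m) < -(2 / m) := by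
    have : -1 / σ ^ 2 = -(1 / σ ^ 2) := by ring
    linarith
  rw [div_lt_iff₀ (by positivity)] at h4
  have h5 : -(2 / m) * (σ * m) = -2 * σ := by field_simp
  linarith

/-- The ideal vertices: triples of pairwise adjacent faces. -/
def IsVertex (N T : Finset Mink) : Prop :=
  T ⊆ N ∧ T.card = 3 ∧ ∀ e ∈ T, ∀ f ∈ T, e ≠ f → lor e f = -1 / 2

/-- No four faces are pairwise adjacent. -/
def NoTetrahedron (N : Finset Mink) : Prop :=
  ∀ T, IsVertex N T → ∀ k ∈ N, ∃ e ∈ T, lor e k ≠ -1 / 2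

namespace NormalSystem

variable {N : Finset Mink}

lemma exists_other_neighbor (h : NormalSystem N) {e f g : Mink} (he : e ∈ N) (hf : f ∈ N)
    (hg : g ∈ N) (hef : lor e f = -1 / 2) (heg : lor e g = -1 / 2) (hfg : lor f g = -1 / 2) :
    ∃ a ∈ N, a ≠ g ∧ lor e a = -1 / 2 ∧ lor f a = -1 / 2 ∧
      ∀ k ∈ N, lor e k = -1 / 2 → lor f k = -1 / 2 → k = g ∨ k = a := by
  obtain ⟨a, ha, b, hb, hab, h1, h2⟩ := h.exists_common_neighbors he hf hef
  have hu := fun k hk h3 h4 => h.common_neighbor_unique (k := k) he hf ha hb hk hef h1 h2 ⟨h3, h4⟩ hab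
  rcases hu g hg heg hfg with rfl | rfl
  · exact ⟨b, hb, hab.symm, h2.1, h2.2, hu⟩
  · exact ⟨a, ha, hab, h1.1, h1.2, fun k hk h3 h4 => (hu k hk h3 h4).symm⟩

lemma frame (h : NormalSystem N) {e : Fin 3 → Mink} (he : ∀ i, e i ∈ N)
    (hp : ∀ i j, i ≠ j → lor (e i) (e j) = -1 / 2) : Frame e := by
  refine ⟨fun i => h.unit _ (he i), hp, ?_⟩
  obtain ⟨x, hx⟩ := h.interior
  apply future_of_lor_neg_H3 x
  · simp only [lor_add_left, lor_add_right, h.unit _ (he _)]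
    rw [hp 0 1 (by decide), hp 0 2 (by decide), hp 1 2 (by decide), hp 1 0 (by decide),
      hp 2 0 (by decide), hp 2 1 (by decide)]
    norm_num
  · simp only [lor_add_right]
    linarith [hx _ (he 0), hx _ (he 1), hx _ (he 2)]

lemma exists_frame (h : NormalSystem N) {T : Finset Mink} (hT : IsVertex N T) :
    ∃ e : Fin 3 → Mink, Frame e ∧ Function.Injective e ∧ (∀ k, k ∈ T ↔ ∃ i, e i = k) ∧
      ∑ k ∈ T, k = e 0 + e 1 + e 2 := by
  classical
  obtain ⟨hTN, hcard, hpair⟩ := hT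
  obtain ⟨a, b, c, hab, hac, hbc, rfl⟩ := Finset.card_eq_three.mp hcard
  have hmem : ∀ i, ![a, b, c] i ∈ ({a, b, c} : Finset Mink) := by
    intro i; fin_cases i <;> simp
  have hinj : Function.Injective ![a, b, c] := by
    intro i j hij
    fin_cases i <;> fin_cases j <;> simp_all
  refine ⟨![a, b, c], h.frame (fun i => hTN (hmem i)) (fun i j hij => hpair _ (hmem i) _ (hmem j)
    (hinj.ne hij)), hinj, fun k => ?_, ?_⟩
  · constructor
    · intro hk
      simp only [Finset.mem_insert, Finset.mem_singleton] at hk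
      rcases hk with rfl | rfl | rfl
      · exact ⟨0, rfl⟩
      · exact ⟨1, rfl⟩
      · exact ⟨2, rfl⟩
    · rintro ⟨i, rfl⟩; exact hmem i
  · rw [Finset.sum_insert (by simp [hab, hac]), Finset.sum_pair hbc, ← add_assoc]
    rfl

/-- At least one face of the vertex is not adjacent to `k` and contributes at most `-1`; the other
two contribute at most `-1 / 2` each. -/
lemma lor_apex_le (h : NormalSystem N) (hno : NoTetrahedron N) {T : Finset Mink}
    (hT : IsVertex N T) {k : Mink} (hk : k ∈ N) (hkT : k ∉ T) : lor k (∑ f ∈ T, f) ≤ -2 := by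
  classical
  obtain ⟨e, heT, hek⟩ := hno T hT k hk
  have hne : ∀ f ∈ T, f ≠ k := fun f hf hfk => hkT (hfk ▸ hf)
  have h1 : lor e k ≤ -1 :=
    (h.gram e (hT.1 heT) k hk (hne e heT)).resolve_left hek
  rw [lor_comm, lor_sum_left, ← Finset.add_sum_erase T _ heT]
  have h2 : ∑ f ∈ T.erase e, lor f k ≤ ∑ f ∈ T.erase e, (-1 / 2 : ℝ) :=
    Finset.sum_le_sum fun f hf => h.le_neg_half (hT.1 (Finset.mem_of_mem_erase hf)) hk
      (hne f (Finset.mem_of_mem_erase hf))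
  rw [Finset.sum_const, Finset.card_erase_of_mem heT, hT.2.1] at h2
  norm_num at h2
  linarith

lemma lor_apex_eq_zero (h : NormalSystem N) {T : Finset Mink} (hT : IsVertex N T) {k : Mink}
    (hk : k ∈ T) : lor k (∑ f ∈ T, f) = 0 := by
  obtain ⟨e, he, -, hmem, hsum⟩ := h.exists_frame hT
  obtain ⟨i, rfl⟩ := (hmem k).mp hk
  rw [hsum, lor_comm, he.lor_apex]

/-- Ideal vertices that are not joined by an edge are far apart. -/
lemma apex_far (h : NormalSystem N) (hno : NoTetrahedron N) {T T' : Finset Mink}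
    (hT : IsVertex N T) (hT' : IsVertex N T') [DecidableEq Mink] (hcard : (T' ∩ T).card ≤ 1) :
    lor (∑ f ∈ T', f) (∑ f ∈ T, f) ≤ -6 := by
  have hsum : lor (∑ f ∈ T', f) (∑ f ∈ T, f) = ∑ f ∈ T' \ T, lor f (∑ f ∈ T, f) := by
    rw [lor_sum_left, ← Finset.sum_inter_add_sum_sdiff T' T,
      Finset.sum_eq_zero fun f hf => h.lor_apex_eq_zero hT (Finset.mem_inter.mp hf).2, zero_add]
  have hcd : (T' \ T).card + (T' ∩ T).card = 3 := by
    rw [Finset.card_sdiff_add_card_inter, hT'.2.1]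
  rw [hsum]
  rcases Nat.le_one_iff_eq_zero_or_eq_one.mp hcard with hc | hc
  · have h1 : ∑ f ∈ T' \ T, lor f (∑ f ∈ T, f) ≤ ∑ f ∈ T' \ T, (-2 : ℝ) :=
      Finset.sum_le_sum fun f hf => h.lor_apex_le hno hT (hT'.1 (Finset.mem_sdiff.mp hf).1)
        (Finset.mem_sdiff.mp hf).2
    rw [Finset.sum_const, show (T' \ T).card = 3 by omega] at h1
    norm_num at h1
    exact h1
  · obtain ⟨k, hk⟩ := Finset.card_eq_one.mp hc
    obtain ⟨D, E, hDE, hdiff⟩ := Finset.card_eq_two.mp (show (T' \ T).card = 2 by omega)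
    have hkm : k ∈ T' ∧ k ∈ T := by
      rw [← Finset.mem_inter, hk]; simp
    have hDm : D ∈ T' ∧ D ∉ T := by rw [← Finset.mem_sdiff, hdiff]; simp
    have hEm : E ∈ T' ∧ E ∉ T := by rw [← Finset.mem_sdiff, hdiff]; simp
    rw [hdiff, Finset.sum_pair hDE]
    obtain ⟨e, he, hinj, hmem, hsumT⟩ := h.exists_frame hT
    obtain ⟨i, hi⟩ := (hmem k).mp hkm.2
    have heT : ∀ j, e j ∈ T := fun j => (hmem _).mpr ⟨j, rfl⟩
    have hD2 := h.lor_apex_le hno hT (hT'.1 hDm.1) hDm.2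
    have hE2 := h.lor_apex_le hno hT (hT'.1 hEm.1) hEm.2
    have hDj : ∀ j, lor D (e j) ≤ -1 / 2 := fun j =>
      h.le_neg_half (hT'.1 hDm.1) (hT.1 (heT j)) fun hh => hDm.2 (hh ▸ heT j)
    have hEj : ∀ j, lor E (e j) ≤ -1 / 2 := fun j =>
      h.le_neg_half (hT'.1 hEm.1) (hT.1 (heT j)) fun hh => hEm.2 (hh ▸ heT j)
    set s := Equiv.swap (0 : Fin 3) i with hs
    have hsum' : (e ∘ s) 0 + (e ∘ s) 1 + (e ∘ s) 2 = ∑ f ∈ T, f := by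
      have h1 := Equiv.sum_comp s e
      rw [Fin.sum_univ_three, Fin.sum_univ_three] at h1
      rw [hsumT, ← h1]; rfl
    have hs0 : (e ∘ s) 0 = k := by rw [Function.comp_apply, hs, Equiv.swap_apply_left, hi]
    have := (he.comp_perm s).inv_add_inv_le (h.unit D (hT'.1 hDm.1)) (h.unit E (hT'.1 hEm.1))
      (h.le_neg_half (hT'.1 hDm.1) (hT'.1 hEm.1) hDE)
      (by rw [hs0]; exact hT'.2.2 D hDm.1 k hkm.1 fun hh => hDm.2 (hh ▸ hkm.2))
      (by rw [hs0]; exact hT'.2.2 E hEm.1 k hkm.1 fun hh => hEm.2 (hh ▸ hkm.2))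
      (hDj _) (hDj _) (hEj _) (hEj _)
      (m := -lor D (∑ f ∈ T, f)) (m' := -lor E (∑ f ∈ T, f))
      (by rw [hsum', neg_neg]) (by rw [hsum', neg_neg])
    set m := -lor D (∑ f ∈ T, f)
    set m' := -lor E (∑ f ∈ T, f)
    have hm0 : 0 < m := by linarith
    have hm0' : 0 < m' := by linarith
    -- The bound `1 / m + 1 / m' ≤ 2 / 3` gives `m + m' ≥ 6` by the inequality of arithmetic and
    -- harmonic means. The bounds `m, m' ≥ 2` alone would only give 4.
    rw [div_add_div _ _ hm0.ne' hm0'.ne', div_le_div_iff₀ (by positivity) (by norm_num)] at this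
    nlinarith [sq_nonneg (m - m')]

/-- The part of the polyhedron that is closest to a given ideal vertex. -/
def cell (N T : Finset Mink) : Set H3 :=
  {x | (∀ e ∈ N, lor x.1 e ≤ 0) ∧
    ∀ T', IsVertex N T' → T' ≠ T → lor x.1 (∑ f ∈ T', f) < lor x.1 (∑ f ∈ T, f)}

/-- The cell of a vertex contains the part of a triangular prism above certain surfaces. -/
lemma exists_cell_bound (h : NormalSystem N) (hno : NoTetrahedron N) {T : Finset Mink}
    (hT : IsVertex N T) {e : Fin 3 → Mink} (he : Frame e) (hinj : Function.Injective e)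
    (hmem : ∀ k, k ∈ T ↔ ∃ i, e i = k) (hsum : ∑ k ∈ T, k = e 0 + e 1 + e 2) :
    ∃ m : Fin 3 → ℝ, (∀ i, 2 ≤ m i) ∧ (∀ i j, i ≠ j → 1 / m i + 1 / m j ≤ 2 / 3) ∧
      ∀ x : H3, (∀ i, lor x.1 (e i) ≤ 0) → lor x.1 (e 0 + e 1 + e 2) ^ 2 < 3 →
        (∀ i, lor x.1 (e 0 + e 1 + e 2) ^ 2 *
          (2 / m i - (1 - lor x.1 (e i) / lor x.1 (e 0 + e 1 + e 2)) ^ 2) < 1) →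
        x ∈ cell N T := by
  classical
  have heT : ∀ i, e i ∈ T := fun i => (hmem _).mpr ⟨i, rfl⟩
  have heN : ∀ i, e i ∈ N := fun i => hT.1 (heT i)
  have key : ∀ i j k : Fin 3, i ≠ j → i ≠ k → j ≠ k → ∃ a ∈ N, a ≠ e i ∧
      lor (e j) a = -1 / 2 ∧ lor (e k) a = -1 / 2 ∧
      ∀ b ∈ N, lor (e j) b = -1 / 2 → lor (e k) b = -1 / 2 → b = e i ∨ b = a := by
    intro i j k hij hik hjk
    exact h.exists_other_neighbor (heN j) (heN k) (heN i) (he.pair _ _ hjk)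
      (he.pair _ _ hij.symm) (he.pair _ _ hik.symm)
  -- The face `a i` closes the far end of the edge opposite to `e i`, the edge of the other two
  -- faces of the vertex.
  have key' : ∀ i : Fin 3, ∃ a ∈ N, a ∉ T ∧ (∀ j, j ≠ i → lor a (e j) = -1 / 2) ∧
      ∀ b ∈ N, b ∉ T → (∀ j, j ≠ i → lor b (e j) = -1 / 2) → b = a := by
    intro i
    obtain ⟨j, k, hij, hik, hjk, hall⟩ : ∃ j k : Fin 3, i ≠ j ∧ i ≠ k ∧ j ≠ k ∧
        ∀ l, l ≠ i → l = j ∨ l = k := by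
      revert i; decide
    obtain ⟨a, ha, hai, haj, hak, huniq⟩ := key i j k hij hik hjk
    refine ⟨a, ha, ?_, ?_, ?_⟩
    · intro haT
      obtain ⟨l, rfl⟩ := (hmem a).mp haT
      by_cases hl : l = i
      · exact hai (by rw [hl])
      · rcases hall l hl with rfl | rfl
        · exact h.ne_of_adj (heN _) haj rfl
        · exact h.ne_of_adj (heN _) hak rfl
    · intro l hl
      rcases hall l hl with rfl | rfl
      · rw [lor_comm, haj]
      · rw [lor_comm, hak]
    · intro b hb hbT hbl
      rcases huniq b hb (by rw [lor_comm]; exact hbl j hij.symm)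
        (by rw [lor_comm]; exact hbl k hik.symm) with rfl | rfl
      · exact absurd (heT i) hbT
      · rfl
  choose a haN haT hae huniq using key'
  have hap : ∀ i, lor (a i) (e 0 + e 1 + e 2) = lor (a i) (∑ k ∈ T, k) := fun i => by rw [hsum]
  have hm2 : ∀ i, 2 ≤ -lor (a i) (e 0 + e 1 + e 2) := fun i => by
    have := h.lor_apex_le hno hT (haN i) (haT i)
    rw [hap]; linarith
  have hale : ∀ i j, lor (a i) (e j) ≤ -1 / 2 := fun i j =>
    h.le_neg_half (haN i) (heN j) fun hh => haT i (hh ▸ heT j)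
  -- A face that closes two of the edges would be adjacent to all three faces of the vertex, giving
  -- a tetrahedron.
  have hane : ∀ i j, i ≠ j → a i ≠ a j := by
    intro i j hij hh
    obtain ⟨f, hf, hfa⟩ := hno T hT (a i) (haN i)
    obtain ⟨l, rfl⟩ := (hmem f).mp hf
    apply hfa
    rw [lor_comm]
    by_cases hl : l = i
    · rw [hh]; exact hae j l (by rw [hl]; exact hij)
    · exact hae i l hl
  refine ⟨fun i => -lor (a i) (e 0 + e 1 + e 2), hm2, ?_, ?_⟩
  · intro i j hij
    obtain ⟨k, hki, hkj⟩ : ∃ k : Fin 3, k ≠ i ∧ k ≠ j := by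
      revert i j; decide
    -- Both `a i` and `a j` are adjacent to `e k`, so they sit over a common side of the triangle;
    -- the swap moves that side to index 0.
    set s := Equiv.swap (0 : Fin 3) k with hs
    have hsum' : (e ∘ s) 0 + (e ∘ s) 1 + (e ∘ s) 2 = e 0 + e 1 + e 2 := by
      have h1 := Equiv.sum_comp s e
      rw [Fin.sum_univ_three, Fin.sum_univ_three] at h1
      rw [← h1]; rfl
    have hs0 : (e ∘ s) 0 = e k := by rw [Function.comp_apply, hs, Equiv.swap_apply_left]
    exact (he.comp_perm s).inv_add_inv_le (h.unit _ (haN i)) (h.unit _ (haN j))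
      (h.le_neg_half (haN i) (haN j) (hane i j hij)) (by rw [hs0]; exact hae i k hki)
      (by rw [hs0]; exact hae j k hkj) (hale _ _) (hale _ _) (hale _ _) (hale _ _)
      (by rw [hsum', neg_neg]) (by rw [hsum', neg_neg])
  · intro x hx hw hbound
    refine ⟨fun f hf => ?_, fun T' hT' hne => ?_⟩
    · by_cases hfT : f ∈ T
      · obtain ⟨i, rfl⟩ := (hmem f).mp hfT
        exact hx i
      · have hm := h.lor_apex_le hno hT hf hfT
        rw [hsum] at hm
        exact he.lor_face_nonpos (h.unit f hf) hm hw
    · rw [hsum]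
      have hnull : lor (∑ f ∈ T', f) (∑ f ∈ T', f) = 0 := by
        obtain ⟨g, hg, -, -, hsum'⟩ := h.exists_frame hT'
        rw [hsum', hg.lor_apex_self]
      -- A vertex that shares two faces with `T` is the other end of one of its edges, so it
      -- replaces some `e i` by `a i` and pairs with the apex like `a i` alone. All others are far.
      rcases Nat.lt_or_ge 1 (T' ∩ T).card with hc | hc
      · have hcT : (T' ∩ T).card = 2 := by
          have h1 : (T' ∩ T).card ≤ T.card := Finset.card_le_card Finset.inter_subset_right
          have hT3 := hT.2.1
          by_contra h2
          have h3 : (T' ∩ T).card = 3 := by omega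
          have h4 : T' ∩ T = T := Finset.eq_of_subset_of_card_le Finset.inter_subset_right
            (by omega)
          have h5 : T' ∩ T = T' := Finset.eq_of_subset_of_card_le Finset.inter_subset_left
            (by have := hT'.2.1; omega)
          exact hne (h5.symm.trans h4)
        have hcd := Finset.card_sdiff_add_card_inter T' T
        have hcd' := Finset.card_sdiff_add_card_inter T T'
        rw [Finset.inter_comm T T'] at hcd'
        have hT3 := hT.2.1
        have hT3' := hT'.2.1
        obtain ⟨b, hb⟩ := Finset.card_eq_one.mp (show (T' \ T).card = 1 by omega)
        obtain ⟨c, hc⟩ := Finset.card_eq_one.mp (show (T \ T').card = 1 by omega)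
        have hbm : b ∈ T' ∧ b ∉ T := by rw [← Finset.mem_sdiff, hb]; simp
        have hcm : c ∈ T ∧ c ∉ T' := by rw [← Finset.mem_sdiff, hc]; simp
        obtain ⟨i, rfl⟩ := (hmem c).mp hcm.1
        have hej : ∀ j, j ≠ i → e j ∈ T' := by
          intro j hj
          by_contra hjT
          have : e j ∈ T \ T' := Finset.mem_sdiff.mpr ⟨heT j, hjT⟩
          rw [hc, Finset.mem_singleton] at this
          exact hj (hinj this)
        have hba : b = a i := huniq i b (hT'.1 hbm.1) hbm.2 fun j hj =>
          hT'.2.2 b hbm.1 (e j) (hej j hj) fun hh => hbm.2 (hh ▸ heT j)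
        have hvm : lor (∑ f ∈ T', f) (e 0 + e 1 + e 2) =
            -(-lor (a i) (e 0 + e 1 + e 2)) := by
          rw [lor_sum_left, ← Finset.sum_inter_add_sum_sdiff T' T, hb, Finset.sum_singleton,
            Finset.sum_eq_zero fun f hf => by
              rw [← hsum]; exact h.lor_apex_eq_zero hT (Finset.mem_inter.mp hf).2, hba, zero_add,
            neg_neg]
        exact he.lor_lt_apex_of_adj hnull hvm (by linarith [hm2 i]) i (fun j hj => by
          rw [lor_comm]; exact h.lor_apex_eq_zero hT' (hej j hj)) (hbound i)
      · have hfar := h.apex_far hno hT hT' hc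
        rw [hsum] at hfar
        exact he.lor_lt_apex_of_far hnull hfar hw

end NormalSystem

/-! ### Volume of the cell of a vertex -/

/-- The coordinates of `E3`, last one first. -/
def coordsE3 (q : E3) : ℝ × ℝ × ℝ := (q 2, q 0, q 1)

lemma measurePreserving_coordsE3 : MeasurePreserving coordsE3 volume volume := by
  have h1 := EuclideanSpace.volume_preserving_symm_measurableEquiv_toLp (Fin 3)
  have h2 := volume_preserving_piFinSuccAbove (fun _ : Fin 3 => ℝ) 2
  have h3 := volume_preserving_finTwoArrow ℝ
  have h4 := ((MeasurePreserving.id (volume : Measure ℝ)).prod h3).comp (h2.comp h1)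
  exact h4

/-- A set with bounded slices has bounded volume. -/
lemma volume_le_of_slices {Y : Type*} [MeasureSpace Y] [SFinite (volume : Measure Y)]
    {S : Set (ℝ × Y)} (hS : MeasurableSet S) {α β : ℝ} (hαβ : α ≤ β) {g : ℝ → ℝ}
    (hg : ContinuousOn g (Set.Icc α β)) (hg0 : ∀ a ∈ Set.Icc α β, 0 ≤ g a)
    (h : ∀ a ∈ Set.Icc α β, volume (Prod.mk a ⁻¹' S) ≤ ENNReal.ofReal (g a))
    (hout : ∀ p ∈ S, p.1 ∈ Set.Icc α β) :
    volume S ≤ ENNReal.ofReal (∫ a in α..β, g a) := by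
  rw [Measure.volume_eq_prod, Measure.prod_apply hS]
  have h1 : ∫⁻ a, volume (Prod.mk a ⁻¹' S) = ∫⁻ a in Set.Icc α β, volume (Prod.mk a ⁻¹' S) := by
    rw [← lintegral_indicator measurableSet_Icc]
    congr 1
    ext a
    by_cases ha : a ∈ Set.Icc α β
    · rw [Set.indicator_of_mem ha]
    · rw [Set.indicator_of_notMem ha]
      have : Prod.mk a ⁻¹' S = ∅ := by
        ext b
        simp only [Set.mem_preimage, Set.mem_empty_iff_false, iff_false]
        exact fun hb => ha (hout _ hb)
      rw [this, measure_empty]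
  rw [h1]
  calc ∫⁻ a in Set.Icc α β, volume (Prod.mk a ⁻¹' S)
      ≤ ∫⁻ a in Set.Icc α β, ENNReal.ofReal (g a) := setLIntegral_mono' measurableSet_Icc h
    _ = ENNReal.ofReal (∫ a in Set.Icc α β, g a) := by
        rw [ofReal_integral_eq_lintegral_ofReal (hg.integrableOn_Icc)]
        exact (ae_restrict_mem measurableSet_Icc).mono hg0
    _ = ENNReal.ofReal (∫ a in α..β, g a) := by
        rw [integral_Icc_eq_integral_Ioc, ← intervalIntegral.integral_of_le hαβ]

/-- The open standard triangle. -/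
def openTriangle : Set (ℝ × ℝ) := {p | 0 < p.1 ∧ 0 < p.2 ∧ p.1 + p.2 < 1}

/-- Barycentric coordinates on the standard triangle. -/
def bary (p : ℝ × ℝ) : Fin 3 → ℝ := ![p.1, p.2, 1 - p.1 - p.2]

lemma continuous_bary (i : Fin 3) : Continuous fun p => bary p i := by
  fin_cases i
  · exact continuous_fst
  · exact continuous_snd
  · change Continuous fun p : ℝ × ℝ => 1 - p.1 - p.2
    fun_prop

lemma measurableSet_openTriangle : MeasurableSet openTriangle :=
  ((measurableSet_lt measurable_const measurable_fst).inter
    ((measurableSet_lt measurable_const measurable_snd).inter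
      (measurableSet_lt (measurable_fst.add measurable_snd) measurable_const)))

lemma volume_openTriangle : volume openTriangle = ENNReal.ofReal (1 / 2) := by
  have h : openTriangle = regionBetween (fun _ => 0) (fun a => 1 - a) (Set.Ioo 0 1) := by
    ext ⟨a, b⟩
    simp only [openTriangle, regionBetween, Set.mem_ofPred_eq, Set.mem_Ioo]
    constructor
    · rintro ⟨h1, h2, h3⟩; exact ⟨⟨h1, by linarith⟩, h2, by linarith⟩
    · rintro ⟨⟨h1, -⟩, h2, h3⟩; exact ⟨h1, h2, by linarith⟩
  have hc : Continuous fun a : ℝ => 1 - a := by fun_prop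
  rw [h, Measure.volume_eq_prod, volume_regionBetween_eq_integral (integrableOn_const (by simp)) (hc.integrableOn_Icc.mono_set
    Set.Ioo_subset_Icc_self) measurableSet_Ioo (fun x hx => by linarith [hx.2])]
  congr 1
  rw [← integral_Ioc_eq_integral_Ioo, ← intervalIntegral.integral_of_le zero_le_one]
  simp only [Pi.sub_apply, sub_zero]
  rw [intervalIntegral.integral_sub (by simp) (by simp), integral_id,
    intervalIntegral.integral_const, smul_eq_mul]
  norm_num

/-- For `c ≤ 1` the corner is the standard triangle scaled by `c`; for larger `c` the value is only
an upper bound. -/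
lemma volume_corner_le {c : ℝ} (hc : 0 ≤ c) (i : Fin 3) :
    volume {p | p ∈ openTriangle ∧ 1 - bary p i ≤ c} ≤ ENNReal.ofReal (c ^ 2 / 2) := by
  have hmeas : ∀ i, MeasurableSet {p | p ∈ openTriangle ∧ 1 - bary p i ≤ c} := fun i =>
    measurableSet_openTriangle.inter (measurableSet_le
      (measurable_const.sub (continuous_bary i).measurable) measurable_const)
  have h0 : volume {p | p ∈ openTriangle ∧ 1 - bary p 0 ≤ c} ≤ ENNReal.ofReal (c ^ 2 / 2) := by
    have := volume_le_of_slices (hmeas 0) (α := 1 - c) (β := 1) (by linarith) (g := fun a => 1 - a)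
      (by fun_prop) (fun a ha => by linarith [ha.2]) (fun a ha => ?_) (fun p hp => ?_)
    · refine this.trans (le_of_eq ?_)
      have hi : ∫ a in (1 - c)..1, (1 - a) = c ^ 2 / 2 := by
        rw [intervalIntegral.integral_sub (by simp) (by simp), integral_id,
          intervalIntegral.integral_const, smul_eq_mul]
        ring
      rw [hi]
    · calc volume _ ≤ volume (Set.Icc 0 (1 - a)) := by
            apply measure_mono
            rintro b ⟨hb, -⟩
            exact ⟨hb.2.1.le, by linarith [hb.2.2]⟩
        _ = _ := by rw [Real.volume_Icc, sub_zero]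
    · have h1 : 1 - p.1 ≤ c := hp.2
      exact ⟨by linarith, by linarith [hp.1.2.1, hp.1.2.2]⟩
  fin_cases i
  · exact h0
  · have hsw : MeasurePreserving (Prod.swap : ℝ × ℝ → ℝ × ℝ) volume volume :=
      Measure.measurePreserving_swap
    refine le_trans (le_of_eq ?_) h0
    rw [← hsw.measure_preimage (hmeas 0).nullMeasurableSet]
    congr 1
    ext ⟨a, b⟩
    simp only [openTriangle, bary, Set.mem_ofPred_eq, Set.mem_preimage, Prod.swap]
    simp only [Fin.mk_one, Matrix.cons_val]
    constructor
    · rintro ⟨⟨h1, h2, h3⟩, h4⟩; exact ⟨⟨h2, h1, by linarith⟩, h4⟩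
    · rintro ⟨⟨h1, h2, h3⟩, h4⟩; exact ⟨⟨h2, h1, by linarith⟩, h4⟩
  · have := volume_le_of_slices (hmeas 2) (α := 0) (β := c) hc (g := fun a => c - a)
      (by fun_prop) (fun a ha => by linarith [ha.2]) (fun a ha => ?_) (fun p hp => ?_)
    · refine this.trans (le_of_eq ?_)
      have hi : ∫ a in (0 : ℝ)..c, (c - a) = c ^ 2 / 2 := by
        rw [intervalIntegral.integral_sub (by simp) (by simp), integral_id,
          intervalIntegral.integral_const, smul_eq_mul]
        ring
      rw [hi]
    · calc volume _ ≤ volume (Set.Icc 0 (c - a)) := by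
            apply measure_mono
            rintro b ⟨hb, hb2⟩
            have h1 : 1 - (1 - a - b) ≤ c := hb2
            exact ⟨hb.2.1.le, by linarith [hb.2.2]⟩
        _ = _ := by rw [Real.volume_Icc, sub_zero]
    · have h1 : 1 - (1 - p.1 - p.2) ≤ c := hp.2
      exact ⟨hp.1.1.le, by linarith [hp.1.2.1, hp.1.2.2]⟩

/-- The part of the prism of height `3` over the triangle where a corner constraint fails. -/
def badRegion (m : ℝ) (i : Fin 3) : Set (ℝ × ℝ × ℝ) :=
  {p | (0 < p.1 ∧ p.1 < 3) ∧ p.2 ∈ openTriangle ∧ 1 ≤ p.1 * (2 / m - (1 - bary p.2 i) ^ 2)}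

lemma measurableSet_badRegion (m : ℝ) (i : Fin 3) : MeasurableSet (badRegion m i) := by
  have h1 : Measurable fun p : ℝ × ℝ × ℝ => p.1 * (2 / m - (1 - bary p.2 i) ^ 2) :=
    measurable_fst.mul (measurable_const.sub
      ((measurable_const.sub ((continuous_bary i).measurable.comp measurable_snd)).pow_const 2))
  exact ((measurableSet_lt measurable_const measurable_fst).inter
    (measurableSet_lt measurable_fst measurable_const)).inter
    ((measurable_snd measurableSet_openTriangle).inter (measurableSet_le measurable_const h1))

/-- The slice at `w` is a corner with `c ^ 2 = 2 / m - 1 / w`, nonempty only for `w ≥ m / 2`. With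
`g = 6 / m - 1`, integrating `c ^ 2 / 2` up to 3 gives `(g - log (1 + g)) / 2`, and `log (1 + g) ≥ 2
* g / (2 + g)` makes the bound rational. For `m > 6` the region is empty. -/
lemma volume_badRegion_le {m : ℝ} (hm : 2 ≤ m) (i : Fin 3) :
    volume (badRegion m i) ≤
      ENNReal.ofReal (max (6 / m - 1) 0 ^ 2 / (2 * (2 + max (6 / m - 1) 0))) := by
  have hm0 : 0 < m := by linarith
  have hlow : ∀ p ∈ badRegion m i, m / 2 ≤ p.1 := by
    rintro p ⟨⟨h1, -⟩, -, h3⟩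
    have h4 : p.1 * (2 / m - (1 - bary p.2 i) ^ 2) ≤ p.1 * (2 / m) := by
      gcongr; linarith [sq_nonneg (1 - bary p.2 i)]
    have h5 : 1 ≤ p.1 * (2 / m) := h3.trans h4
    rw [← mul_div_assoc, le_div_iff₀ hm0] at h5
    linarith
  rcases le_or_gt m 6 with hm6 | hm6
  · have hg0 : 0 ≤ 6 / m - 1 := by rw [sub_nonneg, le_div_iff₀ hm0]; linarith
    rw [max_eq_left hg0]
    have h := volume_le_of_slices (measurableSet_badRegion m i) (α := m / 2) (β := 3) (by linarith)
      (g := fun w => 1 / m - 1 / 2 * w⁻¹) (by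
        apply ContinuousOn.sub continuousOn_const
        apply ContinuousOn.mul continuousOn_const
        apply continuousOn_id.inv₀
        intro w hw
        have := hw.1
        exact (show (0 : ℝ) < w by linarith).ne')
      (fun w hw => by
        have h1 : w⁻¹ ≤ (m / 2)⁻¹ := inv_anti₀ (by positivity) hw.1
        have h2 : (m / 2)⁻¹ = 2 * (1 / m) := by field_simp
        linarith) (fun w hw => ?_) (fun p hp => ⟨hlow p hp, hp.1.2.le⟩)
    · refine h.trans (ENNReal.ofReal_le_ofReal ?_)
      have h0 : (0 : ℝ) ∉ Set.uIcc (m / 2) 3 := by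
        rw [Set.uIcc_of_le (by linarith)]
        intro h; have := h.1; linarith
      rw [intervalIntegral.integral_sub (by simp) ((intervalIntegral.intervalIntegrable_inv
        (fun w hw => fun hw0 => h0 (hw0 ▸ hw)) continuousOn_id).const_mul _),
        intervalIntegral.integral_const_mul, integral_inv h0, intervalIntegral.integral_const]
      have hlog : 2 * (6 / m - 1) / (6 / m - 1 + 2) ≤ Real.log (1 + (6 / m - 1)) :=
        Real.le_log_one_add_of_nonneg hg0
      have he : 3 / (m / 2) = 1 + (6 / m - 1) := by field_simp; ring
      rw [he, smul_eq_mul]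
      have h2 : (3 - m / 2) * (1 / m) = 1 / 2 * (6 / m - 1) := by field_simp; ring
      rw [h2]
      set g := 6 / m - 1
      have h3 : g ^ 2 / (2 * (2 + g)) = 1 / 2 * g - 1 / 2 * (2 * g / (g + 2)) := by
        field_simp; ring
      rw [h3]
      linarith
    · have hw0 : 0 < w := by have := hw.1; linarith
      have hnn : 0 ≤ 2 / m - 1 / w := by
        rw [sub_nonneg, div_le_div_iff₀ hw0 hm0]; have := hw.1; linarith
      refine le_trans (measure_mono ?_) ((volume_corner_le (Real.sqrt_nonneg (2 / m - 1 / w)) i).trans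
        (le_of_eq ?_))
      · rintro p ⟨-, h2, h3⟩
        refine ⟨h2, Real.le_sqrt_of_sq_le ?_⟩
        have h3 : 1 ≤ w * (2 / m - (1 - bary p i) ^ 2) := h3
        have h4 : 1 / w ≤ 2 / m - (1 - bary p i) ^ 2 := by
          rw [div_le_iff₀ hw0]; linarith
        linarith
      · rw [Real.sq_sqrt hnn]
        congr 1
        field_simp
  · have : badRegion m i = ∅ := by
      ext p
      simp only [Set.mem_empty_iff_false, iff_false]
      intro hp
      have := hlow p hp
      linarith [hp.1.2]
    rw [this, measure_empty]
    exact zero_le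

/-- The part of the prism of height `3` over the triangle cut out by three corner constraints. -/
def goodRegion (m : Fin 3 → ℝ) : Set (ℝ × ℝ × ℝ) :=
  {p | (0 < p.1 ∧ p.1 < 3) ∧ p.2 ∈ openTriangle ∧
    ∀ i, p.1 * (2 / m i - (1 - bary p.2 i) ^ 2) < 1}

lemma measurableSet_goodRegion (m : Fin 3 → ℝ) : MeasurableSet (goodRegion m) := by
  have h1 : ∀ i, Measurable fun p : ℝ × ℝ × ℝ => p.1 * (2 / m i - (1 - bary p.2 i) ^ 2) :=
    fun i => measurable_fst.mul (measurable_const.sub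
      ((measurable_const.sub ((continuous_bary i).measurable.comp measurable_snd)).pow_const 2))
  have h2 : goodRegion m = ({p | 0 < p.1 ∧ p.1 < 3} ∩ {p | p.2 ∈ openTriangle}) ∩
      ⋂ i, {p | p.1 * (2 / m i - (1 - bary p.2 i) ^ 2) < 1} := by
    ext p
    simp [goodRegion, and_assoc]
  rw [h2]
  exact (((measurableSet_lt measurable_const measurable_fst).inter
    (measurableSet_lt measurable_fst measurable_const)).inter
    (measurable_snd measurableSet_openTriangle)).inter
    (MeasurableSet.iInter fun i => measurableSet_lt (h1 i) measurable_const)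

/-- The summand is increasing on nonnegative numbers. If all `g i ≤ 1`, each term is at most `1 /
6`. If some `a = g i ≥ 1`, the other two are at most `2 - a`, and the resulting defect factors with
the zeros `a = 1` and `a = 2`. -/
lemma sum_sq_div_le {g : Fin 3 → ℝ} (h0 : ∀ i, 0 ≤ g i) (h : ∀ i j, i ≠ j → g i + g j ≤ 2) :
    g 0 ^ 2 / (2 * (2 + g 0)) + g 1 ^ 2 / (2 * (2 + g 1)) + g 2 ^ 2 / (2 * (2 + g 2)) ≤ 1 / 2 := by
  have key : ∀ a b c : ℝ, 0 ≤ a → 0 ≤ b → 0 ≤ c → a + b ≤ 2 → a + c ≤ 2 → 1 ≤ a →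
      a ^ 2 / (2 * (2 + a)) + b ^ 2 / (2 * (2 + b)) + c ^ 2 / (2 * (2 + c)) ≤ 1 / 2 := by
    intro a b c ha hb hc hab hac ha1
    have mono : ∀ x : ℝ, 0 ≤ x → x ≤ 2 - a → x ^ 2 / (2 * (2 + x)) ≤
        (2 - a) ^ 2 / (2 * (2 + (2 - a))) := by
      intro x hx hxa
      rw [div_le_div_iff₀ (by positivity) (by nlinarith)]
      nlinarith [mul_nonneg hx (sub_nonneg.mpr hxa), mul_nonneg (mul_nonneg hx (sub_nonneg.mpr hxa))
        (show 0 ≤ 2 - a by linarith)]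
    have h1 := mono b hb (by linarith)
    have h2 := mono c hc (by linarith)
    have h3 : a ^ 2 / (2 * (2 + a)) + 2 * ((2 - a) ^ 2 / (2 * (2 + (2 - a)))) ≤ 1 / 2 := by
      have p4 : 0 < 4 - a := by linarith
      have e : 1 / 2 - (a ^ 2 / (2 * (2 + a)) + 2 * ((2 - a) ^ 2 / (2 * (2 + (2 - a))))) =
          (2 - a) * (a - 1) * (4 + a) / (2 * (2 + a) * (4 - a)) := by
        rw [show 2 + (2 - a) = 4 - a by ring]
        field_simp
        ring
      have : 0 ≤ (2 - a) * (a - 1) * (4 + a) / (2 * (2 + a) * (4 - a)) :=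
        div_nonneg (mul_nonneg (mul_nonneg (by linarith) (by linarith)) (by linarith))
          (by positivity)
      linarith
    linarith
  have small : ∀ x : ℝ, 0 ≤ x → x ≤ 1 → x ^ 2 / (2 * (2 + x)) ≤ 1 / 6 := by
    intro x hx hx1
    rw [div_le_div_iff₀ (by positivity) (by norm_num)]
    nlinarith
  by_cases c0 : 1 ≤ g 0
  · exact key _ _ _ (h0 0) (h0 1) (h0 2) (h 0 1 (by decide)) (h 0 2 (by decide)) c0
  by_cases c1 : 1 ≤ g 1
  · have := key _ _ _ (h0 1) (h0 0) (h0 2) (h 1 0 (by decide)) (h 1 2 (by decide)) c1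
    linarith
  by_cases c2 : 1 ≤ g 2
  · have := key _ _ _ (h0 2) (h0 0) (h0 1) (h 2 0 (by decide)) (h 2 1 (by decide)) c2
    linarith
  have a0 := small _ (h0 0) (by linarith)
  have a1 := small _ (h0 1) (by linarith)
  have a2 := small _ (h0 2) (by linarith)
  linarith

/-- The prism has volume `3 / 2` and the three bad regions take at most `1 / 2`: with `g i = 6 / m i
- 1`, cut off at 0, the hypotheses become `g i ≤ 2` and `g i + g j ≤ 2`. -/
lemma one_le_volume_goodRegion {m : Fin 3 → ℝ} (hm : ∀ i, 2 ≤ m i)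
    (hmm : ∀ i j, i ≠ j → 1 / m i + 1 / m j ≤ 2 / 3) : 1 ≤ volume (goodRegion m) := by
  have hprism : volume (Set.Ioo (0 : ℝ) 3 ×ˢ openTriangle) = ENNReal.ofReal (3 / 2) := by
    rw [Measure.volume_eq_prod, Measure.prod_prod, Real.volume_Ioo, volume_openTriangle,
      ← ENNReal.ofReal_mul (by norm_num)]
    norm_num
  have hsub : Set.Ioo (0 : ℝ) 3 ×ˢ openTriangle ⊆ goodRegion m ∪ (badRegion (m 0) 0 ∪
      (badRegion (m 1) 1 ∪ badRegion (m 2) 2)) := by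
    rintro p ⟨h1, h2⟩
    by_contra hcon
    simp only [Set.mem_union, not_or] at hcon
    obtain ⟨hg, hb0, hb1, hb2⟩ := hcon
    apply hg
    refine ⟨h1, h2, fun i => ?_⟩
    by_contra! h3
    fin_cases i
    · exact hb0 ⟨h1, h2, h3⟩
    · exact hb1 ⟨h1, h2, h3⟩
    · exact hb2 ⟨h1, h2, h3⟩
  set g : Fin 3 → ℝ := fun i => max (6 / m i - 1) 0 with hg
  have hg0 : ∀ i, 0 ≤ g i := fun i => le_max_right _ _
  have hg2 : ∀ i, 6 / m i - 1 ≤ 2 := fun i => by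
    have h2 := hm i
    have : 6 / m i ≤ 3 := by rw [div_le_iff₀ (by linarith)]; linarith
    linarith
  have hgg : ∀ i j, i ≠ j → g i + g j ≤ 2 := by
    intro i j hij
    have h1 := hmm i j hij
    have e1 : 6 / m i = 6 * (1 / m i) := by ring
    have e2 : 6 / m j = 6 * (1 / m j) := by ring
    have h2 := hg2 i
    have h3 := hg2 j
    simp only [hg]
    rcases max_cases (6 / m i - 1) 0 with ⟨c1, -⟩ | ⟨c1, -⟩ <;>
      rcases max_cases (6 / m j - 1) 0 with ⟨c2, -⟩ | ⟨c2, -⟩ <;> rw [c1, c2] <;> linarith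
  have hsum := sum_sq_div_le hg0 hgg
  have hpos : ∀ i, 0 ≤ g i ^ 2 / (2 * (2 + g i)) := fun i => by have := hg0 i; positivity
  have hbad : volume (badRegion (m 0) 0) + (volume (badRegion (m 1) 1) +
      volume (badRegion (m 2) 2)) ≤ ENNReal.ofReal (1 / 2) := by
    refine (add_le_add (volume_badRegion_le (hm 0) 0) (add_le_add (volume_badRegion_le (hm 1) 1)
      (volume_badRegion_le (hm 2) 2))).trans ?_
    rw [← ENNReal.ofReal_add (hpos 1) (hpos 2),
      ← ENNReal.ofReal_add (hpos 0) (add_nonneg (hpos 1) (hpos 2))]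
    exact ENNReal.ofReal_le_ofReal (by linarith)
  have h1 : ENNReal.ofReal (3 / 2) ≤ volume (goodRegion m) + ENNReal.ofReal (1 / 2) := by
    rw [← hprism]
    refine (measure_mono hsub).trans ((measure_union_le _ _).trans ?_)
    gcongr
    refine ((measure_union_le _ _).trans ?_).trans hbad
    gcongr
    exact measure_union_le _ _
  have h2 := tsub_le_iff_right.mpr h1
  rw [← ENNReal.ofReal_sub _ (by norm_num)] at h2
  norm_num at h2
  exact h2

namespace NormalSystem

variable {N : Finset Mink}

lemma measurableSet_cell (N T : Finset Mink) : MeasurableSet (cell N T) := by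
  have hm : ∀ f : Mink, Measurable fun x : H3 => lor x.1 f := fun f =>
    (Continuous.lor' continuous_id continuous_const).measurable.comp measurable_subtype_coe
  have h : cell N T = (⋂ e ∈ N, halfSpace e) ∩ ⋂ T' ∈ {T' | IsVertex N T' ∧ T' ≠ T},
      {x : H3 | lor x.1 (∑ f ∈ T', f) < lor x.1 (∑ f ∈ T, f)} := by
    ext x
    simp [cell, halfSpace]
  rw [h]
  refine (measurableSet_polyhedron N).inter (Set.Finite.measurableSet_biInter ?_ fun T' _ =>
    measurableSet_lt (hm _) (hm _))
  exact (N.powerset.finite_toSet).subset fun T' hT' => by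
    simpa using hT'.1.1

/-- Every point of the good region is the chart image of a point of the cell, namely the one whose
frame pairings are `-w` times the barycentric coordinates, `w` being the square root of the last
chart coordinate. -/
lemma one_le_vol_cell (h : NormalSystem N) (hno : NoTetrahedron N) {T : Finset Mink}
    (hT : IsVertex N T) : 1 ≤ ENNReal.ofReal (√3) * vol (cell N T) := by
  obtain ⟨e, he, hinj, hmem, hsum⟩ := h.exists_frame hT
  obtain ⟨m, hm, hmm, hcell⟩ := h.exists_cell_bound hno hT he hinj hmem hsum
  rw [← he.volume_chart_image (measurableSet_cell N T)]
  refine (one_le_volume_goodRegion hm hmm).trans ?_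
  rw [← measurePreserving_coordsE3.measure_preimage (measurableSet_goodRegion m).nullMeasurableSet]
  apply measure_mono
  rintro q ⟨⟨hw0, hw3⟩, ⟨h0, h1, h2⟩, hq⟩
  simp only [coordsE3] at hw0 hw3 h0 h1 h2 hq
  set w := √(q 2) with hw
  have hwp : 0 < w := Real.sqrt_pos.mpr hw0
  have hww : w ^ 2 = q 2 := Real.sq_sqrt hw0.le
  obtain ⟨x, hx⟩ := he.exists_H3 (fun i => w * bary (q 0, q 1) i) (by
    simp only [bary, Matrix.cons_val_zero, Matrix.cons_val_one, Matrix.cons_val]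
    nlinarith)
  have hb0 : bary (q 0, q 1) 0 = q 0 := rfl
  have hb1 : bary (q 0, q 1) 1 = q 1 := rfl
  have hb2 : bary (q 0, q 1) 2 = 1 - q 0 - q 1 := rfl
  have hxv : lor x.1 (e 0 + e 1 + e 2) = -w := by
    rw [lor_add_right, lor_add_right, hx, hx, hx, hb0, hb1, hb2]
    ring
  have hdiv : ∀ i, lor x.1 (e i) / lor x.1 (e 0 + e 1 + e 2) = bary (q 0, q 1) i := fun i => by
    rw [hx, hxv]
    field_simp
  have hbn : ∀ i, 0 ≤ bary (q 0, q 1) i := by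
    intro i
    fin_cases i
    · exact h0.le
    · exact h1.le
    · change 0 ≤ 1 - q 0 - q 1
      linarith
  refine ⟨x, hcell x (fun i => ?_) ?_ (fun i => ?_), ?_⟩
  · rw [hx, neg_nonpos]
    exact mul_nonneg hwp.le (hbn i)
  · rw [hxv, neg_sq, hww]
    exact hw3
  · rw [hdiv, hxv, neg_sq, hww]
    exact hq i
  · ext i
    fin_cases i
    · exact hdiv 0
    · exact hdiv 1
    · change (lor x.1 (e 0 + e 1 + e 2)) ^ 2 = q 2
      rw [hxv, neg_sq, hww]

end NormalSystem

/-! ### Counting ideal vertices -/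

namespace NormalSystem

variable {N : Finset Mink}

lemma isVertex_triple (h : NormalSystem N) [DecidableEq Mink] {e f g : Mink} (he : e ∈ N)
    (hf : f ∈ N) (hg : g ∈ N) (hef : lor e f = -1 / 2) (heg : lor e g = -1 / 2)
    (hfg : lor f g = -1 / 2) : IsVertex N {e, f, g} := by
  refine ⟨?_, ?_, ?_⟩
  · intro k hk
    simp only [Finset.mem_insert, Finset.mem_singleton] at hk
    rcases hk with rfl | rfl | rfl <;> assumption
  · exact Finset.card_eq_three.mpr ⟨e, f, g, h.ne_of_adj he hef, h.ne_of_adj he heg,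
      h.ne_of_adj hf hfg, rfl⟩
  · intro k hk l hl hkl
    simp only [Finset.mem_insert, Finset.mem_singleton] at hk hl
    rcases hk with rfl | rfl | rfl <;> rcases hl with rfl | rfl | rfl <;>
      first | exact absurd rfl hkl | assumption | (rw [lor_comm]; assumption)

lemma not_adj_of_noTetrahedron (h : NormalSystem N) (hno : NoTetrahedron N) {e f g k : Mink}
    (he : e ∈ N) (hf : f ∈ N) (hg : g ∈ N) (hk : k ∈ N) (hef : lor e f = -1 / 2)
    (heg : lor e g = -1 / 2) (hfg : lor f g = -1 / 2) (hek : lor e k = -1 / 2)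
    (hfk : lor f k = -1 / 2) : lor g k ≠ -1 / 2 := by
  classical
  obtain ⟨l, hl, hlk⟩ := hno _ (h.isVertex_triple he hf hg hef heg hfg) k hk
  simp only [Finset.mem_insert, Finset.mem_singleton] at hl
  rcases hl with rfl | rfl | rfl
  · exact absurd hek hlk
  · exact absurd hfk hlk
  · exact hlk

open Classical in
/-- The set of ideal vertices. -/
noncomputable def vertices (N : Finset Mink) : Finset (Finset Mink) :=
  N.powerset.filter (IsVertex N)

lemma mem_vertices {T : Finset Mink} : T ∈ vertices N ↔ IsVertex N T := by
  classical
  simp only [vertices, Finset.mem_filter, Finset.mem_powerset, and_iff_right_iff_imp]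
  exact fun h => h.1

open Classical in
-- Follow the boundary of the face `e` both ways from its edge with `f`: the ends lie on `g` and
-- `g'`, and the next vertices on `k` and `k'`. Since `g` and `g'` are not adjacent, `k ≠ g'` and
-- the face does not close up as a triangle; `k = k'` is allowed and is the quadrilateral.
lemma four_le_card_vertices_at (h : NormalSystem N) (hno : NoTetrahedron N) {e : Mink}
    (he : e ∈ N) : 4 ≤ ((vertices N).filter (e ∈ ·)).card := by
  obtain ⟨f, hf, hef⟩ := h.exists_adj he
  obtain ⟨g, hg, g', hg', hgg, ⟨heg, hfg⟩, heg', hfg'⟩ := h.exists_common_neighbors he hf hef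
  have hgf : lor g f = -1 / 2 := by rw [lor_comm, hfg]
  have hgf' : lor g' f = -1 / 2 := by rw [lor_comm, hfg']
  obtain ⟨k, hk, hkf, hek, hgk, -⟩ := h.exists_other_neighbor he hg hf heg hef hgf
  obtain ⟨k', hk', hkf', hek', hgk', -⟩ := h.exists_other_neighbor he hg' hf heg' hef hgf'
  have hadj := h.not_adj_of_noTetrahedron hno he hf hg hg' hef heg hfg heg' hfg'
  have hkg : k ≠ g' := by rintro rfl; exact hadj hgk
  have nef := h.ne_of_adj he hef
  have neg := h.ne_of_adj he heg
  have neg' := h.ne_of_adj he heg'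
  have nek := h.ne_of_adj he hek
  have nek' := h.ne_of_adj he hek'
  have nfg := h.ne_of_adj hf hfg
  have nfg' := h.ne_of_adj hf hfg'
  have ngk := h.ne_of_adj hg hgk
  have ngk' := h.ne_of_adj hg' hgk'
  have hsub : ({{e, f, g}, {e, f, g'}, {e, g, k}, {e, g', k'}} : Finset (Finset Mink)) ⊆
      (vertices N).filter (e ∈ ·) := by
    intro T hT
    simp only [Finset.mem_insert, Finset.mem_singleton] at hT
    rw [Finset.mem_filter, mem_vertices]
    rcases hT with rfl | rfl | rfl | rfl
    · exact ⟨h.isVertex_triple he hf hg hef heg hfg, by simp⟩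
    · exact ⟨h.isVertex_triple he hf hg' hef heg' hfg', by simp⟩
    · exact ⟨h.isVertex_triple he hg hk heg hek hgk, by simp⟩
    · exact ⟨h.isVertex_triple he hg' hk' heg' hek' hgk', by simp⟩
  refine le_trans (le_of_eq ?_) (Finset.card_le_card hsub)
  have hneq : ∀ {A B : Finset Mink} (x : Mink), x ∈ A → x ∉ B → A ≠ B := by
    rintro A B x hA hB rfl; exact hB hA
  symm
  rw [Finset.card_insert_of_notMem, Finset.card_insert_of_notMem, Finset.card_insert_of_notMem,
    Finset.card_singleton]
  · rw [Finset.mem_singleton]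
    refine (hneq g' (by simp) ?_).symm
    simp only [Finset.mem_insert, Finset.mem_singleton, not_or]
    exact ⟨neg'.symm, hgg.symm, hkg.symm⟩
  · rw [Finset.mem_insert, Finset.mem_singleton, not_or]
    refine ⟨hneq f (by simp) ?_, hneq f (by simp) ?_⟩ <;>
      simp only [Finset.mem_insert, Finset.mem_singleton, not_or]
    · exact ⟨nef.symm, nfg, hkf.symm⟩
    · exact ⟨nef.symm, nfg', hkf'.symm⟩
  · rw [Finset.mem_insert, Finset.mem_insert, Finset.mem_singleton, not_or, not_or]
    refine ⟨hneq g (by simp) ?_, hneq f (by simp) ?_, hneq f (by simp) ?_⟩ <;>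
      simp only [Finset.mem_insert, Finset.mem_singleton, not_or]
    · exact ⟨neg.symm, nfg.symm, hgg⟩
    · exact ⟨nef.symm, nfg, hkf.symm⟩
    · exact ⟨nef.symm, nfg', hkf'.symm⟩

/-- Double counting of incidences: at least four vertices on each face, exactly three faces through
each vertex. -/
lemma four_mul_card_le (h : NormalSystem N) (hno : NoTetrahedron N) :
    4 * N.card ≤ 3 * (vertices N).card := by
  classical
  have h1 := Finset.sum_card_bipartiteAbove_eq_sum_card_bipartiteBelow
    (s := N) (t := vertices N) (fun e T => e ∈ T)
  have h2 : ∑ e ∈ N, 4 ≤ ∑ e ∈ N, (Finset.bipartiteAbove (fun e T => e ∈ T) (vertices N) e).card :=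
    Finset.sum_le_sum fun e he => h.four_le_card_vertices_at hno he
  have h3 : ∀ T ∈ vertices N, (Finset.bipartiteBelow (fun e T => e ∈ T) N T).card = 3 := by
    intro T hT
    have hT := mem_vertices.mp hT
    refine Eq.trans (congrArg _ ?_) hT.2.1
    ext k
    simp only [Finset.bipartiteBelow, Finset.mem_filter, and_iff_right_iff_imp]
    exact fun hk => hT.1 hk
  rw [h1, Finset.sum_congr rfl h3, Finset.sum_const, Finset.sum_const, smul_eq_mul,
    smul_eq_mul] at h2
  omega

/-- The cells are pairwise disjoint subsets of the polyhedron, each of chart volume at least 1. -/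
lemma card_vertices_le_vol (h : NormalSystem N) (hno : NoTetrahedron N) :
    ((vertices N).card : ENNReal) ≤ ENNReal.ofReal (√3) * vol (⋂ e ∈ N, halfSpace e) := by
  have hdisj : Set.PairwiseDisjoint (vertices N : Set (Finset Mink)) (cell N) := by
    intro T hT T' hT' hne
    refine Set.disjoint_left.mpr fun x hx hx' => ?_
    exact lt_asymm (hx.2 T' (mem_vertices.mp hT') hne.symm) (hx'.2 T (mem_vertices.mp hT) hne)
  have hsub : (⋃ T ∈ vertices N, cell N T) ⊆ ⋂ e ∈ N, halfSpace e := by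
    intro x hx
    simp only [Set.mem_iUnion] at hx
    obtain ⟨T, -, hT⟩ := hx
    simp only [Set.mem_iInter]
    exact fun e he => hT.1 e he
  calc ((vertices N).card : ENNReal) = ∑ T ∈ vertices N, 1 := by simp
    _ ≤ ∑ T ∈ vertices N, ENNReal.ofReal (√3) * vol (cell N T) :=
        Finset.sum_le_sum fun T hT => h.one_le_vol_cell hno (mem_vertices.mp hT)
    _ = ENNReal.ofReal (√3) * vol (⋃ T ∈ vertices N, cell N T) := by
        rw [← Finset.mul_sum, measure_biUnion_finset hdisj fun T _ => measurableSet_cell N T]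
    _ ≤ _ := by gcongr

lemma exists_vertex (h : NormalSystem N) : ∃ e : Fin 3 → Mink, Frame e ∧ ∀ i, e i ∈ N := by
  have hN : N.Nonempty := by
    by_contra hN
    rw [Finset.not_nonempty_iff_eq_empty] at hN
    -- Without faces every vector is in the cone, including this spacelike one.
    have := h.causal (0, EuclideanSpace.single 0 1) (by simp [hN])
    simp [lor_self] at this
    linarith
  obtain ⟨e, he⟩ := hN
  obtain ⟨f, hf, hef⟩ := h.exists_adj he
  obtain ⟨g, hg, -, -, -, ⟨heg, hfg⟩, -⟩ := h.exists_common_neighbors he hf hef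
  have hmem : ∀ i, ![e, f, g] i ∈ N := by
    intro i
    fin_cases i
    exacts [he, hf, hg]
  refine ⟨![e, f, g], h.frame hmem ?_, hmem⟩
  intro i j hij
  fin_cases i <;> fin_cases j <;> first | exact absurd rfl hij | assumption |
    (rw [lor_comm]; assumption)

/-- Without tetrahedra, either the faces around some ideal vertex close up like those of a cube, or
there are at least seven faces. -/
lemma exists_cube_or_seven_le (h : NormalSystem N) (hno : NoTetrahedron N) :
    (∃ e a : Fin 3 → Mink, Frame e ∧ (∀ i, e i ∈ N) ∧ (∀ i, a i ∈ N) ∧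
      (∀ i j, i ≠ j → lor (a i) (e j) = -1 / 2) ∧ (∀ i, lor (a i) (e i) ≤ -1) ∧
      ∀ i j, i ≠ j → lor (a i) (a j) = -1 / 2) ∨ 7 ≤ N.card := by
  classical
  obtain ⟨e, he, heN⟩ := h.exists_vertex
  have key : ∀ i : Fin 3, ∃ a ∈ N, a ≠ e i ∧ ∀ j, j ≠ i → lor a (e j) = -1 / 2 := by
    intro i
    obtain ⟨j, k, hij, hik, hjk, hall⟩ : ∃ j k : Fin 3, i ≠ j ∧ i ≠ k ∧ j ≠ k ∧
        ∀ l, l ≠ i → l = j ∨ l = k := by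
      revert i; decide
    obtain ⟨a, ha, hai, h1, h2, -⟩ := h.exists_other_neighbor (heN j) (heN k) (heN i)
      (he.pair _ _ hjk) (he.pair _ _ hij.symm) (he.pair _ _ hik.symm)
    refine ⟨a, ha, hai, fun l hl => ?_⟩
    rcases hall l hl with rfl | rfl
    · rw [lor_comm, h1]
    · rw [lor_comm, h2]
  choose a haN hane hae using key
  have haa : ∀ i, lor (a i) (e i) ≠ -1 / 2 := by
    intro i
    obtain ⟨j, k, hij, hik, hjk⟩ : ∃ j k : Fin 3, i ≠ j ∧ i ≠ k ∧ j ≠ k := by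
      revert i; decide
    rw [lor_comm]
    exact h.not_adj_of_noTetrahedron hno (heN j) (heN k) (heN i) (haN i) (he.pair _ _ hjk)
      (he.pair _ _ hij.symm) (he.pair _ _ hik.symm) (by rw [lor_comm, hae i j hij.symm])
      (by rw [lor_comm, hae i k hik.symm])
  by_cases hadj : ∀ i j, i ≠ j → lor (a i) (a j) = -1 / 2
  · exact .inl ⟨e, a, he, heN, haN, fun i j hij => hae i j hij.symm,
      fun i => (h.gram _ (haN i) _ (heN i) (hane i)).resolve_left (haa i), hadj⟩
  right
  push Not at hadj
  obtain ⟨i, j, hij, hnadj⟩ := hadj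
  obtain ⟨k, hki, hkj, hall⟩ : ∃ k : Fin 3, k ≠ i ∧ k ≠ j ∧ ∀ l, l = i ∨ l = j ∨ l = k := by
    clear hnadj
    revert i j; decide
  -- The edge of `e k` and `a i` has one end on `e j`; `x` is the face at its other end. In a cube
  -- this would be `a j`, which is excluded because `x` is adjacent to `a i`.
  obtain ⟨x, hxN, hxj, hkx, hax, -⟩ := h.exists_other_neighbor (heN k) (haN i) (heN j)
    (by rw [lor_comm, hae i k hki]) (he.pair _ _ hkj) (hae i j hij.symm)
  have hxe : ∀ l, e l ≠ x := by
    rintro l rfl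
    rcases hall l with rfl | rfl | rfl
    · exact haa l hax
    · exact hxj rfl
    · exact h.ne_of_adj (heN _) hkx rfl
  have hxa : ∀ l, a l ≠ x := by
    rintro l rfl
    rcases hall l with rfl | rfl | rfl
    · exact h.ne_of_adj (haN _) hax rfl
    · exact hnadj hax
    · exact haa l (by rw [lor_comm, hkx])
  have heinj : Function.Injective e := by
    intro l m hlm
    by_contra hne
    exact h.ne_of_adj (heN _) (he.pair l m hne) hlm
  have hainj : Function.Injective a := by
    intro l m hlm
    by_contra hne
    exact haa l (by rw [hlm]; exact hae m l hne)
  have hea : ∀ l m, e l ≠ a m := by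
    intro l m hlm
    by_cases hl : l = m
    · exact hane m (by rw [← hlm, hl])
    · exact h.ne_of_adj (haN m) (hae m l hl) hlm.symm
  let F : Option (Fin 3 ⊕ Fin 3) → N := fun o =>
    o.elim ⟨x, hxN⟩ (Sum.elim (fun l => ⟨e l, heN l⟩) fun l => ⟨a l, haN l⟩)
  have hF : Function.Injective F := by
    rintro (_ | l | l) (_ | m | m) hlm <;> have hlm := congrArg Subtype.val hlm <;>
      simp only [F, Option.elim, Sum.elim] at hlm
    · rfl
    · exact absurd hlm.symm (hxe m)
    · exact absurd hlm.symm (hxa m)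
    · exact absurd hlm (hxe l)
    · rw [heinj hlm]
    · exact absurd hlm (hea l m)
    · exact absurd hlm (hxa l)
    · exact absurd hlm.symm (hea m l)
    · rw [hainj hlm]
  have := Fintype.card_le_of_injective F hF
  simpa using this

lemma ten_le_vol (h : NormalSystem N) (hno : NoTetrahedron N) (hcard : 7 ≤ N.card) :
    10 ≤ ENNReal.ofReal (√3) * vol (⋂ e ∈ N, halfSpace e) := by
  refine le_trans ?_ (h.card_vertices_le_vol hno)
  have := h.four_mul_card_le hno
  -- Seven faces give at least `28 / 3` vertices, hence ten.
  exact_mod_cast (show 10 ≤ (vertices N).card by omega)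

end NormalSystem

/-! ### Congruences between frames -/

namespace Frame

variable {e e' : Fin 3 → Mink}

/-- `Frame.lor_eq` expresses the form through self-products and frame pairings alone, so equal data
give equal products. -/
lemma lor_eq_of_eq (h : Frame e) (h' : Frame e') {x y x' y' : Mink} (hxx : lor x x = lor x' x')
    (hyy : lor y y = lor y' y') (hx : ∀ i, lor x (e i) = lor x' (e' i))
    (hy : ∀ i, lor y (e i) = lor y' (e' i)) (hx0 : lor x (e 0 + e 1 + e 2) ≠ 0)
    (hy0 : lor y (e 0 + e 1 + e 2) ≠ 0) : lor x y = lor x' y' := by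
  have hs : ∀ {z z' : Mink}, (∀ i, lor z (e i) = lor z' (e' i)) →
      lor z' (e' 0 + e' 1 + e' 2) = lor z (e 0 + e 1 + e 2) := by
    intro z z' hz
    simp only [lor_add_right, hz]
  have h1 := h.lor_eq (x := x) (y := y) (neg_neg _).symm (neg_neg _).symm (neg_ne_zero.mpr hx0)
    (neg_ne_zero.mpr hy0)
  have h2 := h'.lor_eq (x := x') (y := y') (neg_neg _).symm (neg_neg _).symm
    (neg_ne_zero.mpr (by rw [hs hx]; exact hx0)) (neg_ne_zero.mpr (by rw [hs hy]; exact hy0))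
  rw [hs hx, hs hy, ← hxx, ← hyy] at h2
  simp only [hx, hy] at h1
  rw [← h2] at h1
  field_simp at h1
  exact h1

/-- The frame pairings are coordinates with the same range for every frame; match the points with
equal coordinates. -/
lemma exists_equiv (h : Frame e) (h' : Frame e') :
    ∃ φ : H3 ≃ H3, ∀ x i, lor (φ x).1 (e' i) = lor x.1 (e i) := by
  have key : ∀ {e e' : Fin 3 → Mink}, Frame e → Frame e' →
      ∀ x : H3, ∃ y : H3, ∀ i, lor y.1 (e' i) = lor x.1 (e i) := by
    intro e e' h h' x
    obtain ⟨y, hy⟩ := h'.exists_H3 (fun i => -lor x.1 (e i)) (by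
      have := h.lor_apex_neg x
      simp only [lor_add_right] at this
      linarith)
    exact ⟨y, fun i => by rw [hy, neg_neg]⟩
  choose f hf using key h h'
  choose g hg using key h' h
  exact ⟨⟨f, g, fun x => h.ext_H3 fun i => by rw [hg, hf], fun x => h'.ext_H3 fun i => by
    rw [hf, hg]⟩, hf⟩

/-- Polyhedra that look the same from two frames are congruent and have the same volume. -/
lemma congruent (h : Frame e) (h' : Frame e') {ι : Type*} [Finite ι] {f f' : ι → Mink}
    (hf : ∀ k, lor (f k) (f k) = 1) (hf' : ∀ k, lor (f' k) (f' k) = 1)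
    (heq : ∀ k i, lor (f k) (e i) = lor (f' k) (e' i))
    (h0 : ∀ k, lor (f k) (e 0 + e 1 + e 2) ≠ 0) {P P' : Set H3}
    (hP : P = {x | (∀ i, lor x.1 (e i) ≤ 0) ∧ ∀ k, lor x.1 (f k) ≤ 0})
    (hP' : P' = {x | (∀ i, lor x.1 (e' i) ≤ 0) ∧ ∀ k, lor x.1 (f' k) ≤ 0}) :
    Congruent P P' ∧ vol P = vol P' := by
  obtain ⟨φ, hφ⟩ := h.exists_equiv h'
  have hlor : ∀ x y, lor (φ x).1 (φ y).1 = lor x.1 y.1 := fun x y =>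
    (h.lor_eq_of_eq h' (by rw [x.2.1, (φ x).2.1]) (by rw [y.2.1, (φ y).2.1])
      (fun i => (hφ x i).symm) (fun i => (hφ y i).symm) (h.lor_apex_neg x).ne
      (h.lor_apex_neg y).ne).symm
  have hface : ∀ x k, lor (φ x).1 (f' k) = lor x.1 (f k) := fun x k =>
    (h.lor_eq_of_eq h' (by rw [x.2.1, (φ x).2.1]) (by rw [hf, hf'])
      (fun i => (hφ x i).symm) (heq k) (h.lor_apex_neg x).ne (h0 k)).symm
  have himg : φ '' P = P' := by
    rw [Equiv.image_eq_preimage_symm]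
    ext y
    obtain ⟨x, rfl⟩ := φ.surjective y
    simp only [Set.mem_preimage, Equiv.symm_apply_apply, hP, hP', Set.mem_ofPred_eq, hφ, hface]
  refine ⟨⟨φ, fun x y => by rw [hdist, hdist, hlor], himg⟩, ?_⟩
  have hmeas : ∀ (e : Fin 3 → Mink) (f : ι → Mink),
      MeasurableSet {x : H3 | (∀ i, lor x.1 (e i) ≤ 0) ∧ ∀ k, lor x.1 (f k) ≤ 0} := by
    intro e f
    have : {x : H3 | (∀ i, lor x.1 (e i) ≤ 0) ∧ ∀ k, lor x.1 (f k) ≤ 0} =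
        (⋂ i, halfSpace (e i)) ∩ ⋂ k, halfSpace (f k) := by
      ext x; simp [halfSpace]
    rw [this]
    exact (MeasurableSet.iInter fun i => measurableSet_halfSpace _).inter
      (MeasurableSet.iInter fun i => measurableSet_halfSpace _)
  have hchart : ∀ x, chart e' (φ x) = chart e x := by
    intro x
    simp only [chart, lor_add_right, hφ]
  -- The chart depends only on the frame pairings, so both sets have the same image and thus the
  -- same volume.
  have hc : chart e' '' P' = chart e '' P := by
    rw [← himg, Set.image_image]
    simp only [hchart]
  have h1 := h.volume_chart_image (A := P) (hP ▸ hmeas e f)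
  have h2 := h'.volume_chart_image (A := P') (hP' ▸ hmeas e' f')
  rw [hc, h1] at h2
  exact (ENNReal.mul_right_inj (by simp) ENNReal.ofReal_ne_top).mp h2

end Frame

/-! ### Tetrahedra and cubes -/

namespace NormalSystem

variable {N : Finset Mink}

/-- Four pairwise adjacent faces are all the faces. -/
lemma mem_of_tetrahedron (h : NormalSystem N) {e : Fin 3 → Mink} (he : Frame e)
    (heN : ∀ i, e i ∈ N) {k : Mink} (hk : k ∈ N) (hke : ∀ i, lor k (e i) = -1 / 2) {f : Mink}
    (hf : f ∈ N) : (∃ i, e i = f) ∨ k = f := by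
  by_contra! hcon
  obtain ⟨hfe, hfk⟩ := hcon
  have h0 : ∀ i, lor f (e i) ≤ -1 / 2 := fun i => h.le_neg_half hf (heN i) (hfe i).symm
  have h1 : lor f k ≤ -1 / 2 := h.le_neg_half hf hk hfk.symm
  have hs : lor f (e 0 + e 1 + e 2) = -(-(lor f (e 0) + lor f (e 1) + lor f (e 2))) := by
    simp only [lor_add_right, neg_neg]
  have hks : lor k (e 0 + e 1 + e 2) = -(3 / 2) := by
    simp only [lor_add_right, hke]; norm_num
  have a0 := h0 0
  have a1 := h0 1
  have a2 := h0 2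
  have key := he.lor_eq hs hks (by linarith) (by norm_num)
  rw [h.unit f hf, h.unit k hk, hke, hke, hke] at key
  generalize lor f (e 0) = x at *
  generalize lor f (e 1) = y at *
  generalize lor f (e 2) = z at *
  generalize lor f k = t at *
  have hm : 0 < -(x + y + z) := by linarith
  have hm' : x + y + z ≠ 0 := by linarith
  field_simp at key
  -- Multiplied by `(x + y + z) ^ 2`, the right side of `Frame.lor_eq` is `1 + 4 / 3 * (x * y + x *
  -- z + y * z) > 0`, while the left side has the sign of `t < 0`.
  nlinarith [mul_pos_of_neg_of_neg (show x < 0 by linarith) (show y < 0 by linarith),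
    mul_pos_of_neg_of_neg (show x < 0 by linarith) (show z < 0 by linarith),
    mul_pos_of_neg_of_neg (show y < 0 by linarith) (show z < 0 by linarith),
    mul_pos_of_neg_of_neg (show t < 0 by linarith) (show x + y + z < 0 by linarith)]

/-- The polyhedron of a system that contains a tetrahedron. -/
lemma eq_of_tetrahedron (h : NormalSystem N) {e : Fin 3 → Mink} (he : Frame e)
    (heN : ∀ i, e i ∈ N) {k : Mink} (hk : k ∈ N) (hke : ∀ i, lor k (e i) = -1 / 2) :
    ⋂ f ∈ N, halfSpace f = {x | (∀ i, lor x.1 (e i) ≤ 0) ∧ ∀ _ : Unit, lor x.1 k ≤ 0} := by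
  ext x
  rw [mem_polyhedron]
  constructor
  · exact fun hx => ⟨fun i => hx _ (heN i), fun _ => hx _ hk⟩
  · rintro ⟨h1, h2⟩ f hf
    rcases h.mem_of_tetrahedron he heN hk hke hf with ⟨i, rfl⟩ | rfl
    · exact h1 i
    · exact h2 ()

end NormalSystem

/-- Only `lor a (e 0) = 1 - m` and `lor b (e 1) = 1 - m'` are unknown among the frame pairings, so
`lor a b = -1 / 2` becomes the single relation `3 * (m + m') = 2 * m * m'`. -/
lemma Frame.inv_add_inv_eq {e : Fin 3 → Mink} (he : Frame e) {a b : Mink} (ha : lor a a = 1)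
    (hb : lor b b = 1) (hab : lor a b = -1 / 2) (ha1 : lor a (e 1) = -1 / 2)
    (ha2 : lor a (e 2) = -1 / 2) (hb0 : lor b (e 0) = -1 / 2) (hb2 : lor b (e 2) = -1 / 2)
    (ha0 : lor a (e 0) ≤ -1) (hb1 : lor b (e 1) ≤ -1) :
    1 / (1 - lor a (e 0)) + 1 / (1 - lor b (e 1)) = 2 / 3 := by
  have hsa : lor a (e 0 + e 1 + e 2) = -(1 - lor a (e 0)) := by
    simp only [lor_add_right, ha1, ha2]; ring
  have hsb : lor b (e 0 + e 1 + e 2) = -(1 - lor b (e 1)) := by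
    simp only [lor_add_right, hb0, hb2]; ring
  have key := he.lor_eq hsa hsb (by linarith) (by linarith)
  rw [ha, hb, hab, ha1, ha2, hb0, hb2] at key
  obtain ⟨m, hm⟩ : ∃ m, 1 - lor a (e 0) = m := ⟨_, rfl⟩
  obtain ⟨m', hm'⟩ : ∃ m, 1 - lor b (e 1) = m := ⟨_, rfl⟩
  have hm0 : 0 < m := by linarith
  have hm0' : 0 < m' := by linarith
  rw [hm, hm', show lor a (e 0) = 1 - m by linarith, show lor b (e 1) = 1 - m' by linarith] at key
  rw [hm, hm']
  field_simp at key ⊢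
  have h0 : (m * m') * ((m' + m) * 3 - 2 * (m * m')) = 0 := by linarith
  have := (mul_eq_zero.mp h0).resolve_left (by positivity)
  linarith

namespace NormalSystem

variable {N : Finset Mink}

/-- The three reciprocals `1 / (1 - lor (a i) (e i))` have all pairwise sums `2 / 3`, so each is `1
/ 3`. -/
lemma lor_eq_neg_two_of_cube (h : NormalSystem N) {e a : Fin 3 → Mink} (he : Frame e)
    (haN : ∀ i, a i ∈ N)
    (hae : ∀ i j, i ≠ j → lor (a i) (e j) = -1 / 2) (haa : ∀ i, lor (a i) (e i) ≤ -1)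
    (hadj : ∀ i j, i ≠ j → lor (a i) (a j) = -1 / 2) (i : Fin 3) : lor (a i) (e i) = -2 := by
  have key : ∀ i j, i ≠ j → 1 / (1 - lor (a i) (e i)) + 1 / (1 - lor (a j) (e j)) = 2 / 3 := by
    intro i j hij
    obtain ⟨s, rfl, rfl, hs0, hs1⟩ : ∃ s : Equiv.Perm (Fin 3), s 0 = i ∧ s 1 = j ∧ i ≠ s 2 ∧
        j ≠ s 2 := by
      revert i j; decide
    exact (he.comp_perm s).inv_add_inv_eq (h.unit _ (haN _)) (h.unit _ (haN _)) (hadj _ _ hij)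
      (hae _ _ hij) (hae _ _ hs0) (hae _ _ hij.symm) (hae _ _ hs1) (haa _) (haa _)
  obtain ⟨j, k, hij, hik, hjk⟩ : ∃ j k : Fin 3, i ≠ j ∧ i ≠ k ∧ j ≠ k := by
    revert i; decide
  have h1 := key i j hij
  have h2 := key i k hik
  have h3 := key j k hjk
  have h4 : 1 / (1 - lor (a i) (e i)) = 1 / 3 := by linarith
  have h5 := haa i
  rw [div_eq_div_iff (by linarith) (by norm_num)] at h4
  linarith

/-- The six faces of a cube are all the faces. -/
lemma mem_of_cube (h : NormalSystem N) {e a : Fin 3 → Mink} (he : Frame e)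
    (heN : ∀ i, e i ∈ N) (haN : ∀ i, a i ∈ N)
    (hae : ∀ i j, i ≠ j → lor (a i) (e j) = -1 / 2) (haa : ∀ i, lor (a i) (e i) = -2) {f : Mink}
    (hf : f ∈ N) : (∃ i, e i = f) ∨ ∃ i, a i = f := by
  by_contra! hcon
  obtain ⟨hfe, hfa⟩ := hcon
  -- The face `e (s 0)` with the most negative pairing marks the corner of the triangle nearest to
  -- the centre of a further hemisphere `f`; there `f` conflicts with `a (s 0)`. In `Frame.lor_eq`
  -- the right side is then positive because `y * (y - x)` and `z * (z - x)` are nonpositive, while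
  -- `t < 0`.
  have main : ∀ s : Equiv.Perm (Fin 3), lor f (e (s 1)) ≥ lor f (e (s 0)) →
      lor f (e (s 2)) ≥ lor f (e (s 0)) → False := by
    intro s h1 h2
    have h0 : ∀ i, lor f (e i) ≤ -1 / 2 := fun i => h.le_neg_half hf (heN i) (hfe i).symm
    have h3 : lor f (a (s 0)) ≤ -1 / 2 := h.le_neg_half hf (haN _) (hfa _).symm
    have he' := he.comp_perm s
    have hs : lor f ((e ∘ s) 0 + (e ∘ s) 1 + (e ∘ s) 2) =
        -(-(lor f (e (s 0)) + lor f (e (s 1)) + lor f (e (s 2)))) := by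
      simp only [lor_add_right, neg_neg, Function.comp_apply]
    have q1 : lor (a (s 0)) (e (s 1)) = -1 / 2 := hae _ _ (s.injective.ne (by decide))
    have q2 : lor (a (s 0)) (e (s 2)) = -1 / 2 := hae _ _ (s.injective.ne (by decide))
    have hks : lor (a (s 0)) ((e ∘ s) 0 + (e ∘ s) 1 + (e ∘ s) 2) = -3 := by
      simp only [lor_add_right, Function.comp_apply, haa, q1, q2]; norm_num
    have a0 := h0 (s 0)
    have a1 := h0 (s 1)
    have a2 := h0 (s 2)
    have key := he'.lor_eq hs hks (by linarith) (by norm_num)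
    simp only [Function.comp_apply] at key
    rw [h.unit f hf, h.unit _ (haN _), haa, q1, q2] at key
    generalize lor f (e (s 0)) = x at *
    generalize lor f (e (s 1)) = y at *
    generalize lor f (e (s 2)) = z at *
    generalize lor f (a (s 0)) = t at *
    have hm : 0 < -(x + y + z) := by linarith
    have hm' : x + y + z ≠ 0 := by linarith
    field_simp at key
    nlinarith [mul_nonneg_of_nonpos_of_nonpos (show y ≤ 0 by linarith) (show x - y ≤ 0 by linarith),
      mul_nonneg_of_nonpos_of_nonpos (show z ≤ 0 by linarith) (show x - z ≤ 0 by linarith),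
      mul_pos_of_neg_of_neg (show t < 0 by linarith) (show x + y + z < 0 by linarith)]
  rcases le_total (lor f (e 0)) (lor f (e 1)) with h1 | h1
  · rcases le_total (lor f (e 0)) (lor f (e 2)) with h2 | h2
    · exact main 1 h1 h2
    · exact main (Equiv.swap 0 2) (h2.trans h1) h2
  · rcases le_total (lor f (e 1)) (lor f (e 2)) with h2 | h2
    · exact main (Equiv.swap 0 1) h1 h2
    · exact main (Equiv.swap 0 2) h2 (h2.trans h1)

/-- The polyhedron of a system that contains a cube. -/
lemma eq_of_cube (h : NormalSystem N) {e a : Fin 3 → Mink} (he : Frame e)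
    (heN : ∀ i, e i ∈ N) (haN : ∀ i, a i ∈ N)
    (hae : ∀ i j, i ≠ j → lor (a i) (e j) = -1 / 2) (haa : ∀ i, lor (a i) (e i) = -2) :
    ⋂ f ∈ N, halfSpace f = {x | (∀ i, lor x.1 (e i) ≤ 0) ∧ ∀ i, lor x.1 (a i) ≤ 0} := by
  ext x
  rw [mem_polyhedron]
  constructor
  · exact fun hx => ⟨fun i => hx _ (heN i), fun i => hx _ (haN i)⟩
  · rintro ⟨h1, h2⟩ f hf
    rcases h.mem_of_cube he heN haN hae haa hf with ⟨i, rfl⟩ | ⟨i, rfl⟩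
    · exact h1 i
    · exact h2 i

/-- A polyhedron with all dihedral angles `π / 3` is a tetrahedron, is a cube, or has at least ten
ideal vertices. -/
theorem trichotomy (h : NormalSystem N) :
    (∃ (e : Fin 3 → Mink) (k : Mink), Frame e ∧ lor k k = 1 ∧ (∀ i, lor k (e i) = -1 / 2) ∧
      ⋂ f ∈ N, halfSpace f = {x | (∀ i, lor x.1 (e i) ≤ 0) ∧ ∀ _ : Unit, lor x.1 k ≤ 0}) ∨
    (∃ e a : Fin 3 → Mink, Frame e ∧ (∀ i, lor (a i) (a i) = 1) ∧
      (∀ i j, lor (a i) (e j) = if i = j then -2 else -1 / 2) ∧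
      ⋂ f ∈ N, halfSpace f = {x | (∀ i, lor x.1 (e i) ≤ 0) ∧ ∀ i, lor x.1 (a i) ≤ 0}) ∨
    10 ≤ ENNReal.ofReal (√3) * vol (⋂ f ∈ N, halfSpace f) := by
  by_cases hno : NoTetrahedron N
  · right
    rcases h.exists_cube_or_seven_le hno with ⟨e, a, he, heN, haN, hae, haa, hadj⟩ | hcard
    · have h2 := h.lor_eq_neg_two_of_cube he haN hae haa hadj
      refine .inl ⟨e, a, he, fun i => h.unit _ (haN i), fun i j => ?_,
        h.eq_of_cube he heN haN hae h2⟩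
      split_ifs with hij
      · rw [← hij, h2]
      · exact hae i j hij
    · exact .inr (h.ten_le_vol hno hcard)
  · left
    unfold NoTetrahedron at hno
    push Not at hno
    obtain ⟨T, hT, k, hk, hTk⟩ := hno
    obtain ⟨e, he, -, hmem, -⟩ := h.exists_frame hT
    have heT : ∀ i, e i ∈ T := fun i => (hmem _).mpr ⟨i, rfl⟩
    have hke : ∀ i, lor k (e i) = -1 / 2 := fun i => by rw [lor_comm, hTk _ (heT i)]
    exact ⟨e, k, he, h.unit k hk, hke, h.eq_of_tetrahedron he (fun i => hT.1 (heT i)) hk hke⟩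

end NormalSystem

/-! ### Polyhedra given by a Gram matrix -/

/-- Both unit vectors lie in the positive definite complement of `x`, so this is the equality case
of Cauchy–Schwarz. -/
lemma eq_or_eq_neg_of_perp {x e f : Mink} (hx : lor x x < 0) (he : lor e e = 1) (hf : lor f f = 1)
    (hxe : lor x e = 0) (hxf : lor x f = 0) (hef : 1 ≤ lor e f ^ 2) : e = f ∨ e = -f := by
  have hx0 : x ≠ 0 := by rintro rfl; simp [lor_zero_left] at hx
  have key : ∀ {g : Mink}, lor g g = 1 → lor x g = 0 → -1 ≤ lor e g ∧ (lor e g = -1 → e = -g) := by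
    intro g hg hxg
    obtain ⟨h1, h2⟩ := lor_lt_of_timelike_perp hx.le hx0 he hg hxe hxg
    refine ⟨h1, fun h => ?_⟩
    obtain ⟨c, hc⟩ := h2 h
    have h3 : lor x (e + g) = 0 := by rw [lor_add_right, hxe, hxg, add_zero]
    rw [hc, lor_smul_right] at h3
    have hc0 := (mul_eq_zero.mp h3).resolve_right hx.ne
    rw [hc0, zero_smul] at hc
    exact eq_neg_of_add_eq_zero_left hc
  obtain ⟨h1, h1'⟩ := key hf hxf
  obtain ⟨h2, h2'⟩ := key (g := -f) (by rw [lor_neg_left, lor_neg_right, neg_neg, hf])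
    (by rw [lor_neg_right, hxf, neg_zero])
  rw [lor_neg_right] at h2 h2'
  rcases eq_or_lt_of_le h1 with h | h
  · exact .inr (h1' h.symm)
  rcases eq_or_lt_of_le h2 with h' | h'
  · exact .inl (by rw [h2' h'.symm, neg_neg])
  nlinarith

/-- Adding up points of `F`, one witness for each `n`, makes all inequalities strict at once; sums
stay in the future cone. -/
lemma exists_interior_of_face {N : Finset Mink} {F : Set H3} {e : Mink} (hne : F.Nonempty)
    (hFe : ∀ x ∈ F, lor x.1 e = 0) (hFN : ∀ x ∈ F, ∀ n ∈ N, lor x.1 n ≤ 0)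
    (hlt : ∀ n ∈ N, ∃ x ∈ F, lor x.1 n < 0) :
    ∃ w, lor w w < 0 ∧ 0 < w.1 ∧ lor w e = 0 ∧ ∀ n ∈ N, lor w n < 0 := by
  classical
  have key : ∀ M ⊆ N, ∃ w, lor w w < 0 ∧ 0 < w.1 ∧ lor w e = 0 ∧ (∀ n ∈ N, lor w n ≤ 0) ∧
      ∀ n ∈ M, lor w n < 0 := by
    intro M
    induction M using Finset.induction_on with
    | empty =>
      intro _
      obtain ⟨x, hx⟩ := hne
      exact ⟨x.1, by rw [x.2.1]; norm_num, x.2.2, hFe x hx, hFN x hx, by simp⟩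
    | insert n M hn ih =>
      intro hM
      obtain ⟨w, h1, h2, h3, h4, h5⟩ := ih ((Finset.subset_insert _ _).trans hM)
      have hnN := hM (Finset.mem_insert_self n M)
      obtain ⟨x, hx, hxn⟩ := hlt n hnN
      have ht := timelike_add h1 h2 (y := x.1) (by rw [x.2.1]; norm_num) x.2.2 one_pos one_pos
      simp only [one_smul] at ht
      refine ⟨w + x.1, ht.1, ht.2, by rw [lor_add_left, h3, hFe x hx, add_zero], fun k hk => ?_,
        fun k hk => ?_⟩
      · rw [lor_add_left]
        linarith [h4 k hk, hFN x hx k hk]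
      · rw [lor_add_left]
        rcases Finset.mem_insert.mp hk with rfl | hk'
        · linarith [h4 k hnN]
        · linarith [h5 k hk', hFN x hx k (hM hk)]
  obtain ⟨w, h1, h2, h3, -, h5⟩ := key N subset_rfl
  exact ⟨w, h1, h2, h3, h5⟩

/-- The faces of an intersection of half-spaces lie on the boundaries of these half-spaces. -/
lemma mem_of_isFaceNormal {N : Finset Mink} (hunit : ∀ e ∈ N, lor e e = 1) {x : H3} {r : ℝ}
    (hr : 0 < r) (hball : {y | hdist x y < r} ⊆ ⋂ e ∈ N, halfSpace e) {e : Mink}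
    (he : IsFaceNormal (⋂ e ∈ N, halfSpace e) e) : e ∈ N := by
  obtain ⟨hee, hsub, hrank⟩ := he
  set F := (⋂ e ∈ N, halfSpace e) ∩ hyperplane e with hF
  have hFe : ∀ x ∈ F, lor x.1 e = 0 := fun x hx => hx.2
  have hFN : ∀ x ∈ F, ∀ n ∈ N, lor x.1 n ≤ 0 := fun x hx => mem_polyhedron.mp hx.1
  have hne : F.Nonempty := by
    by_contra hcon
    rw [Set.not_nonempty_iff_eq_empty] at hcon
    rw [hcon, spanRank, Set.image_empty, Submodule.span_empty, finrank_bot] at hrank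
    omega
  -- If every `n` is strict somewhere on the face, some point of its plane is strictly inside all
  -- half-spaces of `N`, and a small step along `e` leaves `halfSpace e` but not the polyhedron.
  -- Otherwise some `n` vanishes on the whole face, whose rank 3 makes the two planes equal.
  by_cases hlt : ∀ n ∈ N, ∃ x ∈ F, lor x.1 n < 0
  · obtain ⟨w, h1, h2, h3, h4⟩ := exists_interior_of_face hne hFe hFN hlt
    obtain ⟨s, hs, h5, h6, h7⟩ := exists_small_step h1 h2 N h4 e
    obtain ⟨y, c, hc, hy⟩ := exists_H3_smul h5 h6
    have hyP : y ∈ ⋂ e ∈ N, halfSpace e := mem_polyhedron.mpr fun n hn => by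
      have := h7 n hn
      rw [hy, lor_smul_left] at this
      exact (neg_of_mul_neg_right this hc.le).le
    have h8 : lor y.1 e ≤ 0 := hsub hyP
    have h9 : lor (w + s • e) e = s := by rw [lor_add_left, lor_smul_left, h3, hee]; ring
    rw [hy, lor_smul_left] at h9
    nlinarith
  · push Not at hlt
    obtain ⟨n, hn, hFn⟩ := hlt
    have hFn : ∀ x ∈ F, lor x.1 n = 0 := fun x hx => le_antisymm (hFN x hx n hn) (hFn x hx)
    obtain ⟨y, hy⟩ := hne
    have hsq : 1 ≤ lor e n ^ 2 := by
      by_contra! hcon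
      have h1 := finrank_ker_lorL_pair hee (hunit n hn) hcon
      have h2 : Submodule.span ℝ ((fun x : H3 => x.1) '' F) ≤
          LinearMap.ker ((lorL e).prod (lorL n)) := by
        rw [Submodule.span_le]
        rintro _ ⟨z, hz, rfl⟩
        simp only [SetLike.mem_coe, LinearMap.mem_ker, LinearMap.prod_apply, Function.prod,
          lorL_apply, hFe z hz, hFn z hz, Prod.mk_zero_zero]
      have h3 := Submodule.finrank_mono h2
      unfold spanRank at hrank
      omega
    rcases eq_or_eq_neg_of_perp (x := y.1) (by rw [y.2.1]; norm_num) hee (hunit n hn) (hFe y hy)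
      (hFn y hy) hsq with h | h
    · rwa [h]
    -- Opposite normals would put the polyhedron in a single plane, but it contains a ball.
    · have h1 := lor_neg_of_ball hr hee (hball.trans hsub)
      have h2 := lor_neg_of_ball hr (hunit n hn) (hball.trans (Set.biInter_subset_of_mem hn))
      rw [h, lor_neg_right] at h1
      linarith

/-- All face normals belong to `N`, and planes whose normals have product below `-1` have no common
point, so adjacent faces have product `-1 / 2`. -/
lemma isEquiangular_of_gram {N : Finset Mink} (hunit : ∀ e ∈ N, lor e e = 1) {x : H3} {r : ℝ}
    (hr : 0 < r) (hball : {y | hdist x y < r} ⊆ ⋂ e ∈ N, halfSpace e)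
    (hvol : vol (⋂ e ∈ N, halfSpace e) < ⊤)
    (hgram : ∀ e ∈ N, ∀ f ∈ N, e ≠ f → lor e f = -1 / 2 ∨ lor e f < -1) :
    IsEquiangular (Real.pi / 3) (⋂ e ∈ N, halfSpace e) := by
  refine ⟨⟨⟨N, hunit, rfl⟩, x, r, hr, hball⟩, hvol, fun e f hadj => ?_⟩
  obtain ⟨he, hf, hef, hrank⟩ := hadj
  have heN := mem_of_isFaceNormal hunit hr hball he
  have hfN := mem_of_isFaceNormal hunit hr hball hf
  have hlor : lor e f = -1 / 2 := by
    refine (hgram e heN f hfN hef).resolve_right fun hlt => ?_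
    rcases Set.eq_empty_or_nonempty (((⋂ e ∈ N, halfSpace e) ∩ hyperplane e) ∩
      ((⋂ e ∈ N, halfSpace e) ∩ hyperplane f)) with h0 | ⟨y, hy⟩
    · rw [h0, spanRank, Set.image_empty, Submodule.span_empty, finrank_bot] at hrank
      omega
    · have hy0 : y.1 ≠ 0 := fun h => by
        have := y.2.1
        rw [h, lor_zero_left] at this
        norm_num at this
      have := (lor_lt_of_timelike_perp (p := y.1) (by rw [y.2.1]; norm_num) hy0 (hunit e heN)
        (hunit f hfN) hy.1.2 hy.2.2).1
      linarith
  rw [dihedralAngle, hlor, show (-1 / 2 : ℝ) = -(1 / 2) by norm_num, Real.arccos_neg,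
    ← Real.cos_pi_div_three, Real.arccos_cos (by positivity) (by linarith [Real.pi_pos])]
  ring

/-! ### The regular ideal tetrahedron and the regular ideal cube -/

/-- The outward normals of the cube. -/
noncomputable def cubeNormal (s : ℝ) (i : Fin 3) : Mink :=
  (1 / √2, EuclideanSpace.single i (s * √3 / √2))

lemma lor_cubeNormal (x : Mink) (s : ℝ) (i : Fin 3) :
    lor x (cubeNormal s i) = (s * (√3 * x.2 i) - x.1) / √2 := by
  simp only [lor, cubeNormal, EuclideanSpace.inner_single_right, conj_trivial]
  ring

lemma lor_cubeNormal_cubeNormal (s t : ℝ) (i j : Fin 3) :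
    lor (cubeNormal s i) (cubeNormal t j) = if i = j then 3 / 2 * (s * t) - 1 / 2 else -1 / 2 := by
  have h2 : √2 ^ 2 = 2 := Real.sq_sqrt (by norm_num)
  have h3 : √3 ^ 2 = 3 := Real.sq_sqrt (by norm_num)
  rw [lor_cubeNormal]
  split_ifs with hij
  · subst hij
    simp only [cubeNormal, PiLp.single_apply, if_true]
    field_simp
    rw [h2, h3]
    ring
  · simp only [cubeNormal, PiLp.single_apply, if_neg (Ne.symm hij)]
    field_simp
    rw [h2]
    ring

/-- The outward normals of the tetrahedron. -/
noncomputable def tetraNormal (t : Fin 3 → ℝ) : Mink :=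
  (1 / (2 * √2), WithLp.toLp 2 fun i => -(√3 * t i) / (2 * √2))

lemma lor_tetraNormal (x : Mink) (t : Fin 3 → ℝ) :
    lor x (tetraNormal t) =
      -(x.1 + √3 * (t 0 * x.2 0 + t 1 * x.2 1 + t 2 * x.2 2)) / (2 * √2) := by
  simp only [lor_eq_coords, tetraNormal]
  ring

lemma lor_tetraNormal_tetraNormal (s t : Fin 3 → ℝ) :
    lor (tetraNormal s) (tetraNormal t) = (3 * (s 0 * t 0 + s 1 * t 1 + s 2 * t 2) - 1) / 8 := by
  have h2 : √2 ^ 2 = 2 := Real.sq_sqrt (by norm_num)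
  have h3 : √3 ^ 2 = 3 := Real.sq_sqrt (by norm_num)
  rw [lor_tetraNormal]
  simp only [tetraNormal]
  field_simp
  rw [h2]
  ring_nf
  rw [h3]
  ring

/-- The vertex set is a product of three pairs, and convex hulls commute with products. -/
lemma convexHull_cubeVertices :
    convexHull ℝ cubeVertices = {y | ∀ i, y i ∈ Set.Icc (-(1 / √3)) (1 / √3)} := by
  have h : cubeVertices = (WithLp.linearEquiv 2 ℝ (Fin 3 → ℝ)).symm.toLinearMap ''
      Set.univ.pi fun _ => {-(1 / √3), 1 / √3} := by
    ext v
    constructor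
    · intro hv
      refine ⟨v.ofLp, ?_, rfl⟩
      intro i _
      exact (hv i).symm
    · rintro ⟨w, hw, rfl⟩ i
      exact (hw i trivial).symm
  rw [h, ← LinearMap.image_convexHull, convexHull_pi]
  have h0 : -(1 / √3) ≤ 1 / √3 := by
    have : 0 < 1 / √3 := by positivity
    linarith
  simp only [convexHull_pair, segment_eq_Icc h0]
  ext v
  constructor
  · rintro ⟨w, hw, rfl⟩ i
    exact hw i trivial
  · intro hv
    exact ⟨v.ofLp, fun i _ => hv i, rfl⟩

lemma mem_P₂ {x : H3} : x ∈ P₂ ↔ ∀ i, |√3 * x.1.2 i| ≤ x.1.1 := by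
  have h3 : 0 < √3 := by positivity
  have hx := x.2.2
  simp only [P₂, idealHull, convexHull_cubeVertices, Set.mem_ofPred_eq, Set.mem_Icc, PiLp.smul_apply,
    smul_eq_mul]
  refine forall_congr' fun i => ?_
  rw [← abs_le, abs_mul, abs_mul, abs_inv, abs_of_pos hx, abs_of_pos h3, inv_mul_le_iff₀ hx, ← mul_div_assoc, mul_one, le_div_iff₀ h3, mul_comm]

/-- The sign patterns of the vertices of the tetrahedron. -/
def tetraSign : Fin 4 → Fin 3 → ℝ :=
  ![![1, 1, 1], ![1, -1, -1], ![-1, 1, -1], ![-1, -1, 1]]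

lemma convexHull_tetrahedronVertices :
    convexHull ℝ tetrahedronVertices = {y | ∀ k, 0 ≤ 1 + √3 * (tetraSign k 0 * y 0 +
      tetraSign k 1 * y 1 + tetraSign k 2 * y 2)} := by
  have h3 : √3 ^ 2 = 3 := Real.sq_sqrt (by norm_num)
  have h30 : 0 < √3 := by positivity
  have hs : √3 * (1 / √3) = 1 := by field_simp
  apply Set.Subset.antisymm
  · apply convexHull_min
    · rintro v ⟨hv, hpos⟩ k
      have hp : 0 < 1 / √3 := by positivity
      rcases hv 0 with h0 | h0 <;> rcases hv 1 with h1 | h1 <;> rcases hv 2 with h2 | h2 <;>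
        rw [h0, h1, h2] at hpos ⊢ <;>
        first
        | (exfalso; have := mul_pos (mul_pos hp hp) hp; linarith)
        | (fin_cases k <;> simp [tetraSign] <;> positivity)
    · intro x hx y hy a b ha hb hab k
      have h1 := mul_nonneg ha (hx k)
      have h2 := mul_nonneg hb (hy k)
      simp only [PiLp.add_apply, PiLp.smul_apply, smul_eq_mul]
      have : b = 1 - a := by linarith
      subst this
      linarith
  · intro y hy
    -- A quarter of each of the four affine forms is the barycentric coordinate at the corresponding
    -- vertex.
    have h1 := (convex_convexHull ℝ tetrahedronVertices).sum_mem (t := Finset.univ)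
      (w := fun k => (1 + √3 * (tetraSign k 0 * y 0 + tetraSign k 1 * y 1 + tetraSign k 2 * y 2)) / 4)
      (z := fun k => (WithLp.toLp 2 fun i => tetraSign k i * (1 / √3) : E3))
      (fun k _ => div_nonneg (hy k) (by norm_num))
      (by simp [Fin.sum_univ_four, tetraSign]; ring)
      (fun k _ => subset_convexHull ℝ _ ?_)
    · convert h1 using 1
      ext i
      simp only [Fin.sum_univ_four, PiLp.add_apply, PiLp.smul_apply, smul_eq_mul]
      fin_cases i <;> simp [tetraSign] <;> field_simp <;> ring
    · have hp : 0 < 1 / √3 := by positivity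
      constructor
      · intro i
        fin_cases k <;> fin_cases i <;> simp [tetraSign]
      · fin_cases k <;> simp [tetraSign]

lemma mem_P₁ {x : H3} : x ∈ P₁ ↔ ∀ k, 0 ≤ x.1.1 + √3 * (tetraSign k 0 * x.1.2 0 +
    tetraSign k 1 * x.1.2 1 + tetraSign k 2 * x.1.2 2) := by
  have hx := x.2.2
  simp only [P₁, idealHull, convexHull_tetrahedronVertices, Set.mem_ofPred_eq, PiLp.smul_apply,
    smul_eq_mul]
  refine forall_congr' fun k => ?_
  rw [← mul_nonneg_iff_of_pos_left hx]
  have : x.1.1 * (1 + √3 * (tetraSign k 0 * (x.1.1⁻¹ * x.1.2 0) +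
      tetraSign k 1 * (x.1.1⁻¹ * x.1.2 1) + tetraSign k 2 * (x.1.1⁻¹ * x.1.2 2))) =
      x.1.1 + √3 * (tetraSign k 0 * x.1.2 0 +
    tetraSign k 1 * x.1.2 1 + tetraSign k 2 * x.1.2 2) := by
    field_simp
  rw [this]


open Classical in
/-- The normals of the cube. -/
noncomputable def cubeNormals : Finset Mink :=
  Finset.univ.image (cubeNormal 1) ∪ Finset.univ.image (cubeNormal (-1))

open Classical in
/-- The normals of the tetrahedron. -/
noncomputable def tetraNormals : Finset Mink :=
  Finset.univ.image fun k => tetraNormal (tetraSign k)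

lemma mem_cubeNormals {f : Mink} :
    f ∈ cubeNormals ↔ (∃ i, cubeNormal 1 i = f) ∨ ∃ i, cubeNormal (-1) i = f := by
  simp [cubeNormals]

lemma mem_tetraNormals {f : Mink} : f ∈ tetraNormals ↔ ∃ k, tetraNormal (tetraSign k) = f := by
  simp [tetraNormals]

lemma P₂_eq_setOf : P₂ = {x | (∀ i, lor x.1 (cubeNormal 1 i) ≤ 0) ∧
    ∀ i, lor x.1 (cubeNormal (-1) i) ≤ 0} := by
  ext x
  have h2 : 0 < √2 := by positivity
  have h : ∀ s i, lor x.1 (cubeNormal s i) ≤ 0 ↔ s * (√3 * x.1.2 i) ≤ x.1.1 := fun s i => by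
    rw [lor_cubeNormal, div_le_iff₀ h2, zero_mul, sub_nonpos]
  simp only [mem_P₂, Set.mem_ofPred_eq, h, abs_le, ← forall_and]
  refine forall_congr' fun i => ?_
  constructor
  · rintro ⟨h1, h2⟩; constructor <;> linarith
  · rintro ⟨h1, h2⟩; constructor <;> linarith

lemma P₂_eq : P₂ = ⋂ f ∈ cubeNormals, halfSpace f := by
  ext x
  rw [P₂_eq_setOf, mem_polyhedron]
  constructor
  · rintro ⟨h1, h2⟩ f hf
    rcases mem_cubeNormals.mp hf with ⟨i, rfl⟩ | ⟨i, rfl⟩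
    · exact h1 i
    · exact h2 i
  · exact fun h => ⟨fun i => h _ (mem_cubeNormals.mpr (.inl ⟨i, rfl⟩)),
      fun i => h _ (mem_cubeNormals.mpr (.inr ⟨i, rfl⟩))⟩

lemma P₁_eq : P₁ = ⋂ f ∈ tetraNormals, halfSpace f := by
  ext x
  have h2 : 0 < 2 * √2 := by positivity
  have h : ∀ k, lor x.1 (tetraNormal (tetraSign k)) ≤ 0 ↔ 0 ≤ x.1.1 + √3 * (tetraSign k 0 * x.1.2 0 +
    tetraSign k 1 * x.1.2 1 + tetraSign k 2 * x.1.2 2) := fun k => by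
    rw [lor_tetraNormal, div_le_iff₀ h2, zero_mul, neg_nonpos]
  rw [mem_polyhedron, mem_P₁]
  constructor
  · intro hx f hf
    obtain ⟨k, rfl⟩ := mem_tetraNormals.mp hf
    exact (h k).mpr (hx k)
  · exact fun hx k => (h k).mp (hx _ (mem_tetraNormals.mpr ⟨k, rfl⟩))

lemma P₁_eq_setOf : P₁ = {x | (∀ i : Fin 3, lor x.1 (tetraNormal (tetraSign i.succ)) ≤ 0) ∧
    ∀ _ : Unit, lor x.1 (tetraNormal (tetraSign 0)) ≤ 0} := by
  ext x
  rw [P₁_eq, mem_polyhedron]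
  constructor
  · exact fun hx => ⟨fun i => hx _ (mem_tetraNormals.mpr ⟨_, rfl⟩),
      fun _ => hx _ (mem_tetraNormals.mpr ⟨_, rfl⟩)⟩
  · rintro ⟨h1, h2⟩ f hf
    obtain ⟨k, rfl⟩ := mem_tetraNormals.mp hf
    exact Fin.cases (h2 ()) h1 k

lemma frame_cubeNormal : Frame (cubeNormal 1) := by
  refine ⟨fun i => ?_, fun i j hij => ?_, ?_⟩
  · rw [lor_cubeNormal_cubeNormal, if_pos rfl]; norm_num
  · rw [lor_cubeNormal_cubeNormal, if_neg hij]
  · simp only [cubeNormal, Prod.fst_add]; positivity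

lemma lor_tetraNormal_tetraSign (k l : Fin 4) :
    lor (tetraNormal (tetraSign k)) (tetraNormal (tetraSign l)) = if k = l then 1 else -1 / 2 := by
  rw [lor_tetraNormal_tetraNormal]
  fin_cases k <;> fin_cases l <;> simp [tetraSign, Fin.ext_iff] <;> norm_num

lemma frame_tetraNormal : Frame fun i : Fin 3 => tetraNormal (tetraSign i.succ) := by
  refine ⟨fun i => ?_, fun i j hij => ?_, ?_⟩
  · rw [lor_tetraNormal_tetraSign, if_pos rfl]
  · rw [lor_tetraNormal_tetraSign, if_neg ((Fin.succ_injective _).ne hij)]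
  · simp only [tetraNormal, Prod.fst_add]; positivity

lemma P₁_subset_P₂ : P₁ ⊆ P₂ := fun _ hx => convexHull_mono (fun _ hv => hv.1) hx

/-- Time below `√(10 / 9)` means that the space part has norm below `1 / 3`, so each form is at
least `1 - 3 * (1 / 3)`. The ball also serves for the cube, which contains the tetrahedron. -/
lemma ball_subset_P₁ : {y | hdist (lift 0) y < Real.arcosh (√(10 / 9))} ⊆ P₁ := by
  intro y hy
  have h1 : (1 : ℝ) ≤ √(10 / 9) := Real.le_sqrt_of_sq_le (by norm_num)
  have h10 : √(10 / 9) ^ 2 = (10 / 9 : ℝ) := Real.sq_sqrt (by norm_num)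
  have hl : -lor (lift 0).1 y.1 = y.1.1 := by simp [lor, lift]
  have hyy := y.2.1
  rw [lor_eq_coords] at hyy
  have hy0 := y.2.2
  have hy1 : 1 ≤ y.1.1 := by nlinarith [sq_nonneg (y.1.2 0), sq_nonneg (y.1.2 1), sq_nonneg (y.1.2 2)]
  have hlt : y.1.1 < √(10 / 9) := by
    change Real.arcosh (-lor (lift 0).1 y.1) < _ at hy
    rwa [hl, Real.arcosh_lt_arcosh (by linarith) (by linarith)] at hy
  have hsq : y.1.2 0 ^ 2 + y.1.2 1 ^ 2 + y.1.2 2 ^ 2 < 1 / 9 := by nlinarith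
  have h3 : √3 ^ 2 = 3 := Real.sq_sqrt (by norm_num)
  rw [mem_P₁]
  intro k
  have key : ∀ t : ℝ, t ^ 2 ≤ 3 * (y.1.2 0 ^ 2 + y.1.2 1 ^ 2 + y.1.2 2 ^ 2) →
      0 ≤ y.1.1 + √3 * t := by
    intro t ht
    have : |√3 * t| ≤ 1 := by
      rw [← sq_le_one_iff_abs_le_one, mul_pow, h3]; linarith
    linarith [(abs_le.mp this).1]
  apply key
  have hk : ∀ i, tetraSign k i ^ 2 = 1 := by
    intro i; fin_cases k <;> fin_cases i <;> simp [tetraSign]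
  have h0 := hk 0
  have h1 := hk 1
  have h2 := hk 2
  generalize tetraSign k 0 = a at *
  generalize tetraSign k 1 = b at *
  generalize tetraSign k 2 = c at *
  have e : ∀ p q r : ℝ, (a * p + b * q + c * r) ^ 2 = 3 * (a ^ 2 * p ^ 2 + b ^ 2 * q ^ 2 + c ^ 2 * r ^ 2) -
      ((a * p - b * q) ^ 2 + (a * p - c * r) ^ 2 + (b * q - c * r) ^ 2) := by intros; ring
  rw [e, h0, h1, h2]
  nlinarith [sq_nonneg (a * y.1.2 0 - b * y.1.2 1), sq_nonneg (a * y.1.2 0 - c * y.1.2 2),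
    sq_nonneg (b * y.1.2 1 - c * y.1.2 2)]

lemma isEquiangular_P₂ (hvol : vol P₂ < ⊤) : IsEquiangular (Real.pi / 3) P₂ := by
  rw [P₂_eq] at hvol ⊢
  refine isEquiangular_of_gram ?_ (Real.arcosh_pos (Real.lt_sqrt_of_sq_lt (by norm_num)))
    ((ball_subset_P₁.trans P₁_subset_P₂).trans P₂_eq.le) hvol ?_
  · intro f hf
    rcases mem_cubeNormals.mp hf with ⟨i, rfl⟩ | ⟨i, rfl⟩ <;>
      rw [lor_cubeNormal_cubeNormal, if_pos rfl] <;> norm_num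
  · intro f hf g hg hfg
    rcases mem_cubeNormals.mp hf with ⟨i, rfl⟩ | ⟨i, rfl⟩ <;>
      rcases mem_cubeNormals.mp hg with ⟨j, rfl⟩ | ⟨j, rfl⟩ <;>
      rw [lor_cubeNormal_cubeNormal] <;> by_cases hij : i = j
    all_goals first | rw [if_neg hij]; norm_num | rw [if_pos hij]; norm_num
    all_goals exact absurd (congrArg _ hij) hfg

lemma isEquiangular_P₁ (hvol : vol P₂ < ⊤) : IsEquiangular (Real.pi / 3) P₁ := by
  have hvol := (measure_mono P₁_subset_P₂).trans_lt hvol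
  rw [P₁_eq] at hvol ⊢
  refine isEquiangular_of_gram ?_ (Real.arcosh_pos (Real.lt_sqrt_of_sq_lt (by norm_num)))
    (ball_subset_P₁.trans P₁_eq.le) hvol ?_
  · intro f hf
    obtain ⟨k, rfl⟩ := mem_tetraNormals.mp hf
    rw [lor_tetraNormal_tetraSign, if_pos rfl]
  · intro f hf g hg hfg
    obtain ⟨k, rfl⟩ := mem_tetraNormals.mp hf
    obtain ⟨l, rfl⟩ := mem_tetraNormals.mp hg
    rw [lor_tetraNormal_tetraSign, if_neg fun h => hfg (by rw [h])]
    exact .inl rfl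

lemma vol_P₁_lt_vol_P₂ (hvol : vol P₂ < ⊤) : vol P₁ < vol P₂ := by
  have hm1 : MeasurableSet P₁ := P₁_eq ▸ measurableSet_polyhedron _
  have hm2 : MeasurableSet P₂ := P₂_eq ▸ measurableSet_polyhedron _
  have hpos : 0 < vol (P₂ \ P₁) := by
    rw [vol_apply (hm2.diff hm1)]
    set U : Set E3 := {y | (∀ i, |√3 * y i| < √(1 + ‖y‖ ^ 2)) ∧
      √(1 + ‖y‖ ^ 2) + √3 * (y 0 + y 1 + y 2) < 0} with hU
    have hUo : IsOpen U := by
      have : U = (⋂ i, {y : E3 | |√3 * y i| < √(1 + ‖y‖ ^ 2)}) ∩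
          {y | √(1 + ‖y‖ ^ 2) + √3 * (y 0 + y 1 + y 2) < 0} := by
        ext y; simp [hU]
      rw [this]
      exact (isOpen_iInter_of_finite fun i => isOpen_lt (by fun_prop) (by fun_prop)).inter
        (isOpen_lt (by fun_prop) (by fun_prop))
    have hUn : U.Nonempty := by
      -- This point has time coordinate 2. It is in the open cube as `√3 < 2`, and strictly outside
      -- the tetrahedron as `2 < 3 * √3`.
      refine ⟨WithLp.toLp 2 fun _ => -1, ?_⟩
      have hn : √(1 + ‖(WithLp.toLp 2 fun _ => -1 : E3)‖ ^ 2) = 2 := by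
        rw [EuclideanSpace.norm_sq_eq, Real.sqrt_eq_iff_mul_self_eq (by positivity) (by norm_num)]
        norm_num
      have h3 : √3 < 2 := by rw [Real.sqrt_lt' (by norm_num)]; norm_num
      have h3' : 1 < √3 := Real.lt_sqrt_of_sq_lt (by norm_num)
      refine ⟨fun i => ?_, ?_⟩
      · rw [hn]
        simpa [abs_of_pos (show 0 < √3 by linarith)] using h3
      · rw [hn]
        simp only
        linarith
    have hsub : U ⊆ lift ⁻¹' (P₂ \ P₁) := by
      rintro y ⟨h1, h2⟩
      refine ⟨mem_P₂.mpr fun i => (h1 i).le, fun h => ?_⟩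
      have := mem_P₁.mp h 0
      simp only [tetraSign, Matrix.cons_val_zero, Matrix.cons_val_one, Matrix.cons_val, one_mul,
        lift] at this
      linarith
    refine lt_of_lt_of_le ?_ (lintegral_mono_set hsub)
    rw [setLIntegral_pos_iff (by fun_prop)]
    have : (Function.support fun y : E3 => ENNReal.ofReal (1 / √(1 + ‖y‖ ^ 2))) = Set.univ := by
      ext y
      simp only [Function.mem_support, Set.mem_univ, iff_true]
      have : 0 < 1 / √(1 + ‖y‖ ^ 2) := by positivity
      simpa using this
    rw [this, Set.univ_inter]
    exact hUo.measure_pos volume hUn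
  have hd := measure_sdiff_add_inter (μ := vol) P₂ hm1
  rw [Set.inter_eq_self_of_subset_right P₁_subset_P₂] at hd
  rw [← hd, add_comm]
  exact ENNReal.lt_add_right ((measure_mono P₁_subset_P₂).trans_lt hvol).ne hpos.ne'

/-! ### Volume of the cube -/

lemma integral_quintic (c₀ c₁ c₂ c₃ c₄ c₅ α β : ℝ) :
    ∫ b in α..β, (c₀ + c₁ * b + c₂ * b ^ 2 + c₃ * b ^ 3 + c₄ * b ^ 4 + c₅ * b ^ 5) =
      c₀ * (β - α) + c₁ / 2 * (β ^ 2 - α ^ 2) + c₂ / 3 * (β ^ 3 - α ^ 3) +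
        c₃ / 4 * (β ^ 4 - α ^ 4) + c₄ / 5 * (β ^ 5 - α ^ 5) + c₅ / 6 * (β ^ 6 - α ^ 6) := by
  have hp : ∀ (b : ℝ) (n : ℕ) (c : ℝ), HasDerivAt (fun b => c * b ^ n) (c * (n * b ^ (n - 1))) b :=
    fun b n c => (hasDerivAt_pow n b).const_mul c
  rw [intervalIntegral.integral_eq_sub_of_hasDerivAt (f := fun b => c₀ * b ^ 1 + c₁ / 2 * b ^ 2 +
    c₂ / 3 * b ^ 3 + c₃ / 4 * b ^ 4 + c₄ / 5 * b ^ 5 + c₅ / 6 * b ^ 6)]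
  · ring
  · intro b _
    have h := (((((hp b 1 c₀).add (hp b 2 (c₁ / 2))).add (hp b 3 (c₂ / 3))).add
      (hp b 4 (c₃ / 4))).add (hp b 5 (c₄ / 5))).add (hp b 6 (c₅ / 6))
    refine h.congr_deriv ?_
    norm_num
    ring
  · exact Continuous.intervalIntegrable (by fun_prop) _ _

/-- A fundamental domain of the symmetries of the cube, in the chart of a vertex. -/
def sector : Set (ℝ × ℝ × ℝ) :=
  {p | (0 ≤ p.1 ∧ p.1 ≤ p.2.1 ∧ p.1 + 2 * p.2.1 ≤ 1) ∧ 0 < p.2.2 ∧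
    p.2.2 * (1 - 2 * (p.1 ^ 2 + p.1 * p.2.1 + p.2.1 ^ 2)) ≤ 3 / 2}

lemma measurableSet_sector : MeasurableSet sector := by
  have h0 : Measurable fun p : ℝ × ℝ × ℝ => p.1 := measurable_fst
  have h1 : Measurable fun p : ℝ × ℝ × ℝ => p.2.1 := measurable_snd.fst
  have h2 : Measurable fun p : ℝ × ℝ × ℝ => p.2.2 := measurable_snd.snd
  have h3 : Measurable fun p : ℝ × ℝ × ℝ => p.1 + 2 * p.2.1 := by fun_prop
  have h4 : Measurable fun p : ℝ × ℝ × ℝ =>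
    p.2.2 * (1 - 2 * (p.1 ^ 2 + p.1 * p.2.1 + p.2.1 ^ 2)) := by fun_prop
  exact ((measurableSet_le measurable_const h0).inter ((measurableSet_le h0 h1).inter
    (measurableSet_le h3 measurable_const))).inter ((measurableSet_lt measurable_const h2).inter
      (measurableSet_le h4 measurable_const))

/-- With `q = a ^ 2 + a * b + b ^ 2 ≤ 1 / 3` one has `(1 - 2 * q) * (1 + 2 * q + 12 * q ^ 2) = 1 + 8
* q ^ 2 * (1 - 3 * q) ≥ 1`. The polynomial majorant of `1 / (1 - 2 * q)` makes the volume bound a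
rational integral. -/
lemma le_quartic_of_mem_sector {a b w : ℝ} (h : (a, b, w) ∈ sector) :
    w ≤ 3 / 2 * (1 + 2 * (a ^ 2 + a * b + b ^ 2) + 12 * (a ^ 2 + a * b + b ^ 2) ^ 2) := by
  obtain ⟨⟨h1, h2, h3⟩, h4, h5⟩ := h
  simp only at h1 h2 h3 h4 h5
  have hq0 : 0 ≤ a ^ 2 + a * b + b ^ 2 := by nlinarith
  have hq : 3 * (a ^ 2 + a * b + b ^ 2) ≤ 1 := by
    nlinarith [mul_nonneg (sub_nonneg.mpr h2) (show 0 ≤ b + 2 * a by linarith)]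
  generalize a ^ 2 + a * b + b ^ 2 = q at *
  have hf : 0 ≤ 1 + 2 * q + 12 * q ^ 2 := by positivity
  have h6 := mul_le_mul_of_nonneg_right h5 hf
  have h7 : 0 ≤ w * (q ^ 2 * (1 - 3 * q)) :=
    mul_nonneg h4.le (mul_nonneg (sq_nonneg q) (by linarith))
  nlinarith

lemma volume_sector_le : volume sector ≤ ENNReal.ofReal (143 / 720) := by
  have hinner : ∀ a : ℝ, ∫ b in a..(1 - a) / 2,
      3 / 2 * (1 + 2 * (a ^ 2 + a * b + b ^ 2) + 12 * (a ^ 2 + a * b + b ^ 2) ^ 2) =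
      79 / 80 + -9 / 4 * a + 9 / 4 * a ^ 2 + -27 / 4 * a ^ 3 + 81 / 16 * a ^ 4 +
        -729 / 10 * a ^ 5 := by
    intro a
    have := integral_quintic (3 / 2 + 3 * a ^ 2 + 18 * a ^ 4) (3 * a + 36 * a ^ 3)
      (3 + 54 * a ^ 2) (36 * a) 18 0 a ((1 - a) / 2)
    refine (intervalIntegral.integral_congr fun b _ => ?_).trans (this.trans ?_)
    · ring
    · ring
  have houter : ∫ a in (0 : ℝ)..1 / 3, (79 / 80 + -9 / 4 * a + 9 / 4 * a ^ 2 + -27 / 4 * a ^ 3 +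
      81 / 16 * a ^ 4 + -729 / 10 * a ^ 5) = 143 / 720 := by
    rw [integral_quintic]; norm_num
  rw [← houter]
  refine volume_le_of_slices measurableSet_sector (by norm_num) (by fun_prop) ?_ ?_ ?_
  · intro a ha
    rw [← hinner]
    refine intervalIntegral.integral_nonneg (by linarith [ha.2]) fun b hb => ?_
    have := ha.1
    have : 0 ≤ b := this.trans hb.1
    positivity
  · intro a ha
    rw [← hinner]
    refine volume_le_of_slices (measurable_prodMk_left measurableSet_sector) (by linarith [ha.2])
      (by fun_prop) ?_ ?_ ?_
    · intro b hb
      have := ha.1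
      have : 0 ≤ b := this.trans hb.1
      positivity
    · intro b hb
      refine (measure_mono (t := Set.Icc 0 (3 / 2 * (1 + 2 * (a ^ 2 + a * b + b ^ 2) +
        12 * (a ^ 2 + a * b + b ^ 2) ^ 2))) ?_).trans (by rw [Real.volume_Icc, sub_zero])
      intro w hw
      exact ⟨(show (a, b, w) ∈ sector from hw).2.1.le, le_quartic_of_mem_sector hw⟩
    · rintro ⟨b, w⟩ hp
      obtain ⟨⟨h1, h2, h3⟩, -⟩ := hp
      simp only at h1 h2 h3
      exact ⟨h2, by simp only; linarith⟩
  · rintro ⟨a, b, w⟩ ⟨⟨h1, h2, h3⟩, -⟩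
    simp only at h1 h2 h3
    exact ⟨h1, by simp only; linarith⟩

/-- The coordinates of `E3`. -/
def coordsE3' (q : E3) : ℝ × ℝ × ℝ := (q 0, q 1, q 2)

lemma measurePreserving_coordsE3' : MeasurePreserving coordsE3' volume volume := by
  have h1 := EuclideanSpace.volume_preserving_symm_measurableEquiv_toLp (Fin 3)
  have h2 := volume_preserving_piFinSuccAbove (fun _ : Fin 3 => ℝ) 0
  have h3 := volume_preserving_finTwoArrow ℝ
  have h4 := ((MeasurePreserving.id (volume : Measure ℝ)).prod h3).comp (h2.comp h1)
  exact h4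

/-- The points of the polyhedron of a frame in a fundamental domain of a cube. -/
def frameSector (e : Fin 3 → Mink) : Set H3 :=
  {x | (lor x.1 (e 0) ≤ 0 ∧ lor x.1 (e 1) ≤ lor x.1 (e 0) ∧ lor x.1 (e 2) ≤ lor x.1 (e 1)) ∧
    (lor x.1 (e 0) + lor x.1 (e 1) + lor x.1 (e 2)) ^ 2 - 2 * (lor x.1 (e 0) ^ 2 +
      lor x.1 (e 0) * lor x.1 (e 1) + lor x.1 (e 1) ^ 2) ≤ 3 / 2}

lemma measurableSet_frameSector (e : Fin 3 → Mink) : MeasurableSet (frameSector e) := by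
  have hm : ∀ i, Measurable fun x : H3 => lor x.1 (e i) := fun i =>
    (Continuous.lor' continuous_id continuous_const).measurable.comp measurable_subtype_coe
  have h0 := hm 0
  have h1 := hm 1
  have h2 := hm 2
  have h3 : Measurable fun x : H3 => (lor x.1 (e 0) + lor x.1 (e 1) + lor x.1 (e 2)) ^ 2 -
    2 * (lor x.1 (e 0) ^ 2 + lor x.1 (e 0) * lor x.1 (e 1) + lor x.1 (e 1) ^ 2) := by fun_prop
  exact ((measurableSet_le h0 measurable_const).inter ((measurableSet_le h1 h0).inter
    (measurableSet_le h2 h1))).inter (measurableSet_le h3 measurable_const)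

lemma Frame.vol_frameSector_le {e : Fin 3 → Mink} (h : Frame e) :
    ENNReal.ofReal (√3) * vol (frameSector e) ≤ ENNReal.ofReal (143 / 720) := by
  rw [← h.volume_chart_image (measurableSet_frameSector e)]
  refine le_trans ?_ volume_sector_le
  rw [← measurePreserving_coordsE3'.measure_preimage measurableSet_sector.nullMeasurableSet]
  apply measure_mono
  rintro _ ⟨x, ⟨⟨h0, h1, h2⟩, h3⟩, rfl⟩
  have hv := h.lor_apex_neg x
  change (lor x.1 (e 0) / lor x.1 (e 0 + e 1 + e 2), lor x.1 (e 1) / lor x.1 (e 0 + e 1 + e 2),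
    lor x.1 (e 0 + e 1 + e 2) ^ 2) ∈ sector
  rw [lor_add_right, lor_add_right] at hv ⊢
  generalize lor x.1 (e 0) = X at *
  generalize lor x.1 (e 1) = Y at *
  generalize lor x.1 (e 2) = Z at *
  have hv' : X + Y + Z ≠ 0 := hv.ne
  refine ⟨⟨div_nonneg_of_nonpos h0 hv.le, ?_, ?_⟩, by positivity, ?_⟩
  · exact div_le_div_of_nonpos_of_le hv.le h1
  · simp only
    rw [← mul_div_assoc, ← add_div, div_le_one_of_neg hv]
    linarith
  · simp only
    refine le_trans (le_of_eq ?_) h3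
    field_simp

/-- The frame of the vertex of the cube in a given octant. -/
noncomputable def cubeFrame (s : Fin 3 → Bool) (i : Fin 3) : Mink :=
  cubeNormal (if s i then 1 else -1) i

lemma frame_cubeFrame (s : Fin 3 → Bool) : Frame (cubeFrame s) := by
  refine ⟨fun i => ?_, fun i j hij => ?_, ?_⟩
  · rw [cubeFrame, lor_cubeNormal_cubeNormal, if_pos rfl]
    split_ifs <;> norm_num
  · rw [cubeFrame, cubeFrame, lor_cubeNormal_cubeNormal, if_neg hij]
  · simp only [cubeFrame, cubeNormal, Prod.fst_add]; positivity

/-- The signs of the space coordinates choose the octant, hence a vertex of the cube, and sorting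
the frame pairings chooses one of six sectors there: 48 pieces in all. -/
lemma P₂_subset_iUnion : P₂ ⊆ ⋃ p : (Fin 3 → Bool) × Equiv.Perm (Fin 3),
    frameSector (cubeFrame p.1 ∘ p.2) := by
  intro x hx
  rw [mem_P₂] at hx
  have h2 : √2 ^ 2 = 2 := Real.sq_sqrt (by norm_num)
  have h3 : √3 ^ 2 = 3 := Real.sq_sqrt (by norm_num)
  have h20 : 0 < √2 := by positivity
  set s : Fin 3 → Bool := fun i => decide (0 ≤ √3 * x.1.2 i) with hs
  set X : Fin 3 → ℝ := fun i => lor x.1 (cubeFrame s i) with hX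
  have hU : ∀ i, |√3 * x.1.2 i| = x.1.1 + √2 * X i := by
    intro i
    simp only [hX, cubeFrame, lor_cubeNormal, hs, decide_eq_true_eq]
    split_ifs with hi
    · rw [abs_of_nonneg hi]; field_simp; ring
    · rw [abs_of_neg (not_le.mp hi)]; field_simp; ring
  have hXneg : ∀ i, X i ≤ 0 := by
    intro i
    have := hx i
    rw [hU] at this
    by_contra! hcon
    have := mul_pos h20 hcon
    linarith
  set π := Tuple.sort fun i => -X i with hπ
  have hmono := Tuple.monotone_sort fun i => -X i
  have m1 : X (π 1) ≤ X (π 0) := by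
    have := hmono (show (0 : Fin 3) ≤ 1 by decide)
    simp only [Function.comp_apply] at this
    linarith
  have m2 : X (π 2) ≤ X (π 1) := by
    have := hmono (show (1 : Fin 3) ≤ 2 by decide)
    simp only [Function.comp_apply] at this
    linarith
  have hsum : -(2 * √2 * x.1.1) * (X (π 0) + X (π 1) + X (π 2)) -
      2 * (X (π 0) ^ 2 + X (π 1) ^ 2 + X (π 2) ^ 2) = 3 := by
    have e1 := Equiv.sum_comp π X
    have e2 := Equiv.sum_comp π fun i => X i ^ 2
    rw [Fin.sum_univ_three, Fin.sum_univ_three] at e1 e2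
    rw [e1, e2]
    have hxx := x.2.1
    rw [lor_eq_coords] at hxx
    have hsq : ∀ i, 3 * x.1.2 i ^ 2 = (x.1.1 + √2 * X i) ^ 2 := fun i => by
      rw [← hU, sq_abs, mul_pow, h3]
    have s0 := hsq 0
    have s1 := hsq 1
    have s2 := hsq 2
    simp only [add_sq, mul_pow, h2] at s0 s1 s2
    linarith
  refine Set.mem_iUnion.mpr ⟨(s, π), ⟨⟨hXneg _, m1, m2⟩, ?_⟩⟩
  change (X (π 0) + X (π 1) + X (π 2)) ^ 2 - 2 * (X (π 0) ^ 2 + X (π 0) * X (π 1) + X (π 1) ^ 2) ≤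
    3 / 2
  have hpos : 0 ≤ x.1.1 + √2 * X (π 2) := by rw [← hU]; exact abs_nonneg _
  have n0 := hXneg (π 0)
  have n1 := hXneg (π 1)
  have n2 := hXneg (π 2)
  -- The smallest of the `|√3 * x.1.2 i|` is nonnegative. Eliminating the time coordinate with
  -- `hsum`, which is the equation of the hyperboloid, turns this into the last inequality of
  -- `frameSector`.
  have key : 0 ≤ (√2 * (x.1.1 + √2 * X (π 2))) * -(X (π 0) + X (π 1) + X (π 2)) :=
    mul_nonneg (mul_nonneg h20.le hpos) (by linarith)
  have hexp : √2 * (x.1.1 + √2 * X (π 2)) = √2 * x.1.1 + 2 * X (π 2) := by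
    linear_combination X (π 2) * h2
  rw [hexp] at key
  nlinarith

/-- There are `8 * 6 = 48` sectors of chart volume at most `143 / 720`, in total `143 / 15`. -/
theorem vol_P₂_lt : ENNReal.ofReal (√3) * vol P₂ < 10 := by
  calc ENNReal.ofReal (√3) * vol P₂
      ≤ ENNReal.ofReal (√3) * ∑ p : (Fin 3 → Bool) × Equiv.Perm (Fin 3),
          vol (frameSector (cubeFrame p.1 ∘ p.2)) := by
        gcongr
        exact (measure_mono P₂_subset_iUnion).trans (measure_iUnion_fintype_le _ _)
    _ ≤ ∑ _p : (Fin 3 → Bool) × Equiv.Perm (Fin 3), ENNReal.ofReal (143 / 720) := by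
        rw [Finset.mul_sum]
        exact Finset.sum_le_sum fun p _ => ((frame_cubeFrame p.1).comp_perm p.2).vol_frameSector_le
    _ = ENNReal.ofReal (143 / 15) := by
        rw [Finset.sum_const, Finset.card_univ, Fintype.card_prod, Fintype.card_perm,
          Fintype.card_fun, Fintype.card_bool, Fintype.card_fin, nsmul_eq_mul,
          ← ENNReal.ofReal_natCast, ← ENNReal.ofReal_mul (by positivity)]
        norm_num [Nat.factorial]
    _ < 10 := by
        rw [← ENNReal.ofReal_ofNat, ENNReal.ofReal_lt_ofReal_iff (by norm_num)]
        norm_num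

end HypPoly

/-! ### The main theorem -/

open HypPoly in
theorem mainTheorem1 :
    HypPoly.IsEquiangular (Real.pi / 3) HypPoly.P₁ ∧
    HypPoly.IsEquiangular (Real.pi / 3) HypPoly.P₂ ∧
    HypPoly.vol HypPoly.P₁ < HypPoly.vol HypPoly.P₂ ∧
    ∀ P : Set HypPoly.H3, HypPoly.IsEquiangular (Real.pi / 3) P →
      (HypPoly.Congruent P HypPoly.P₁ ∧ HypPoly.vol P = HypPoly.vol HypPoly.P₁) ∨
      (HypPoly.Congruent P HypPoly.P₂ ∧ HypPoly.vol P = HypPoly.vol HypPoly.P₂) ∨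
      HypPoly.vol HypPoly.P₂ < HypPoly.vol P := by
  have h3 : ENNReal.ofReal (√3) ≠ 0 := by simp
  -- The numerical bound also supplies the finite volume required of both model polyhedra.
  have hvol : vol P₂ < ⊤ := by
    rw [lt_top_iff_ne_top]
    intro h
    have := vol_P₂_lt
    rw [h, ENNReal.mul_top h3] at this
    exact not_top_lt this
  refine ⟨isEquiangular_P₁ hvol, isEquiangular_P₂ hvol, vol_P₁_lt_vol_P₂ hvol, fun P hP => ?_⟩
  obtain ⟨N, hN, rfl⟩ := hP.exists_normalSystem
  rcases hN.trichotomy with ⟨e, k, he, hk, hke, hPe⟩ | ⟨e, a, he, ha, hae, hPe⟩ | h10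
  · refine .inl (he.congruent frame_tetraNormal (f := fun _ => k)
      (f' := fun _ => tetraNormal (tetraSign 0)) (fun _ => hk) (fun _ => ?_) (fun _ i => ?_)
      (fun _ => ?_) hPe P₁_eq_setOf)
    · rw [lor_tetraNormal_tetraSign, if_pos rfl]
    · rw [hke, lor_tetraNormal_tetraSign, if_neg (Fin.succ_ne_zero i).symm]
    · simp only [lor_add_right, hke]; norm_num
  · refine .inr (.inl (he.congruent frame_cubeNormal (f := a) (f' := cubeNormal (-1)) ha
      (fun i => ?_) (fun i j => ?_) (fun i => ?_) hPe P₂_eq_setOf))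
    · rw [lor_cubeNormal_cubeNormal, if_pos rfl]; norm_num
    · rw [hae, lor_cubeNormal_cubeNormal]; norm_num
    · simp only [lor_add_right, hae]
      fin_cases i <;> simp [Fin.ext_iff] <;> norm_num
  · refine .inr (.inr ?_)
    by_contra! hcon
    have : ENNReal.ofReal (√3) * vol (⋂ e ∈ N, halfSpace e) ≤ ENNReal.ofReal (√3) * vol P₂ := by
      gcongr
    exact absurd (h10.trans this) (not_le.mpr vol_P₂_lt)
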